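/- Let $k$ be a field; all sheaves are sheaves of $k$-vector spaces. For $\theta\in S^1=\mathbb R/2\pi\mathbb Z$ and $\lambda\in\mathbb R$ put $\mathcal H_{\theta,\lambda}=\{x\in\mathbb C:\operatorname{Re}(xe^{-i\theta})>\lambda\}$, with closure $\overline{\mathcal H}_{\theta,\lambda}$, and for $z=e^{\lambda}e^{i\theta}\in\mathbb C^*$ put $\mathcal H_z=\mathcal H_{\theta,\lambda}$. For $\xi\in\mathbb C$ let $S_\xi=\{\rho e^{i\theta}\in\mathbb C^*:\rho=\exp(\operatorname{Re}(\xi e^{-i\theta}))\}$; write $S_\xi<z$ if $z=\rho e^{i\theta}$ with $\rho>\exp(\operatorname{Re}(\xi e^{-i\theta}))$, and $\xi_1<_\theta\xi_2$ if $\operatorname{Re}(\xi_1e^{-i\theta})<\operatorname{Re}(\xi_2e^{-i\theta})$. Let $\pi\colon\mathbb C^*\to S^1$, $\rho e^{i\theta}\mapsto\theta$. *Constructible sheaves.* $\mathrm{Constr}_0$ is the category of sheaves $\mathcal F$ on $\mathbb C$ with finite-dimensional stalks that are locally constant outside a finite set (whose points are the singularities) and satisfy $H^n(\mathbb C,\mathcal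 F)=0$ for all $n\ge 0$. *Co-Stokes structures.* A co-Stokes structure of exponential type with exponents $c_1,\dots,c_n\in\mathbb C$ is a local system $\mathcal L$ of finite-dimensional vector spaces on $S^1$ with subsheaves $\mathcal L_{<\xi}\subset\mathcal L$ ($\xi\in\mathbb C$) such that $\xi_1<_\theta\xi_2$ implies $\mathcal L_{<\xi_1,\theta}\subset\mathcal L_{<\xi_2,\theta}$, and such that there are local systems $\operatorname{gr}_{c_i}$ on $S^1$ and, locally on $S^1$, isomorphisms $\mathcal L\simeq\bigoplus_i\operatorname{gr}_{c_i}$ carrying, for every $\xi$, the stalk $\mathcal L_{<\xi,\theta}$ to $\bigoplus_{c_i<_\theta\xi}\operatorname{gr}_{c_i,\theta}$. *Co-Stokes sheaves.* A co-Stokes sheaf with exponents $c_1,\dots,c_n$ is a pair $(\mathcal L,\mathcal G)$ of a local system $\mathcal L$ of finite-dimensional vector spaces on $\mathbb C^*$ and a subsheaf $\mathcal G$ such that every point has an open neighbourhood $U$ on which $\mathcal L|_U=\bigoplus_i\operatorname{gr}_{c_i}$ with constant sheaves $\operatorname{gr}_{c_i}$ and $\mathcal G_{z}=\bigoplus_{S_{c_i}<z}\operatorname{gr}_{c_i}$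 for all $z\in U$. Morphisms are morphisms of local systems that carry subsheaf to subsheaf. *The functor $\Psi$.* For $\mathcal F\in\mathrm{Constr}_0$ let $\Psi(\mathcal F)=(\mathcal L,\mathcal L_<)$ with $\mathcal L=\operatorname{colim}_{\lambda\to+\infty}R^0q_{\lambda*}p_\lambda^*\mathcal F$ and $\mathcal L_{<\xi}=R^0q_{\xi*}p_\xi^*\mathcal F$, where $p_\lambda,q_\lambda$ and $p_\xi,q_\xi$ are the projections to $\mathbb C$ and $S^1$ of $\bigcup_{\theta}\mathcal H_{\theta,\lambda}\times\{\theta\}$ and of $\bigcup_\theta\overline{\mathcal H}_{\theta,\operatorname{Re}(\xi e^{-i\theta})}\times\{\theta\}$, respectively; $\mathcal L_{<\xi}\to\mathcal L$ is given by restriction of sections. *The functor $\sigma$.* For a co-Stokes structure $(\mathcal L,\mathcal L_<)$ let $\sigma(\mathcal L,\mathcal L_<)=(\pi^*\mathcal L,\mathcal G)$, where $\mathcal G\subset\pi^*\mathcal L$ is the subsheaf with $\mathcal G_z=\mathcal L_{<\xi,\theta}$ whenever $z\in S_\xi$ has argument $\theta$. **Theorem.** Let $p_1,q_1$ be the projections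 of $\bigcup_{z\in\mathbb C^*}\mathcal H_z\times\{z\}\subset\mathbb C\times\mathbb C^*$ to $\mathbb C$ and $\mathbb C^*$, and for $r\in\mathbb R$ let $m_r,n_r$ be those of $\bigcup_{z=|z|e^{i\theta}\in\mathbb C^*}\mathcal H_{\theta,r}\times\{z\}$. There is a unique natural transformation $$R^0q_{1*}p_1^*\longrightarrow \operatorname{colim}_{r\to+\infty}R^0n_{r*}m_r^*$$ given by restriction of sections: for every $r$, its composite with the restriction map from $X_r=\bigcup_z(\mathcal H_z\cup\mathcal H_{\theta,r})\times\{z\}$ to $\bigcup_z\mathcal H_z\times\{z\}$ is the restriction from $X_r$ to $\bigcup_z\mathcal H_{\theta,r}\times\{z\}$ followed by the map to the colimit. For every $\mathcal F\in\mathrm{Constr}_0$ with singularities in a finite set $S$, $\Psi(\mathcal F)$ is a co-Stokes structure with exponents $S$, the sheaf $\mathcal G$ in $\sigma\Psi(\mathcal F)$ has the stalks prescribed above, and both $\sigma\Psi(\mathcal F)$ and $\big(\operatorname{colim}_{r\to+\infty}R^0n_{r*}m_r^*\mathcal F,\ R^0q_{1*}p_1^*\mathcal F\big)$ are co-Stokes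 sheaves with exponents $S$. There is an isomorphism of co-Stokes sheaves, natural in $\mathcal F\in\mathrm{Constr}_0$, $$\sigma\Psi(\mathcal F)\;\simeq\;\big(\operatorname{colim}_{r\to+\infty}R^0n_{r*}m_r^*\mathcal F,\ R^0q_{1*}p_1^*\mathcal F\big).$$ -/

import Mathlib

open CategoryTheory TopologicalSpace Opposite

noncomputable section

namespace TopLaplace

/-! ### Sheaves of `k`-vector spaces and sheaf operations along incidence spaces -/

/-- Sheaves of `k`-vector spaces on a topological space. -/
abbrev Sh (k : Type) [Field k] (X : Type) [TopologicalSpace X] :=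
  TopCat.Sheaf (ModuleCat.{0} k) (TopCat.of X)

section Correspondences

variable {k : Type} [Field k] {X Y : Type} [TopologicalSpace X] [TopologicalSpace Y]

/-- The first projection of a subspace `Z` of `X × Y`. -/
def projFst (Z : Set (X × Y)) : TopCat.of Z ⟶ TopCat.of X :=
  TopCat.ofHom ⟨fun w => w.1.1, continuous_fst.comp continuous_subtype_val⟩

/-- The second projection of a subspace `Z` of `X × Y`. -/
def projSnd (Z : Set (X × Y)) : TopCat.of Z ⟶ TopCat.of Y :=
  TopCat.ofHom ⟨fun w => w.1.2, continuous_snd.comp continuous_subtype_val⟩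

/-- The inclusion of one subspace of `X × Y` in another. -/
def inclMap {Z' Z : Set (X × Y)} (h : Z' ⊆ Z) : TopCat.of Z' ⟶ TopCat.of Z :=
  TopCat.ofHom ⟨Set.inclusion h, continuous_inclusion h⟩

variable (k) in
/-- The functor `R⁰q_* p^*` for the two projections `p : Z ⟶ X`, `q : Z ⟶ Y` of a subspace
`Z` of `X × Y`. -/
def pullPush (Z : Set (X × Y)) : Sh k X ⥤ Sh k Y :=
  TopCat.Sheaf.pullback (ModuleCat.{0} k) (projFst Z) ⋙
    TopCat.Sheaf.pushforward (ModuleCat.{0} k) (projSnd Z)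

variable (k) in
/-- The adjunction `p^* ⊣ p_*` for the first projection. -/
abbrev adjFst (Z : Set (X × Y)) :=
  TopCat.Sheaf.pullbackPushforwardAdjunction (ModuleCat.{0} k) (projFst Z)

/-- For the inclusion `i : Z' ⟶ Z` and the first projections `p`, `p' = p ∘ i`, the natural map
`p^* F ⟶ i_* p'^* F` (that is, `p^* F ⟶ i_* i^* p^* F`): under `p^* ⊣ p_*` it corresponds to the
unit `F ⟶ p'_* p'^* F`, where `p'_* = p_* i_*`. -/
def baseRes {Z' Z : Set (X × Y)} (h : Z' ⊆ Z) (F : Sh k X) :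
    (TopCat.Sheaf.pullback (ModuleCat.{0} k) (projFst Z)).obj F ⟶
      (TopCat.Sheaf.pushforward (ModuleCat.{0} k) (inclMap h)).obj
        ((TopCat.Sheaf.pullback (ModuleCat.{0} k) (projFst Z')).obj F) :=
  ((adjFst k Z).homEquiv F _).symm
    (show F ⟶ (TopCat.Sheaf.pushforward (ModuleCat.{0} k) (projFst Z)).obj
      ((TopCat.Sheaf.pushforward (ModuleCat.{0} k) (inclMap h)).obj
        ((TopCat.Sheaf.pullback (ModuleCat.{0} k) (projFst Z')).obj F)) from
      (adjFst k Z').unit.app F)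

theorem unit_baseRes {Z' Z : Set (X × Y)} (h : Z' ⊆ Z) (F : Sh k X) :
    (adjFst k Z).unit.app F ≫
      (TopCat.Sheaf.pushforward (ModuleCat.{0} k) (projFst Z)).map (baseRes h F) =
    (adjFst k Z').unit.app F := by
  have := ((adjFst k Z).homEquiv F _).apply_symm_apply
    (show F ⟶ (TopCat.Sheaf.pushforward (ModuleCat.{0} k) (projFst Z)).obj
      ((TopCat.Sheaf.pushforward (ModuleCat.{0} k) (inclMap h)).obj
        ((TopCat.Sheaf.pullback (ModuleCat.{0} k) (projFst Z')).obj F)) from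
      (adjFst k Z').unit.app F)
  rw [Adjunction.homEquiv_unit] at this
  exact this

theorem pull_hom_ext {Z : Set (X × Y)} {F : Sh k X} {B : Sh k Z}
    {f g : (TopCat.Sheaf.pullback (ModuleCat.{0} k) (projFst Z)).obj F ⟶ B}
    (h : (adjFst k Z).unit.app F ≫ (TopCat.Sheaf.pushforward _ (projFst Z)).map f =
      (adjFst k Z).unit.app F ≫ (TopCat.Sheaf.pushforward _ (projFst Z)).map g) : f = g := by
  apply ((adjFst k Z).homEquiv F _).injective
  rw [Adjunction.homEquiv_unit, Adjunction.homEquiv_unit]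
  exact h

/-- The restriction map `R⁰q_* p^* ⟶ R⁰q'_* p'^*` along an inclusion `Z' ⊆ Z`, induced by
`id ⟶ i_* i^*`. -/
def pullPushRes {Z' Z : Set (X × Y)} (h : Z' ⊆ Z) : pullPush k Z ⟶ pullPush k Z' where
  app F := (TopCat.Sheaf.pushforward (ModuleCat.{0} k) (projSnd Z)).map (baseRes h F)
  naturality F F' f := by
    have key : (TopCat.Sheaf.pullback (ModuleCat.{0} k) (projFst Z)).map f ≫ baseRes h F' =
        baseRes h F ≫ (TopCat.Sheaf.pushforward (ModuleCat.{0} k) (inclMap h)).map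
          ((TopCat.Sheaf.pullback (ModuleCat.{0} k) (projFst Z')).map f) := by
      apply pull_hom_ext
      have e1 := (adjFst k Z).unit.naturality f
      have e2 := (adjFst k Z').unit.naturality f
      simp only [Functor.id_map, Functor.comp_map] at e1 e2
      rw [Functor.map_comp, Functor.map_comp, ← Category.assoc, ← Category.assoc,
        unit_baseRes, ← e1, Category.assoc, unit_baseRes]
      exact e2
    exact ((TopCat.Sheaf.pushforward (ModuleCat.{0} k) (projSnd Z)).map_comp _ _).symm.trans
      ((congrArg (TopCat.Sheaf.pushforward (ModuleCat.{0} k) (projSnd Z)).map key).trans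
        ((TopCat.Sheaf.pushforward (ModuleCat.{0} k) (projSnd Z)).map_comp _ _))

theorem pullPushRes_self (Z : Set (X × Y)) :
    pullPushRes (k := k) (subset_refl Z) = 𝟙 _ := by
  ext1
  funext F
  have : baseRes (subset_refl Z) F = 𝟙 _ := by
    apply pull_hom_ext
    rw [unit_baseRes]
    exact (((congrArg ((adjFst k Z).unit.app F ≫ ·)
      ((TopCat.Sheaf.pushforward (ModuleCat.{0} k) (projFst Z)).map_id _))).trans
        (Category.comp_id _)).symm
  exact (congrArg (TopCat.Sheaf.pushforward (ModuleCat.{0} k) (projSnd Z)).map this).trans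
    ((TopCat.Sheaf.pushforward (ModuleCat.{0} k) (projSnd Z)).map_id _)

theorem pullPushRes_comp {Z'' Z' Z : Set (X × Y)} (h : Z' ⊆ Z) (h' : Z'' ⊆ Z') :
    pullPushRes (k := k) h ≫ pullPushRes h' = pullPushRes (h'.trans h) := by
  ext1
  funext F
  have : baseRes h F ≫
      (TopCat.Sheaf.pushforward (ModuleCat.{0} k) (inclMap h)).map (baseRes h' F) =
      baseRes (h'.trans h) F := by
    apply pull_hom_ext
    rw [Functor.map_comp, ← Category.assoc, unit_baseRes]
    exact (unit_baseRes h' F).trans (unit_baseRes (h'.trans h) F).symm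
  exact ((TopCat.Sheaf.pushforward (ModuleCat.{0} k) (projSnd Z)).map_comp _ _).symm.trans
    (congrArg (TopCat.Sheaf.pushforward (ModuleCat.{0} k) (projSnd Z)).map this)

variable (k) in
/-- The direct system `r ↦ R⁰q_{r*} p_r^*` of a decreasing family of subspaces `Z r`. -/
def pullPushDiagram (Z : ℝ → Set (X × Y)) (hZ : Antitone Z) : ℝ ⥤ Sh k X ⥤ Sh k Y where
  obj r := pullPush k (Z r)
  map f := pullPushRes (hZ f.le)
  map_id _ := pullPushRes_self _
  map_comp _ _ := (pullPushRes_comp _ _).symm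

variable (k) in
/-- The functor `F ↦ colim_{r → +∞} R⁰q_{r*} p_r^* F`. -/
def colimPullPush (Z : ℝ → Set (X × Y)) (hZ : Antitone Z) : Sh k X ⥤ Sh k Y :=
  (pullPushDiagram k Z hZ).flip ⋙ Limits.colim

variable (k) in
/-- The map `R⁰q_{r*} p_r^* ⟶ colim_r R⁰q_{r*} p_r^*`. -/
def toColim (Z : ℝ → Set (X × Y)) (hZ : Antitone Z) (r : ℝ) :
    pullPush k (Z r) ⟶ colimPullPush k Z hZ where
  app F := Limits.colimit.ι ((pullPushDiagram k Z hZ).flip.obj F) r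
  naturality _ _ f :=
    (Limits.ι_colimMap ((pullPushDiagram k Z hZ).flip.map f) r).symm

end Correspondences

section Stalks

variable {k : Type} [Field k] {Y : Type} [TopologicalSpace Y]

/-- The stalk `A_y`. -/
abbrev stk (A : Sh k Y) (y : Y) : ModuleCat.{0} k := A.presheaf.stalk (X := TopCat.of Y) y

/-- The space of sections `A(U)`. -/
abbrev sec (A : Sh k Y) (U : Opens Y) : ModuleCat.{0} k :=
  A.presheaf.obj (op (U : Opens (TopCat.of Y)))

/-- The germ map `A(U) → A_y`. -/
def germ (A : Sh k Y) (U : Opens Y) (y : Y) (hy : y ∈ U) : sec A U →ₗ[k] stk A y :=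
  (A.presheaf.germ (X := TopCat.of Y) U y hy).hom

/-- The map on stalks induced by a morphism of sheaves. -/
def stalkMap {A B : Sh k Y} (f : A ⟶ B) (y : Y) : stk A y →ₗ[k] stk B y :=
  ((TopCat.Presheaf.stalkFunctor (X := TopCat.of Y) (ModuleCat.{0} k) y).map f.hom).hom

/-- The image of `A_y` in `B_y`. -/
def stalkRange {A B : Sh k Y} (f : A ⟶ B) (y : Y) : Submodule k (stk B y) :=
  LinearMap.range (stalkMap f y)

/-- Sections all of whose germs lie in prescribed subspaces of the stalks. -/
def secIn (A : Sh k Y) (P : ∀ y, Submodule k (stk A y)) (U : Opens Y) : Submodule k (sec A U) :=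
  ⨅ y : U, (P y).comap (germ A U y y.2)

theorem mem_secIn {A : Sh k Y} {P : ∀ y, Submodule k (stk A y)} {U : Opens Y} {s : sec A U} :
    s ∈ secIn A P U ↔ ∀ (y : Y) (hy : y ∈ U), germ A U y hy s ∈ P y := by
  simp [secIn]

theorem germ_map {A : Sh k Y} {U V : Opens Y} (i : V ⟶ U) (y : Y) (hy : y ∈ V) (s : sec A U) :
    germ A V y hy ((A.presheaf.map (Quiver.Hom.op (V := Opens (TopCat.of Y)) i)).hom s) =
      germ A U y (i.le hy) s :=
  TopCat.Presheaf.germ_res_apply A.presheaf i y hy s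

theorem stalkMap_germ {A B : Sh k Y} (f : A ⟶ B) (U : Opens Y) (y : Y) (hy : y ∈ U)
    (s : sec A U) :
    stalkMap f y (germ A U y hy s) = germ B U y hy ((f.hom.app (op U)).hom s) :=
  TopCat.Presheaf.stalkFunctor_map_germ_apply (X := TopCat.of Y) U y hy f.hom s

theorem stalkMap_comp {A B C : Sh k Y} (f : A ⟶ B) (g : B ⟶ C) (y : Y) (x : stk A y) :
    stalkMap (f ≫ g) y x = stalkMap g y (stalkMap f y x) :=
  congrArg (fun φ => φ.hom x)
    ((TopCat.Presheaf.stalkFunctor (X := TopCat.of Y) (ModuleCat.{0} k) y).map_comp f.hom g.hom)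

/-- The presheaf of sections whose germs lie in `P`. -/
def subPresheaf (A : Sh k Y) (P : ∀ y, Submodule k (stk A y)) :
    TopCat.Presheaf (ModuleCat.{0} k) (TopCat.of Y) where
  obj U := ModuleCat.of k (secIn A P U.unop)
  map {U V} i := ModuleCat.ofHom ((A.presheaf.map i).hom.restrict (p := secIn A P U.unop)
    (q := secIn A P V.unop) (fun s hs => mem_secIn.2 fun y hy => by
      have := germ_map (A := A) i.unop y hy s
      rw [show i = i.unop.op from rfl, this]
      exact mem_secIn.1 hs y _))
  map_id U := by
    refine ModuleCat.hom_ext (LinearMap.ext fun s => Subtype.ext ?_)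
    exact congrArg (fun φ => φ.hom s.1) (A.presheaf.map_id U)
  map_comp f g := by
    refine ModuleCat.hom_ext (LinearMap.ext fun s => Subtype.ext ?_)
    exact congrArg (fun φ => φ.hom s.1) (A.presheaf.map_comp f g)

theorem subPresheaf_isSheaf (A : Sh k Y) (P : ∀ y, Submodule k (stk A y)) :
    (subPresheaf A P).IsSheaf := by
  rw [TopCat.Presheaf.isSheaf_iff_isSheaf_comp (forget (ModuleCat.{0} k))]
  refine TopCat.Presheaf.isSheaf_of_isSheafUniqueGluing_types _ fun {ι} U sf hsf => ?_
  obtain ⟨s, hs, huniq⟩ := TopCat.Sheaf.existsUnique_gluing A U (fun i => (sf i).1)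
    (fun i j => congrArg Subtype.val (hsf i j))
  refine ⟨⟨s, mem_secIn.2 fun y hy => ?_⟩, fun i => Subtype.ext (hs i), fun t ht =>
    Subtype.ext (huniq t.1 fun i => congrArg Subtype.val (ht i))⟩
  obtain ⟨i, hi⟩ := Opens.mem_iSup.1 hy
  rw [← germ_map (A := A) (Opens.leSupr U i) y hi s]
  have h1 : germ A (U i) y hi (sf i).1 ∈ P y := mem_secIn.1 (sf i).2 y hi
  have h2 : (A.presheaf.map (Opens.leSupr U i).op).hom s = (sf i).1 := hs i
  rw [h2]
  exact h1

/-- The subsheaf of `A` of sections whose germ at each `y` lies in the subspace `P y` of `A_y`.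
If the union of the `P y` is open in the étale space of `A`, it is the unique subsheaf of `A` with
stalks `P y`. -/
def subSheaf (A : Sh k Y) (P : ∀ y, Submodule k (stk A y)) : Sh k Y :=
  ⟨subPresheaf A P, subPresheaf_isSheaf A P⟩

/-- The inclusion of the subsheaf. -/
def subSheafIncl (A : Sh k Y) (P : ∀ y, Submodule k (stk A y)) : subSheaf A P ⟶ A :=
  ⟨{ app := fun U => ModuleCat.ofHom (secIn A P U.unop).subtype
     naturality := fun _ _ _ => rfl }⟩

/-- A morphism that respects the prescribed subspaces of the stalks restricts to the
subsheaves. -/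
theorem exists_subSheaf_map {A B : Sh k Y} (f : A ⟶ B) (P : ∀ y, Submodule k (stk A y))
    (Q : ∀ y, Submodule k (stk B y)) (h : ∀ y, (P y).map (stalkMap f y) ≤ Q y) :
    ∃ g : subSheaf A P ⟶ subSheaf B Q, g ≫ subSheafIncl B Q = subSheafIncl A P ≫ f := by
  refine ⟨⟨{ app := fun U => ModuleCat.ofHom ((f.hom.app U).hom.restrict
    (p := secIn A P U.unop) (q := secIn B Q U.unop) (fun s hs => mem_secIn.2 fun y hy => ?_))
             naturality := fun U V i => ?_ }⟩, ?_⟩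
  · rw [← stalkMap_germ f U.unop y hy s]
    exact h y (Submodule.mem_map_of_mem (mem_secIn.1 hs y hy))
  · ext s
    exact Subtype.ext (congrArg (fun φ => φ.hom s.1) (f.hom.naturality i))
  · rfl

/-- `A` is constant on `U` with a finite-dimensional fibre `V`: there is an isomorphism from the
constant sheaf with fibre `V` on `U` to `A|_U`. Such a morphism is a linear map `V → A(U)`, and
it is an isomorphism if and only if it induces bijections `V → A_y` for all `y ∈ U`. -/
def IsConstantOn (A : Sh k Y) (U : Opens Y) : Prop :=
  ∃ V : ModuleCat.{0} k, Module.Finite k V ∧ ∃ t : V →ₗ[k] sec A U,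
    ∀ (y : Y) (hy : y ∈ U), Function.Bijective (germ A U y hy ∘ₗ t)

/-- Local systems of finite-dimensional vector spaces. -/
def IsLocalSystem (A : Sh k Y) : Prop :=
  ∀ y : Y, ∃ U : Opens Y, y ∈ U ∧ IsConstantOn A U

end Stalks

/-! ### Constructible sheaves with vanishing cohomology -/

/-- `F` is a constructible sheaf of finite-dimensional vector spaces on `ℂ` whose singularities
are contained in the finite set `S`. -/
def IsConstructible {k : Type} [Field k] (S : Finset ℂ) (F : Sh k ℂ) : Prop :=
  (∀ x : ℂ, x ∉ S → ∃ U : Opens ℂ, x ∈ U ∧ IsConstantOn F U) ∧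
    ∀ x : ℂ, Module.Finite k (stk F x)

/-- The sheaf cohomology of `F` vanishes in all degrees. -/
def IsAcyclic {k : Type} [Field k] (F : Sh k ℂ) : Prop :=
  ∀ n : ℕ, Subsingleton (Sheaf.H.{0}
    ((sheafCompose _ (forget₂ (ModuleCat.{0} k) AddCommGrpCat.{0})).obj F) n)

/-- The full subcategory `Constr₀` of constructible sheaves with vanishing cohomology. -/
def Constr₀ (k : Type) [Field k] : ObjectProperty (Sh k ℂ) :=
  fun F => (∃ S : Finset ℂ, IsConstructible S F) ∧ IsAcyclic F

/-! ### Circles and half-planes -/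

/-- `Re (x e^{-iθ})` for `u = e^{iθ}`. -/
def reDir (u : Circle) (x : ℂ) : ℝ := (x * (starRingEnd ℂ) (u : ℂ)).re

theorem reDir_le_norm (u : Circle) (x : ℂ) : reDir u x ≤ ‖x‖ := by
  refine (Complex.re_le_norm _).trans (le_of_eq ?_)
  rw [norm_mul, RCLike.norm_conj, Circle.norm_coe, mul_one]

/-- The punctured plane `ℂ*`. -/
abbrev Cstar : Type := {z : ℂ // z ≠ 0}

/-- The projection `π : ℂ* → S¹`, `r e^{iθ} ↦ e^{iθ}`. -/
def dir (z : Cstar) : Circle :=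
  ⟨(z : ℂ) / (‖(z : ℂ)‖ : ℂ), by
    have : ‖(z : ℂ)‖ ≠ 0 := norm_ne_zero_iff.2 z.2
    simp [Submonoid.unitSphere, this]⟩

theorem continuous_dir : Continuous dir := by
  refine Continuous.subtype_mk ?_ _
  refine continuous_subtype_val.div
    (Complex.continuous_ofReal.comp (continuous_norm.comp continuous_subtype_val)) ?_
  intro z
  simpa using z.2

/-- `π` as a morphism of topological spaces. -/
def dirMap : TopCat.of Cstar ⟶ TopCat.of Circle := TopCat.ofHom ⟨dir, continuous_dir⟩

/-- The circle `S_ξ = {ρ e^{iθ} : ρ = exp (Re (ξ e^{-iθ}))}`. -/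
def circ (ξ : ℂ) : Set Cstar := {z | ‖(z : ℂ)‖ = Real.exp (reDir (dir z) ξ)}

/-- The region of the points `z` with `S_ξ < z`, i.e. of the points outside `S_ξ`. -/
def outside (ξ : ℂ) : Set Cstar := {z | Real.exp (reDir (dir z) ξ) < ‖(z : ℂ)‖}

/-- The open half-plane `𝓗_{θ,r} = {x : Re (x e^{-iθ}) > r}`, `u = e^{iθ}`. -/
def halfPlane (u : Circle) (r : ℝ) : Set ℂ := {x | r < reDir u x}

/-- The closed half-plane `{x : Re (x e^{-iθ}) ≥ r}`, `u = e^{iθ}`. -/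
def closedHalfPlane (u : Circle) (r : ℝ) : Set ℂ := {x | r ≤ reDir u x}

/-- `⋃_θ 𝓗_{θ,r} × {θ} ⊆ ℂ × S¹`. -/
def incS (r : ℝ) : Set (ℂ × Circle) := {w | w.1 ∈ halfPlane w.2 r}

/-- `⋃_θ cl(𝓗_{θ,Re(ξ e^{-iθ})}) × {θ} ⊆ ℂ × S¹`: the closed half-planes with `ξ` on the
boundary. -/
def incSAt (ξ : ℂ) : Set (ℂ × Circle) := {w | w.1 ∈ closedHalfPlane w.2 (reDir w.2 ξ)}

/-- `⋃_z 𝓗_{θ,r} × {z} ⊆ ℂ × ℂ*`, where `θ = arg z`. -/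
def incC (r : ℝ) : Set (ℂ × Cstar) := {w | w.1 ∈ halfPlane (dir w.2) r}

/-- `⋃_z 𝓗_z × {z} ⊆ ℂ × ℂ*`, where `𝓗_z = 𝓗_{θ,λ}` for `z = e^λ e^{iθ}`. -/
def incH : Set (ℂ × Cstar) := {w | w.1 ∈ halfPlane (dir w.2) (Real.log ‖(w.2 : ℂ)‖)}

theorem antitone_incS : Antitone incS := fun _ _ h _ hw => lt_of_le_of_lt h hw

theorem antitone_incC : Antitone incC := fun _ _ h _ hw => lt_of_le_of_lt h hw

theorem incS_subset (ξ : ℂ) : incS ‖ξ‖ ⊆ incSAt ξ :=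
  fun w hw => (reDir_le_norm w.2 ξ).trans (le_of_lt hw)

/-! ### Co-Stokes structures -/

/-- A sheaf `L` on `S¹` with a family of sheaves `L_{<ξ}` over it, indexed by `ξ ∈ ℂ`. -/
structure FilteredSheaf (k : Type) [Field k] where
  /-- the sheaf `L` -/
  L : Sh k Circle
  /-- the sheaves `L_{<ξ}` -/
  Lt : ℂ → Sh k Circle
  /-- the maps `L_{<ξ} ⟶ L` -/
  incl : ∀ ξ, Lt ξ ⟶ L

/-- A morphism is a morphism `L ⟶ L'` that carries `L_{<ξ}` to `L'_{<ξ}` for all `ξ`. -/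
@[ext]
structure FilteredSheaf.Hom {k : Type} [Field k] (A B : FilteredSheaf k) where
  /-- the morphism `L ⟶ L'` -/
  hom : A.L ⟶ B.L
  preserves : ∀ ξ, ∃ g : A.Lt ξ ⟶ B.Lt ξ, g ≫ B.incl ξ = A.incl ξ ≫ hom

instance (k : Type) [Field k] : Category (FilteredSheaf k) where
  Hom := FilteredSheaf.Hom
  id A := ⟨𝟙 _, fun ξ => ⟨𝟙 _, by simp⟩⟩
  comp f g := ⟨f.hom ≫ g.hom, fun ξ => by
    obtain ⟨a, ha⟩ := f.preserves ξ
    obtain ⟨b, hb⟩ := g.preserves ξ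
    exact ⟨a ≫ b, by rw [Category.assoc, hb, ← Category.assoc, ha, Category.assoc]⟩⟩
  id_comp f := FilteredSheaf.Hom.ext (Category.id_comp _)
  comp_id f := FilteredSheaf.Hom.ext (Category.comp_id _)
  assoc f g h := FilteredSheaf.Hom.ext (Category.assoc _ _ _)

/-- `A` is a co-Stokes structure of exponential type with exponents in `S`: `L` is a local system,
the `L_{<ξ}` are subsheaves, increasing for `<_θ` at each `θ`, and there are local systems `gr_c`
on `S¹` such that locally on `S¹` there is an isomorphism `e` from `⨁_c gr_c` to `L` that carries
`⨁_c j_! j^* gr_c`, with `j` the inclusion of `{θ | c <_θ ξ}`, to `L_{<ξ}` for all `ξ`. The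
isomorphism over `U` is given by its maps on stalks, which have to carry sections to sections. -/
def IsCoStokesStructure {k : Type} [Field k] (S : Finset ℂ) (A : FilteredSheaf k) : Prop :=
  IsLocalSystem A.L ∧ (∀ ξ, Mono (A.incl ξ)) ∧
  (∀ (u : Circle) (ξ₁ ξ₂ : ℂ), reDir u ξ₁ < reDir u ξ₂ →
    stalkRange (A.incl ξ₁) u ≤ stalkRange (A.incl ξ₂) u) ∧
  ∃ gr : S → Sh k Circle, (∀ c, IsLocalSystem (gr c)) ∧
    ∀ u₀ : Circle, ∃ U : Opens Circle, u₀ ∈ U ∧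
      ∃ e : ∀ u : Circle, (∀ c : S, stk (gr c) u) →ₗ[k] stk A.L u,
        (∀ u ∈ U, Function.Bijective (e u)) ∧
        (∀ (W : Opens Circle), W ≤ U → ∀ s : ∀ c : S, sec (gr c) W, ∃ t : sec A.L W,
          ∀ (u : Circle) (hu : u ∈ W),
            germ A.L W u hu t = e u (fun c => germ (gr c) W u hu (s c))) ∧
        ∀ u ∈ U, ∀ (ξ : ℂ) (x : ∀ c : S, stk (gr c) u),
          e u x ∈ stalkRange (A.incl ξ) u ↔
            ∀ c : S, ¬ reDir u (c : ℂ) < reDir u ξ → x c = 0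

/-! ### Co-Stokes sheaves -/

/-- A sheaf `L` on `ℂ*` with a sheaf `G` over it. -/
structure SheafPair (k : Type) [Field k] where
  /-- the sheaf `L` -/
  L : Sh k Cstar
  /-- the sheaf `G` -/
  G : Sh k Cstar
  /-- the map `G ⟶ L` -/
  incl : G ⟶ L

/-- A morphism is a morphism `L ⟶ L'` that carries `G` to `G'`. -/
@[ext]
structure SheafPair.Hom {k : Type} [Field k] (A B : SheafPair k) where
  /-- the morphism `L ⟶ L'` -/
  hom : A.L ⟶ B.L
  preserves : ∃ g : A.G ⟶ B.G, g ≫ B.incl = A.incl ≫ hom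

instance (k : Type) [Field k] : Category (SheafPair k) where
  Hom := SheafPair.Hom
  id A := ⟨𝟙 _, 𝟙 _, by simp⟩
  comp f g := ⟨f.hom ≫ g.hom, by
    obtain ⟨a, ha⟩ := f.preserves
    obtain ⟨b, hb⟩ := g.preserves
    exact ⟨a ≫ b, by rw [Category.assoc, hb, ← Category.assoc, ha, Category.assoc]⟩⟩
  id_comp f := SheafPair.Hom.ext (Category.id_comp _)
  comp_id f := SheafPair.Hom.ext (Category.comp_id _)
  assoc f g h := SheafPair.Hom.ext (Category.assoc _ _ _)

/-- `(L, G)` is a co-Stokes sheaf with exponents in `S`: `G` is a subsheaf of `L`, and each point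
has a neighbourhood `U` with an isomorphism `t` from the constant sheaf with fibre `⨁_c gr_c` to
`L|_U` (see `IsConstantOn`) such that `G_z` is the sum of the `gr_c` with `S_c < z`, for all
`z ∈ U`. -/
def IsCoStokesSheaf {k : Type} [Field k] (S : Finset ℂ) (A : SheafPair k) : Prop :=
  Mono A.incl ∧ ∀ z₀ : Cstar, ∃ U : Opens Cstar, z₀ ∈ U ∧
    ∃ gr : S → ModuleCat.{0} k, (∀ c, Module.Finite k (gr c)) ∧
      ∃ t : (∀ c : S, gr c) →ₗ[k] sec A.L U, ∀ (z : Cstar) (hz : z ∈ U),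
        Function.Bijective (germ A.L U z hz ∘ₗ t) ∧
        ∀ x : ∀ c : S, gr c, germ A.L U z hz (t x) ∈ stalkRange A.incl z ↔
          ∀ c : S, z ∉ outside (c : ℂ) → x c = 0

/-! ### The functors `Ψ` and `σ` -/

/-- The functor `Ψ`, with `L = colim_λ R⁰q_{λ*} p_λ^* F` and `L_{<ξ} = R⁰q_{ξ*} p_ξ^* F`; the map
`L_{<ξ} ⟶ L` restricts sections to the half-planes `𝓗_{θ,λ}` with `λ = |ξ|`. -/
def Psi (k : Type) [Field k] : Sh k ℂ ⥤ FilteredSheaf k where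
  obj F :=
    { L := (colimPullPush k incS antitone_incS).obj F
      Lt := fun ξ => (pullPush k (incSAt ξ)).obj F
      incl := fun ξ =>
        (pullPushRes (incS_subset ξ) ≫ toColim k incS antitone_incS ‖ξ‖).app F }
  map f := ⟨(colimPullPush k incS antitone_incS).map f, fun ξ =>
    ⟨(pullPush k (incSAt ξ)).map f,
      (pullPushRes (incS_subset ξ) ≫ toColim k incS antitone_incS ‖ξ‖).naturality f⟩⟩
  map_id F := FilteredSheaf.Hom.ext ((colimPullPush k incS antitone_incS).map_id F)
  map_comp f g := FilteredSheaf.Hom.ext ((colimPullPush k incS antitone_incS).map_comp f g)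

/-- The pull-back `π^*` from `S¹` to `ℂ*`. -/
abbrev piPull (k : Type) [Field k] : Sh k Circle ⥤ Sh k Cstar :=
  TopCat.Sheaf.pullback (ModuleCat.{0} k) dirMap

/-- The subspace of the stalk of `π^* L` at `z` that is prescribed for `G`: the elements of
`L_{<ξ,θ}`, `θ = arg z`, for the `ξ` with `z ∈ S_ξ`. (In a co-Stokes structure `L_{<ξ,θ}` is the
same for all these `ξ`.) -/
def prescribed {k : Type} [Field k] (A : FilteredSheaf k) (z : Cstar) :
    Submodule k (stk ((piPull k).obj A.L) z) :=
  ⨅ (ξ : ℂ) (_ : z ∈ circ ξ), stalkRange ((piPull k).map (A.incl ξ)) z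

/-- The functor `σ : (L, L_<) ↦ (π^* L, G)`. -/
def sigma (k : Type) [Field k] : FilteredSheaf k ⥤ SheafPair k where
  obj A :=
    { L := (piPull k).obj A.L
      G := subSheaf ((piPull k).obj A.L) (prescribed A)
      incl := subSheafIncl _ _ }
  map {A B} f := ⟨(piPull k).map f.hom, by
    refine exists_subSheaf_map _ _ _ fun z => ?_
    rintro _ ⟨x, hx, rfl⟩
    simp only [prescribed, Submodule.mem_iInf, SetLike.mem_coe] at hx ⊢
    intro ξ hξ
    obtain ⟨y, rfl⟩ := hx ξ hξ
    obtain ⟨g, hg⟩ := f.preserves ξ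
    refine ⟨stalkMap ((piPull k).map g) z y, ?_⟩
    rw [← stalkMap_comp, ← stalkMap_comp, ← Functor.map_comp, ← Functor.map_comp, hg]⟩
  map_id A := SheafPair.Hom.ext ((piPull k).map_id A.L)
  map_comp f g := SheafPair.Hom.ext ((piPull k).map_comp f.hom g.hom)

/-- `σ(A) = (π^* L, G)` has the defining property of `σ`: `G_z = L_{<ξ,θ}` in the stalk of
`π^* L` at `z`, whenever `z ∈ S_ξ`. -/
def HasPrescribedStalks {k : Type} [Field k] (A : FilteredSheaf k) : Prop :=
  ∀ (z : Cstar) (ξ : ℂ), z ∈ circ ξ →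
    stalkRange ((sigma k).obj A).incl z = stalkRange ((piPull k).map (A.incl ξ)) z

/-! ### The direct description -/

/-- The functor `F ↦ colim_{r → +∞} R⁰n_{r*} m_r^* F`. -/
abbrev directL (k : Type) [Field k] : Sh k ℂ ⥤ Sh k Cstar := colimPullPush k incC antitone_incC

/-- The functor `F ↦ R⁰q_{1*} p_1^* F`. -/
abbrev directG (k : Type) [Field k] : Sh k ℂ ⥤ Sh k Cstar := pullPush k incH

/-- The natural map `R⁰q_{1*} p_1^* ⟶ colim_r R⁰n_{r*} m_r^*` is characterized as the one given
by restriction of sections: on a section over `X_r = ⋃_z (𝓗_z ∪ 𝓗_{θ,r}) × {z}`, restricting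
to `⋃_z 𝓗_z × {z}` and applying the map is the same as restricting to `⋃_z 𝓗_{θ,r} × {z}` and
passing to the colimit. (Over `{|z| ≤ e^r}` the space `X_r` agrees with `⋃_z 𝓗_z × {z}`.) -/
def IsRestriction {k : Type} [Field k] (ι : directG k ⟶ directL k) : Prop :=
  ∀ r : ℝ,
    pullPushRes (Set.subset_union_left : incH ⊆ incH ∪ incC r) ≫ ι =
      pullPushRes (Set.subset_union_right : incC r ⊆ incH ∪ incC r) ≫
        toColim k incC antitone_incC r

/-- The functor to pairs given by a natural transformation `G ⟶ L`. -/
def pairFunctor {k : Type} [Field k] {L G : Sh k ℂ ⥤ Sh k Cstar} (ι : G ⟶ L) :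
    Sh k ℂ ⥤ SheafPair k where
  obj F := { L := L.obj F, G := G.obj F, incl := ι.app F }
  map f := ⟨L.map f, G.map f, ι.naturality f⟩
  map_id F := SheafPair.Hom.ext (L.map_id F)
  map_comp f g := SheafPair.Hom.ext (L.map_comp f g)

end TopLaplace

end

open TopLaplace

/-!
Fix a direction `φ` and cut `ℂ` along the rays `c - ℝ≥0 φ`, `c ∈ S`. On the resulting slit domain,
and on every half-plane far out in a direction at an angle less than `π / 2` to `φ`, the sheaf `F`
is constant, so that the sections `M` of `F` on the slit domain are the stalks of both colimits
near the direction `φ`. If the lines through the points of `S` in the direction `φ` are distinct,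
acyclicity of `F` yields `M ≃ ⨁_c M / M_c`, where `M_c` consists of the sections that extend over
the slit at `c`: a Mayer-Vietoris argument, since `H⁰` and `H¹` of `F` vanish on `ℂ`. The germ of a
section in `M` lies in `ℒ_{<ξ, θ}`, or in the stalk of `R⁰q_{1*} p_1^* F` at `z`, if and only if the
section belongs to `M_c` for all `c` with `Re (ξ e^{-iθ}) ≤ Re (c e^{-iθ})`, respectively
`log |z| ≤ Re (c e^{-iθ})`. These are the same conditions when `z ∈ S_ξ`, and base change along
`π` identifies the two colimits compatibly with the sections in `M`.
-/

noncomputable section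

namespace TopLaplace

open Filter Topology

/-! ### Germs and morphisms of sheaves -/

section Germs

variable {k : Type} [Field k] {Y : Type} [TopologicalSpace Y] {A B C : Sh k Y} {U V : Opens Y}
  {y : Y}

open Classical in
/-- The germ at `y` of a section over `U`, extended by zero to the points `y ∉ U`. -/
def germAt (A : Sh k Y) (U : Opens Y) (y : Y) : sec A U →ₗ[k] stk A y :=
  if h : y ∈ U then germ A U y h else 0

theorem germAt_of_mem (h : y ∈ U) : germAt A U y = germ A U y h :=
  dif_pos h

/-- Restriction of sections from `U` to `V ≤ U`. -/
def secRes (A : Sh k Y) (h : V ≤ U) : sec A U →ₗ[k] sec A V :=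
  (A.presheaf.map (Quiver.Hom.op (V := Opens (TopCat.of Y)) (homOfLE h))).hom

@[simp]
theorem germAt_secRes (h : V ≤ U) (hy : y ∈ V) (s : sec A U) :
    germAt A V y (secRes A h s) = germAt A U y s := by
  rw [germAt_of_mem hy, germAt_of_mem (h hy)]
  exact germ_map (homOfLE h) y hy s

theorem sec_ext {s t : sec A U} (h : ∀ y ∈ U, germAt A U y s = germAt A U y t) : s = t :=
  TopCat.Presheaf.section_ext A U s t fun y hy => by
    have h_germ := h y hy
    rwa [germAt_of_mem hy] at h_germ

theorem exists_germAt_eq (A : Sh k Y) (x : stk A y) :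
    ∃ U : Opens Y, y ∈ U ∧ ∃ s : sec A U, germAt A U y s = x := by
  obtain ⟨U, hU, s, hs⟩ := TopCat.Presheaf.exists_germ_eq A.presheaf x
  exact ⟨U, hU, s, by rw [germAt_of_mem hU]; exact hs⟩

theorem eventually_mem_opens (h : y ∈ U) : ∀ᶠ y' in 𝓝 y, y' ∈ U :=
  U.isOpen.mem_nhds h

theorem eventually_germAt_eq (hU : y ∈ U) (hV : y ∈ V) {s : sec A U} {t : sec A V}
    (h : germAt A U y s = germAt A V y t) :
    ∀ᶠ y' in 𝓝 y, germAt A U y' s = germAt A V y' t := by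
  rw [germAt_of_mem hU, germAt_of_mem hV] at h
  obtain ⟨W, hW, hWU, hWV, h_res⟩ := TopCat.Presheaf.germ_eq A.presheaf y hU hV s t h
  filter_upwards [eventually_mem_opens hW] with y' hy'
  rw [← germAt_secRes hWU.le hy' s, ← germAt_secRes hWV.le hy' t]
  exact congrArg _ h_res

theorem eventually_germAt_eq_zero (hU : y ∈ U) {s : sec A U} (h : germAt A U y s = 0) :
    ∀ᶠ y' in 𝓝 y, germAt A U y' s = 0 := by
  simpa only [map_zero] using eventually_germAt_eq (t := (0 : sec A U)) hU hU (by rwa [map_zero])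

theorem exists_sec_of_eventually_germAt_eq (A : Sh k Y) (U : Opens Y) (g : ∀ y, stk A y)
    (hg : ∀ y ∈ U, ∃ V : Opens Y, y ∈ V ∧ ∃ t : sec A V,
      ∀ᶠ y' in 𝓝 y, germAt A V y' t = g y') :
    ∃ s : sec A U, ∀ y ∈ U, germAt A U y s = g y := by
  have h_local : ∀ y : U, ∃ V : Opens Y, y.1 ∈ V ∧ V ≤ U ∧ ∃ t : sec A V, ∀ y' ∈ V,
      germAt A V y' t = g y' := by
    rintro ⟨y, hy⟩
    obtain ⟨V, hV, t, ht⟩ := hg y hy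
    obtain ⟨W, hW, hWo, hyW⟩ := eventually_nhds_iff.1 ht
    refine ⟨V ⊓ U ⊓ ⟨W, hWo⟩, ⟨⟨hV, hy⟩, hyW⟩, fun z hz => hz.1.2,
      secRes A (inf_le_left.trans inf_le_left) t, fun y' hy' => ?_⟩
    rw [germAt_secRes _ hy']
    exact hW y' hy'.2
  choose V hV hVU t ht using h_local
  have h_cover : U ≤ iSup V := fun y hy => Opens.mem_iSup.2 ⟨⟨y, hy⟩, hV ⟨y, hy⟩⟩
  have h_compatible : ∀ i j, secRes A (inf_le_left : V i ⊓ V j ≤ V i) (t i) =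
      secRes A (inf_le_right : V i ⊓ V j ≤ V j) (t j) := fun i j => sec_ext fun y hy => by
    rw [germAt_secRes _ hy, germAt_secRes _ hy, ht i y hy.1, ht j y hy.2]
  obtain ⟨s, hs, -⟩ := TopCat.Sheaf.existsUnique_gluing' A V U (fun i => homOfLE (hVU i))
    h_cover t h_compatible
  refine ⟨s, fun y hy => ?_⟩
  have h_res : secRes A (hVU ⟨y, hy⟩) s = t ⟨y, hy⟩ := hs ⟨y, hy⟩
  rw [← germAt_secRes (hVU ⟨y, hy⟩) (hV _) s, h_res, ht _ _ (hV _)]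

/-- The map on sections over `U` induced by a morphism of sheaves. -/
def secMap (f : A ⟶ B) (U : Opens Y) : sec A U →ₗ[k] sec B U :=
  (f.hom.app (op U)).hom

theorem stalkMap_germAt (f : A ⟶ B) (U : Opens Y) (y : Y) (s : sec A U) :
    stalkMap f y (germAt A U y s) = germAt B U y (secMap f U s) := by
  by_cases hy : y ∈ U
  · rw [germAt_of_mem hy, germAt_of_mem hy, stalkMap_germ]
    rfl
  · simp only [germAt, dif_neg hy, LinearMap.zero_apply, map_zero]

theorem hom_ext_of_stalkMap {f g : A ⟶ B} (h : ∀ y x, stalkMap f y x = stalkMap g y x) :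
    f = g := by
  refine Sheaf.hom_ext (NatTrans.ext (funext fun U => ModuleCat.hom_ext (LinearMap.ext fun s =>
    sec_ext (A := B) (U := U.unop) fun y _ => ?_)))
  exact (stalkMap_germAt f U.unop y s).symm.trans ((h _ _).trans (stalkMap_germAt g U.unop y s))

theorem stalkMap_id (x : stk A y) : stalkMap (𝟙 A) y x = x :=
  congrArg (fun φ => φ.hom x)
    ((TopCat.Presheaf.stalkFunctor (X := TopCat.of Y) (ModuleCat.{0} k) y).map_id A.presheaf)

theorem exists_hom_of_stalkMaps (φ : ∀ y, stk A y →ₗ[k] stk B y)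
    (hφ : ∀ (U : Opens Y) (s : sec A U), ∀ y ∈ U, ∃ V : Opens Y, y ∈ V ∧ ∃ t : sec B V,
      ∀ᶠ y' in 𝓝 y, germAt B V y' t = φ y' (germAt A U y' s)) :
    ∃ f : A ⟶ B, ∀ y, stalkMap f y = φ y := by
  choose T hT using fun (U : Opens Y) (s : sec A U) =>
    exists_sec_of_eventually_germAt_eq B U (fun y => φ y (germAt A U y s)) (hφ U s)
  refine ⟨⟨{ app := fun U => ModuleCat.ofHom
               { toFun := T U.unop
                 map_add' := fun s t => sec_ext fun y hy => ?_
                 map_smul' := fun a s => sec_ext fun y hy => ?_ }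
             naturality := fun U V i => ?_ }⟩, fun y => ?_⟩
  · rw [hT _ _ y hy, map_add, map_add, map_add, hT _ _ y hy, hT _ _ y hy]
  · rw [hT _ _ y hy, map_smul, map_smul, RingHom.id_apply, map_smul, hT _ _ y hy]
  · refine ModuleCat.hom_ext (LinearMap.ext fun s =>
      sec_ext (A := B) (U := V.unop) fun y hy => (hT V.unop _ y hy).trans ?_)
    refine Eq.trans ?_ (germAt_secRes (A := B) i.unop.le hy (T U.unop s)).symm
    rw [hT U.unop s y (i.unop.le hy)]
    exact congrArg _ (germAt_secRes (A := A) i.unop.le hy s)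
  · refine LinearMap.ext fun x => ?_
    obtain ⟨U, hU, s, rfl⟩ := exists_germAt_eq A x
    exact (stalkMap_germAt _ U y s).trans (hT U s y hU)

theorem mono_of_stalkMap_injective (f : A ⟶ B) (h : ∀ y, Function.Injective (stalkMap f y)) :
    Mono f :=
  have (y : TopCat.of Y) :
      Mono ((TopCat.Presheaf.stalkFunctor (ModuleCat.{0} k) y).map f.hom) :=
    (ModuleCat.mono_iff_injective _).2 (h y)
  TopCat.Presheaf.mono_of_stalk_mono f

theorem isIso_of_stalkMap_bijective (f : A ⟶ B) (h : ∀ y, Function.Bijective (stalkMap f y)) :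
    IsIso f :=
  have (y : TopCat.of Y) : IsIso ((TopCat.Presheaf.stalkFunctor (ModuleCat.{0} k) y).map f.hom) :=
    (ConcreteCategory.isIso_iff_bijective _).2 (h y)
  TopCat.Presheaf.isIso_of_stalkFunctor_map_iso f

theorem stalkMap_bijective_of_isIso (f : A ⟶ B) [IsIso f] (y : Y) :
    Function.Bijective (stalkMap f y) :=
  Function.bijective_iff_has_inverse.2 ⟨stalkMap (inv f) y,
    fun x => by rw [← stalkMap_comp, IsIso.hom_inv_id, stalkMap_id],
    fun x => by rw [← stalkMap_comp, IsIso.inv_hom_id, stalkMap_id]⟩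

theorem ker_stalkMap_cokernel_π (f : A ⟶ B) (y : Y) :
    LinearMap.ker (stalkMap (Limits.cokernel.π f) y) = stalkRange f y := by
  have h_exact := (TopCat.Sheaf.exact_iff_stalkFunctor_map_exact _).1
    (ShortComplex.exact_cokernel f) y
  exact ((ShortComplex.moduleCat_exact_iff_range_eq_ker _).1 h_exact).symm

theorem stalkMap_cokernel_π_surjective (f : A ⟶ B) (y : Y) :
    Function.Surjective (stalkMap (Limits.cokernel.π f) y) :=
  (ModuleCat.epi_iff_surjective _).1 (inferInstanceAs (Epi
    ((TopCat.Sheaf.forget (ModuleCat.{0} k) (TopCat.of Y) ⋙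
      TopCat.Presheaf.stalkFunctor (ModuleCat.{0} k) y).map (Limits.cokernel.π f))))

theorem exists_lift_of_stalkRange_le (i : B ⟶ C) [Mono i] (f : A ⟶ C)
    (h : ∀ y, stalkRange f y ≤ stalkRange i y) : ∃ g : A ⟶ B, g ≫ i = f := by
  have h_zero : f ≫ Limits.cokernel.π i = 0 := hom_ext_of_stalkMap fun y x => by
    have h_mem : stalkMap f y x ∈ LinearMap.ker (stalkMap (Limits.cokernel.π i) y) := by
      rw [ker_stalkMap_cokernel_π]
      exact h y ⟨x, rfl⟩
    rw [stalkMap_comp, LinearMap.mem_ker.1 h_mem]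
    exact (congrArg (fun φ => φ.hom x) ((TopCat.Presheaf.stalkFunctor (X := TopCat.of Y)
      (ModuleCat.{0} k) y).map_zero A.presheaf (Limits.cokernel i).presheaf)).symm
  exact ⟨Abelian.monoLift i f h_zero, Abelian.monoLift_comp i f h_zero⟩

theorem mem_stalkRange_subSheafIncl {P : ∀ y, Submodule k (stk A y)} {x : stk A y} :
    x ∈ stalkRange (subSheafIncl A P) y ↔ ∃ U : Opens Y, y ∈ U ∧ ∃ s : sec A U,
      germAt A U y s = x ∧ ∀ y' ∈ U, germAt A U y' s ∈ P y' := by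
  constructor
  · rintro ⟨z, rfl⟩
    obtain ⟨U, hU, s, rfl⟩ := exists_germAt_eq (subSheaf A P) z
    refine ⟨U, hU, s.1, (stalkMap_germAt (subSheafIncl A P) U y s).symm, fun y' hy' => ?_⟩
    rw [germAt_of_mem hy']
    exact mem_secIn.1 s.2 y' hy'
  · rintro ⟨U, _, s, rfl, hs⟩
    have hs_mem : s ∈ secIn A P U := mem_secIn.2 fun y' hy' => by
      rw [← germAt_of_mem hy']
      exact hs y' hy'
    exact ⟨germAt (subSheaf A P) U y ⟨s, hs_mem⟩,
      stalkMap_germAt (subSheafIncl A P) U y ⟨s, hs_mem⟩⟩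

theorem stalkRange_subSheafIncl {P : ∀ y, Submodule k (stk A y)} (j : C ⟶ A)
    (hP : ∀ y, P y = stalkRange j y) :
    stalkRange (subSheafIncl A P) y = stalkRange j y := by
  ext x
  rw [mem_stalkRange_subSheafIncl]
  constructor
  · rintro ⟨U, hU, s, rfl, hs⟩
    exact hP y ▸ hs y hU
  · rintro ⟨c, rfl⟩
    obtain ⟨U, hU, t, rfl⟩ := exists_germAt_eq C c
    refine ⟨U, hU, secMap j U t, (stalkMap_germAt j U y t).symm, fun y' _ => ?_⟩
    rw [hP, ← stalkMap_germAt]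
    exact ⟨_, rfl⟩

theorem mem_stalkRange_comp_inv_iff {x : stk A y} (i : C ⟶ B) (f : A ⟶ B) [IsIso f] :
    x ∈ stalkRange (i ≫ inv f) y ↔ stalkMap f y x ∈ stalkRange i y := by
  refine exists_congr fun c => ?_
  rw [← (stalkMap_bijective_of_isIso f y).1.eq_iff, ← stalkMap_comp, Category.assoc,
    IsIso.inv_hom_id, Category.comp_id]

theorem mem_stalkRange_subSheafIncl_iff_of_isIso {P : ∀ y, Submodule k (stk A y)} {x : stk A y}
    (i : C ⟶ B) (f : A ⟶ B) (hf : IsIso f)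
    (hP : ∀ y x, x ∈ P y ↔ stalkMap f y x ∈ stalkRange i y) :
    x ∈ stalkRange (subSheafIncl A P) y ↔ stalkMap f y x ∈ stalkRange i y := by
  have h_eq (y : Y) : P y = stalkRange (i ≫ inv f) y :=
    Submodule.ext fun x => (hP y x).trans (mem_stalkRange_comp_inv_iff i f).symm
  rw [stalkRange_subSheafIncl _ h_eq, mem_stalkRange_comp_inv_iff]

theorem mono_subSheafIncl (A : Sh k Y) (P : ∀ y, Submodule k (stk A y)) :
    Mono (subSheafIncl A P) := by
  refine ⟨fun g g' h => Sheaf.hom_ext (NatTrans.ext (funext fun U =>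
    ModuleCat.hom_ext (LinearMap.ext fun s => Subtype.ext ?_)))⟩
  exact congrArg (fun φ => (φ.hom.app U).hom s) h

end Germs

section Skyscraper

open StalkSkyscraperPresheafAdjunctionAuxs

variable {k : Type} [Field k] {Y : Type} [TopologicalSpace Y] (A : Sh k Y) (y : Y)
  (M : ModuleCat.{0} k)

open Classical in
/-- The adjunction between stalks and skyscraper sheaves, with linear maps on stalks. -/
def skyscraperHomEquiv :
    (A ⟶ skyscraperSheaf (X := TopCat.of Y) y M) ≃ (stk A y →ₗ[k] M) where
  toFun b := (fromStalk (X := TopCat.of Y) (𝓕 := A.presheaf) (c := M) y b.hom).hom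
  invFun φ := ⟨toSkyscraperPresheaf (X := TopCat.of Y) (𝓕 := A.presheaf) y (ModuleCat.ofHom φ)⟩
  left_inv b := Sheaf.hom_ext (to_skyscraper_fromStalk (X := TopCat.of Y) (𝓕 := A.presheaf) y b.hom)
  right_inv φ := congrArg ModuleCat.Hom.hom
    (fromStalk_to_skyscraper (X := TopCat.of Y) (𝓕 := A.presheaf) y (ModuleCat.ofHom φ))

variable {A y M}

open Classical in
theorem skyscraperHomEquiv_germAt (b : A ⟶ skyscraperSheaf (X := TopCat.of Y) y M)
    {U : Opens Y} (hy : y ∈ U) (s : sec A U) :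
    skyscraperHomEquiv A y M b (germAt A U y s) =
      (eqToHom (if_pos hy) : (skyscraperSheaf (X := TopCat.of Y) y M).presheaf.obj (op U) ⟶ M).hom
        (secMap b U s) := by
  rw [germAt_of_mem hy]
  exact congrArg (fun φ => φ.hom s)
    (germ_fromStalk (X := TopCat.of Y) (𝓕 := A.presheaf) (c := M) y b.hom U hy)

end Skyscraper

section InverseImage

variable {k : Type} [Field k] {T X : Type} [TopologicalSpace T] [TopologicalSpace X]
  (f : TopCat.of T ⟶ TopCat.of X) (F : Sh k X)

/-- The inverse image sheaf `f^* F`. -/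
abbrev pullSheaf : Sh k T := (TopCat.Sheaf.pullback (ModuleCat.{0} k) f).obj F

/-- The direct image sheaf `f_* A`. -/
abbrev pushSheaf (A : Sh k T) : Sh k X := (TopCat.Sheaf.pushforward (ModuleCat.{0} k) f).obj A

/-- The preimage of an open set under a morphism of `TopCat`. -/
abbrev preimageOpens (N : Opens X) : Opens T := (Opens.map f).obj N

/-- The unit `F ⟶ f_* f^* F` of the adjunction `f^* ⊣ f_*`. -/
abbrev pullUnit : F ⟶ pushSheaf f (pullSheaf f F) :=
  (TopCat.Sheaf.pullbackPushforwardAdjunction (ModuleCat.{0} k) f).unit.app F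

/-- The inverse image in `(f^* F)(f⁻¹ N)` of a section of `F` over `N`. -/
def pullSec (N : Opens X) : sec F N →ₗ[k] sec (pullSheaf f F) (preimageOpens f N) :=
  secMap (pullUnit f F) N

/-- The natural map `(f_* A)_{f w} → A_w`. -/
def pushStalk (A : Sh k T) (w : T) : stk (pushSheaf f A) (f.hom w) →ₗ[k] stk A w :=
  (TopCat.Presheaf.stalkPushforward (ModuleCat.{0} k) f A.presheaf w).hom

variable {f F} {N : Opens X} {V W : Opens T} {w : T}

theorem pushStalk_germAt (A : Sh k T) (h : f.hom w ∈ N) (s : sec A (preimageOpens f N)) :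
    pushStalk f A w (germAt (pushSheaf f A) N (f.hom w) s) =
      germAt A (preimageOpens f N) w s := by
  rw [germAt_of_mem h, germAt_of_mem (show w ∈ preimageOpens f N from h)]
  exact congrArg (fun φ => φ.hom s)
    (TopCat.Presheaf.stalkPushforward_germ (ModuleCat.{0} k) f A.presheaf N w h)

variable (f F) in
/-- The natural map `F_{f w} → (f^* F)_w`. -/
def pullStalk (w : T) : stk F (f.hom w) →ₗ[k] stk (pullSheaf f F) w :=
  pushStalk f _ w ∘ₗ stalkMap (pullUnit f F) (f.hom w)

theorem pullStalk_germAt (h : f.hom w ∈ N) (t : sec F N) :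
    pullStalk f F w (germAt F N (f.hom w) t) =
      germAt (pullSheaf f F) (preimageOpens f N) w (pullSec f F N t) := by
  rw [pullStalk, LinearMap.comp_apply, stalkMap_germAt]
  exact pushStalk_germAt _ h _

open Classical in
theorem skyscraperHomEquiv_pullStalk {M : ModuleCat.{0} k}
    {b : pullSheaf f F ⟶ skyscraperSheaf (X := TopCat.of T) w M}
    {α : F ⟶ pushSheaf f (skyscraperSheaf (X := TopCat.of T) w M)}
    (hb : pullUnit f F ≫ (TopCat.Sheaf.pushforward _ f).map b = α) (x : stk F (f.hom w)) :
    skyscraperHomEquiv _ w M b (pullStalk f F w x) =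
      skyscraperHomEquiv F (f.hom w) M α x := by
  subst hb
  obtain ⟨N, hN, t, rfl⟩ := exists_germAt_eq F x
  rw [pullStalk_germAt hN, skyscraperHomEquiv_germAt b (show w ∈ preimageOpens f N from hN)]
  exact (skyscraperHomEquiv_germAt
    (pullUnit f F ≫ (TopCat.Sheaf.pushforward _ f).map b) hN t).symm

theorem exists_pullUnit_comp_eq {B : Sh k T} (α : F ⟶ pushSheaf f B) :
    ∃ b : pullSheaf f F ⟶ B, pullUnit f F ≫ (TopCat.Sheaf.pushforward _ f).map b = α :=
  ⟨((TopCat.Sheaf.pullbackPushforwardAdjunction (ModuleCat.{0} k) f).homEquiv F _).symm α, by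
    rw [← Adjunction.homEquiv_unit, Equiv.apply_symm_apply]⟩

theorem pullSheaf_hom_ext {B : Sh k T} {b c : pullSheaf f F ⟶ B}
    (h : pullUnit f F ≫ (TopCat.Sheaf.pushforward _ f).map b =
      pullUnit f F ≫ (TopCat.Sheaf.pushforward _ f).map c) : b = c :=
  ((TopCat.Sheaf.pullbackPushforwardAdjunction (ModuleCat.{0} k) f).homEquiv F _).injective
    (by rwa [Adjunction.homEquiv_unit, Adjunction.homEquiv_unit])

theorem pullStalk_injective : Function.Injective (pullStalk f F w) := by
  classical
  let q := skyscraperHomEquiv F (f.hom w) (stk F (f.hom w))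
  obtain ⟨b, hb⟩ := exists_pullUnit_comp_eq
    (B := skyscraperSheaf (X := TopCat.of T) w (stk F (f.hom w))) (q.symm LinearMap.id)
  have h_left_inv : Function.LeftInverse (skyscraperHomEquiv _ w _ b) (pullStalk f F w) :=
    fun x => (skyscraperHomEquiv_pullStalk hb x).trans
      (congrArg (fun φ => φ x) (q.apply_symm_apply LinearMap.id))
  exact h_left_inv.injective

theorem pullStalk_surjective : Function.Surjective (pullStalk f F w) := by
  classical
  let M : ModuleCat.{0} k := ModuleCat.of k (stk (pullSheaf f F) w ⧸ (pullStalk f F w).range)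
  let q := skyscraperHomEquiv (pullSheaf f F) w M
  have h_eq : q.symm (Submodule.mkQ _) = q.symm 0 := pullSheaf_hom_ext <|
    (skyscraperHomEquiv F (f.hom w) M).injective <| LinearMap.ext fun x =>
      (skyscraperHomEquiv_pullStalk rfl x).symm.trans <| Eq.trans (by
        rw [Equiv.apply_symm_apply, Equiv.apply_symm_apply]
        exact (Submodule.Quotient.mk_eq_zero _).2 ⟨x, rfl⟩) (skyscraperHomEquiv_pullStalk rfl x)
  rw [← LinearMap.range_eq_top, ← Submodule.ker_mkQ (pullStalk f F w).range,
    q.symm.injective h_eq, LinearMap.ker_zero]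

variable (f F) in
/-- The isomorphism `F_{f w} ≃ (f^* F)_w`. -/
def pullStalkEquiv (w : T) : stk F (f.hom w) ≃ₗ[k] stk (pullSheaf f F) w :=
  LinearEquiv.ofBijective (pullStalk f F w) ⟨pullStalk_injective, pullStalk_surjective⟩

variable (f F) in
/-- The value at `w` of a section of `f^* F`, as an element of `F_{f w}`. -/
def pullVal (V : Opens T) (w : T) : sec (pullSheaf f F) V →ₗ[k] stk F (f.hom w) :=
  (pullStalkEquiv f F w).symm.toLinearMap ∘ₗ germAt (pullSheaf f F) V w

theorem pullStalk_pullVal (s : sec (pullSheaf f F) V) :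
    pullStalk f F w (pullVal f F V w s) = germAt (pullSheaf f F) V w s :=
  (pullStalkEquiv f F w).apply_symm_apply _

theorem pullVal_eq_iff {s : sec (pullSheaf f F) V} {x : stk F (f.hom w)} :
    pullVal f F V w s = x ↔ germAt (pullSheaf f F) V w s = pullStalk f F w x := by
  rw [← pullStalk_pullVal, pullStalk_injective.eq_iff]

theorem pullVal_pullSec (h : f.hom w ∈ N) (t : sec F N) :
    pullVal f F (preimageOpens f N) w (pullSec f F N t) = germAt F N (f.hom w) t :=
  pullVal_eq_iff.2 (pullStalk_germAt h t).symm

theorem pullVal_secRes (h : W ≤ V) (hw : w ∈ W) (s : sec (pullSheaf f F) V) :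
    pullVal f F W w (secRes _ h s) = pullVal f F V w s := by
  rw [pullVal_eq_iff, germAt_secRes _ hw, pullStalk_pullVal]

theorem eventually_map_mem {g : T → X} (hg : Continuous g) (h : g w ∈ N) :
    ∀ᶠ w' in 𝓝 w, g w' ∈ N :=
  hg.continuousAt.eventually (eventually_mem_opens h)

theorem exists_eventually_pullVal_eq (s : sec (pullSheaf f F) V) (hw : w ∈ V) :
    ∃ N : Opens X, f.hom w ∈ N ∧ ∃ t : sec F N,
      ∀ᶠ w' in 𝓝 w, pullVal f F V w' s = germAt F N (f.hom w') t := by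
  obtain ⟨N, hN, t, ht⟩ := exists_germAt_eq F (pullVal f F V w s)
  have h_germ : germAt (pullSheaf f F) V w s =
      germAt (pullSheaf f F) (preimageOpens f N) w (pullSec f F N t) := by
    rw [← pullStalk_germAt hN, ht, pullStalk_pullVal]
  refine ⟨N, hN, t, ?_⟩
  filter_upwards [eventually_germAt_eq hw (show w ∈ preimageOpens f N from hN) h_germ,
    eventually_map_mem f.hom.continuous hN] with w' hw' hNw'
  rw [pullVal_eq_iff, hw', pullStalk_germAt hNw']

theorem pullSheaf_sec_ext {s t : sec (pullSheaf f F) V}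
    (h : ∀ w ∈ V, pullVal f F V w s = pullVal f F V w t) : s = t :=
  sec_ext fun w hw => by rw [← pullStalk_pullVal, h w hw, pullStalk_pullVal]

theorem exists_sec_pullVal_eq (V : Opens T) (g : ∀ w, stk F (f.hom w))
    (hg : ∀ w ∈ V, ∃ N : Opens X, f.hom w ∈ N ∧ ∃ t : sec F N,
      ∀ᶠ w' in 𝓝 w, g w' = germAt F N (f.hom w') t) :
    ∃ s : sec (pullSheaf f F) V, ∀ w ∈ V, pullVal f F V w s = g w := by
  obtain ⟨s, hs⟩ := exists_sec_of_eventually_germAt_eq (pullSheaf f F) V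
    (fun w => pullStalk f F w (g w)) (fun w hw => by
      obtain ⟨N, hN, t, ht⟩ := hg w hw
      refine ⟨preimageOpens f N, hN, pullSec f F N t, ?_⟩
      filter_upwards [ht, eventually_map_mem f.hom.continuous hN] with w' hw' hNw'
      rw [hw', pullStalk_germAt hNw'])
  exact ⟨s, fun w hw => pullVal_eq_iff.2 (hs w hw)⟩

theorem stalkMap_pullStalk {F' : Sh k X} (φ : F ⟶ F') (x : stk F (f.hom w)) :
    stalkMap ((TopCat.Sheaf.pullback _ f).map φ) w (pullStalk f F w x) =
      pullStalk f F' w (stalkMap φ (f.hom w) x) := by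
  obtain ⟨N, hN, t, rfl⟩ := exists_germAt_eq F x
  rw [pullStalk_germAt hN, stalkMap_germAt, stalkMap_germAt, pullStalk_germAt hN]
  have h_unit :=
    (TopCat.Sheaf.pullbackPushforwardAdjunction (ModuleCat.{0} k) f).unit.naturality φ
  exact congrArg _ (congrArg (fun ψ => (ψ.hom.app (op N)).hom t) h_unit).symm

theorem pullStalk_mem_stalkRange_iff {F' : Sh k X} (φ : F ⟶ F') {x : stk F' (f.hom w)} :
    pullStalk f F' w x ∈ stalkRange ((TopCat.Sheaf.pullback (ModuleCat.{0} k) f).map φ) w ↔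
      x ∈ stalkRange φ (f.hom w) := by
  constructor
  · rintro ⟨a, ha⟩
    obtain ⟨b, rfl⟩ := pullStalk_surjective a
    exact ⟨b, pullStalk_injective ((stalkMap_pullStalk φ b).symm.trans ha)⟩
  · rintro ⟨b, rfl⟩
    exact ⟨pullStalk f F w b, stalkMap_pullStalk φ b⟩

theorem pullVal_map {F' : Sh k X} (φ : F ⟶ F') (s : sec (pullSheaf f F) V) :
    pullVal f F' V w (secMap ((TopCat.Sheaf.pullback _ f).map φ) V s) =
      stalkMap φ (f.hom w) (pullVal f F V w s) := by
  rw [pullVal_eq_iff, ← stalkMap_germAt, ← pullStalk_pullVal, stalkMap_pullStalk]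

theorem pullVal_baseChange {T' : Type} [TopologicalSpace T'] {g : TopCat.of T' ⟶ TopCat.of T}
    {b : pullSheaf f F ⟶ pushSheaf g (pullSheaf (g ≫ f) F)}
    (hb : pullUnit f F ≫ (TopCat.Sheaf.pushforward _ f).map b = pullUnit (g ≫ f) F)
    {w : T'} (hw : g.hom w ∈ V) (s : sec (pullSheaf f F) V) :
    pullVal (g ≫ f) F (preimageOpens g V) w (secMap b V s) = pullVal f F V (g.hom w) s := by
  obtain ⟨N, hN, t, ht⟩ := exists_germAt_eq F (pullVal f F V (g.hom w) s)
  have h_stalk : stalkMap b (g.hom w) (germAt (pullSheaf f F) V (g.hom w) s) =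
      germAt _ (preimageOpens f N) (g.hom w) (secMap b (preimageOpens f N) (pullSec f F N t)) := by
    rw [← pullStalk_pullVal, ← ht, pullStalk_germAt hN, stalkMap_germAt]
  refine (pullVal_eq_iff (f := g ≫ f)).2 ?_
  rw [← ht]
  calc germAt (pullSheaf (g ≫ f) F) (preimageOpens g V) w (secMap b V s)
      = pushStalk g _ w (stalkMap b (g.hom w) (germAt (pullSheaf f F) V (g.hom w) s)) := by
        rw [stalkMap_germAt]
        exact (pushStalk_germAt _ hw _).symm
    _ = germAt _ (preimageOpens (g ≫ f) N) w
          (secMap b (preimageOpens f N) (pullSec f F N t)) := by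
        rw [h_stalk]
        exact pushStalk_germAt _ (N := preimageOpens f N) (w := w) hN _
    _ = germAt _ (preimageOpens (g ≫ f) N) w (pullSec (g ≫ f) F N t) :=
        congrArg _ (congrArg (fun ψ => secMap ψ N t) hb)
    _ = pullStalk (g ≫ f) F w (germAt F N (f.hom (g.hom w)) t) :=
        (pullStalk_germAt (N := N) (w := w) hN t).symm

end InverseImage

/-! ### Sections of `R⁰q_* p^* F` as families of germs of `F` -/

/-- A family of germs `s w ∈ F_{f w}` is, on the subset `A`, locally given by sections of `F`. -/
def IsLocallySection {k : Type} [Field k] {T X : Type} [TopologicalSpace T] [TopologicalSpace X]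
    (F : Sh k X) (f : T → X) (A : Set T) (s : ∀ w, stk F (f w)) : Prop :=
  ∀ w ∈ A, ∃ N : Opens X, f w ∈ N ∧ ∃ t : sec F N, ∀ᶠ w' in 𝓝[A] w, s w' = germAt F N (f w') t

theorem IsLocallySection.mono {k : Type} [Field k] {T X : Type} [TopologicalSpace T]
    [TopologicalSpace X] {F : Sh k X} {f : T → X} {A B : Set T} {s : ∀ w, stk F (f w)}
    (h : IsLocallySection F f A s) (hBA : B ⊆ A) : IsLocallySection F f B s := by
  intro w hw
  obtain ⟨N, hN, t, ht⟩ := h w (hBA hw)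
  exact ⟨N, hN, t, ht.filter_mono (nhdsWithin_mono w hBA)⟩

section Transform

variable {k : Type} [Field k] {X Y : Type} [TopologicalSpace X] [TopologicalSpace Y]

/-- The part of `Z` over `V`. -/
def partOver (Z : Set (X × Y)) (V : Opens Y) : Set (X × Y) := {w | w ∈ Z ∧ w.2 ∈ V}

variable (Z : Set (X × Y)) (F : Sh k X)

/-- The sheaf `R⁰q_* p^* F`. -/
abbrev transform : Sh k Y := (pullPush k Z).obj F

/-- The identity, regarding a section of `q_* p^* F` as a section of `p^* F`. -/
def toPullSec (V : Opens Y) :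
    sec (transform Z F) V →ₗ[k] sec (pullSheaf (projFst Z) F) (preimageOpens (projSnd Z) V) :=
  LinearMap.id

open Classical in
/-- The value at `w` of a section of `R⁰q_* p^* F`, as an element of `F_{w.1}`; it is `0` for
`w ∉ Z`. -/
def valueAt (V : Opens Y) (w : X × Y) : sec (transform Z F) V →ₗ[k] stk F w.1 :=
  if h : w ∈ Z then
    pullVal (projFst Z) F (preimageOpens (projSnd Z) V) ⟨w, h⟩ ∘ₗ toPullSec Z F V
  else 0

variable {Z F} {V W : Opens Y} {w : X × Y}

theorem valueAt_of_mem (h : w ∈ Z) (s : sec (transform Z F) V) :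
    valueAt Z F V w s =
      pullVal (projFst Z) F (preimageOpens (projSnd Z) V) ⟨w, h⟩ (toPullSec Z F V s) := by
  rw [valueAt, dif_pos h]
  rfl

theorem eventually_partOver_iff (h : w ∈ Z) (hV : w.2 ∈ V) {P : X × Y → Prop} :
    (∀ᶠ w' in 𝓝[partOver Z V] w, P w') ↔ ∀ᶠ w' : Z in 𝓝 (⟨w, h⟩ : Z), P w' := by
  have h_nhds : 𝓝[partOver Z V] w = 𝓝[Z] w :=
    nhdsWithin_inter_of_mem' (s := Z) (t := Prod.snd ⁻¹' (V : Set Y))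
      (mem_nhdsWithin_of_mem_nhds ((V.isOpen.preimage continuous_snd).mem_nhds hV))
  rw [h_nhds, nhdsWithin_eq_map_subtype_coe h]
  rfl

theorem isLocallySection_valueAt (s : sec (transform Z F) V) :
    IsLocallySection F Prod.fst (partOver Z V) (fun w => valueAt Z F V w s) := by
  rintro w ⟨h, hV⟩
  obtain ⟨N, hN, t, ht⟩ := exists_eventually_pullVal_eq (toPullSec Z F V s) (w := ⟨w, h⟩) hV
  refine ⟨N, hN, t, (eventually_partOver_iff h hV).2 ?_⟩
  filter_upwards [ht] with w' hw'
  rw [valueAt_of_mem w'.2]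
  exact hw'

theorem transform_sec_ext {s t : sec (transform Z F) V}
    (h : ∀ w ∈ partOver Z V, valueAt Z F V w s = valueAt Z F V w t) : s = t := by
  refine pullSheaf_sec_ext (f := projFst Z) (V := preimageOpens (projSnd Z) V) fun w hw => ?_
  have h_value := h w.1 ⟨w.2, hw⟩
  rwa [valueAt_of_mem w.2, valueAt_of_mem w.2] at h_value

theorem exists_valueAt_eq {g : ∀ w : X × Y, stk F w.1}
    (hg : IsLocallySection F Prod.fst (partOver Z V) g) :
    ∃ s : sec (transform Z F) V, ∀ w ∈ partOver Z V, valueAt Z F V w s = g w := by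
  obtain ⟨s, hs⟩ := exists_sec_pullVal_eq (f := projFst Z) (preimageOpens (projSnd Z) V)
    (fun w => g w.1) (fun w hw => by
      obtain ⟨N, hN, t, ht⟩ := hg w.1 ⟨w.2, hw⟩
      exact ⟨N, hN, t, (eventually_partOver_iff w.2 hw).1 ht⟩)
  refine ⟨s, fun w hw => ?_⟩
  exact (valueAt_of_mem (F := F) (V := V) hw.1 s).trans (hs ⟨w, hw.1⟩ hw.2)

theorem valueAt_secRes (h : W ≤ V) (hw : w.2 ∈ W) (s : sec (transform Z F) V) :
    valueAt Z F W w (secRes _ h s) = valueAt Z F V w s := by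
  by_cases hZ : w ∈ Z
  · rw [valueAt_of_mem hZ, valueAt_of_mem hZ]
    exact pullVal_secRes (V := preimageOpens (projSnd Z) V) (W := preimageOpens (projSnd Z) W)
      (fun a ha => h ha) (w := ⟨w, hZ⟩) hw (toPullSec Z F V s)
  · simp [valueAt, hZ]

theorem valueAt_map {F' : Sh k X} (φ : F ⟶ F') (V : Opens Y) (w : X × Y)
    (s : sec (transform Z F) V) :
    valueAt Z F' V w (secMap ((pullPush k Z).map φ) V s) =
      stalkMap φ w.1 (valueAt Z F V w s) := by
  by_cases hZ : w ∈ Z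
  · rw [valueAt_of_mem hZ, valueAt_of_mem hZ]
    exact pullVal_map (f := projFst Z) φ (V := preimageOpens (projSnd Z) V) (w := ⟨w, hZ⟩)
      (toPullSec Z F V s)
  · simp [valueAt, hZ]

theorem valueAt_pullPushRes {Z' : Set (X × Y)} (h : Z' ⊆ Z) (hw : w ∈ partOver Z' V)
    (s : sec (transform Z F) V) :
    valueAt Z' F V w (secMap ((pullPushRes h).app F) V s) = valueAt Z F V w s := by
  rw [valueAt_of_mem hw.1, valueAt_of_mem (h hw.1)]
  exact pullVal_baseChange (g := inclMap h) (unit_baseRes h F)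
    (V := preimageOpens (projSnd Z) V) (w := ⟨w, hw.1⟩) hw.2 (toPullSec Z F V s)

theorem eventually_valueAt_eq {s : sec (transform Z F) V} {t : sec (transform Z F) W} {y : Y}
    (hV : y ∈ V) (hW : y ∈ W) (h : germAt _ V y s = germAt _ W y t) :
    ∀ᶠ y' in 𝓝 y, ∀ x, valueAt Z F V (x, y') s = valueAt Z F W (x, y') t := by
  rw [germAt_of_mem hV, germAt_of_mem hW] at h
  obtain ⟨U, hU, iV, iW, h_res⟩ :=
    TopCat.Presheaf.germ_eq (transform Z F).presheaf y hV hW s t h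
  replace h_res : secRes (transform Z F) iV.le s = secRes (transform Z F) iW.le t := h_res
  filter_upwards [eventually_mem_opens hU] with y' hy' x
  rw [← valueAt_secRes iV.le (w := (x, y')) hy', h_res,
    valueAt_secRes iW.le (w := (x, y')) hy']

theorem germAt_eq_of_valueAt_eq {s : sec (transform Z F) V} {t : sec (transform Z F) W} {y : Y}
    (hV : y ∈ V) (hW : y ∈ W)
    (h : ∀ᶠ y' in 𝓝 y, ∀ x, (x, y') ∈ Z →
      valueAt Z F V (x, y') s = valueAt Z F W (x, y') t) :
    germAt _ V y s = germAt _ W y t := by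
  obtain ⟨O, hO, hOo, hyO⟩ := eventually_nhds_iff.1 h
  let U : Opens Y := V ⊓ W ⊓ ⟨O, hOo⟩
  have hU : y ∈ U := ⟨⟨hV, hW⟩, hyO⟩
  have hUV : U ≤ V := inf_le_left.trans inf_le_left
  have hUW : U ≤ W := inf_le_left.trans inf_le_right
  rw [← germAt_secRes hUV hU s, ← germAt_secRes hUW hU t]
  congr 1
  refine transform_sec_ext fun w hw => ?_
  rw [valueAt_secRes hUV hw.2, valueAt_secRes hUW hw.2]
  exact hO w.2 hw.2.2 w.1 hw.1

/-- The section of `R⁰q_* p^* F` given by a section of `F`. -/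
def transformSec {N : Opens X} (h : ∀ w ∈ partOver Z V, w.1 ∈ N) :
    sec F N →ₗ[k] sec (transform Z F) V :=
  secRes (pullSheaf (projFst Z) F)
    (V := preimageOpens (projSnd Z) V) (U := preimageOpens (projFst Z) N)
    (fun w hw => h w.1 ⟨w.2, hw⟩) ∘ₗ pullSec (projFst Z) F N

theorem valueAt_transformSec {N : Opens X} (h : ∀ w ∈ partOver Z V, w.1 ∈ N)
    (hw : w ∈ partOver Z V) (t : sec F N) :
    valueAt Z F V w (transformSec h t) = germAt F N w.1 t := by
  rw [valueAt_of_mem hw.1]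
  refine (pullVal_secRes (V := preimageOpens (projFst Z) N) (W := preimageOpens (projSnd Z) V)
    (fun w hw => h w.1 ⟨w.2, hw⟩) (w := ⟨w, hw.1⟩) hw.2 _).trans ?_
  exact pullVal_pullSec (f := projFst Z) (w := ⟨w, hw.1⟩) (h w hw) t

end Transform

section BaseChange

variable {k : Type} [Field k] {X Y Y' : Type} [TopologicalSpace X] [TopologicalSpace Y]
  [TopologicalSpace Y'] {Z : Set (X × Y)} {Z' : Set (X × Y')} (g : TopCat.of Y' ⟶ TopCat.of Y)

/-- The map `(x, y') ↦ (x, g y')` from `Z'` to `Z`. -/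
def baseMap (hg : ∀ w ∈ Z', (w.1, g.hom w.2) ∈ Z) : TopCat.of Z' ⟶ TopCat.of Z :=
  TopCat.ofHom ⟨fun w => ⟨(w.1.1, g.hom w.1.2), hg w.1 w.2⟩, by
    refine Continuous.subtype_mk (Continuous.prodMk ?_ ?_) _
    · exact continuous_fst.comp continuous_subtype_val
    · exact g.hom.continuous.comp (continuous_snd.comp continuous_subtype_val)⟩

theorem exists_transformBaseChange (hg : ∀ w ∈ Z', (w.1, g.hom w.2) ∈ Z) (F : Sh k X) :
    ∃ b : transform Z F ⟶ pushSheaf g (transform Z' F),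
      ∀ (V : Opens Y) (s : sec (transform Z F) V), ∀ w ∈ partOver Z' (preimageOpens g V),
        valueAt Z' F (preimageOpens g V) w (secMap b V s) =
          valueAt Z F V (w.1, g.hom w.2) s := by
  obtain ⟨b, hb⟩ := exists_pullUnit_comp_eq (f := projFst Z)
    (B := pushSheaf (baseMap g hg) (pullSheaf (baseMap g hg ≫ projFst Z) F))
    (pullUnit (baseMap g hg ≫ projFst Z) F)
  refine ⟨(TopCat.Sheaf.pushforward (ModuleCat.{0} k) (projSnd Z)).map b, fun V s w hw => ?_⟩
  rw [valueAt_of_mem (hg w hw.1)]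
  refine (valueAt_of_mem (F := F) (V := preimageOpens g V) hw.1 _).trans ?_
  exact pullVal_baseChange (g := baseMap g hg) hb
    (V := preimageOpens (projSnd Z) V) (w := ⟨w, hw.1⟩) hw.2 (toPullSec Z F V s)

/-- The base change map `q_* p^* F ⟶ g_* q'_* p'^* F`. -/
def transformBaseChange (hg : ∀ w ∈ Z', (w.1, g.hom w.2) ∈ Z) (F : Sh k X) :
    transform Z F ⟶ pushSheaf g (transform Z' F) :=
  (exists_transformBaseChange g hg F).choose

theorem valueAt_transformBaseChange (hg : ∀ w ∈ Z', (w.1, g.hom w.2) ∈ Z) (F : Sh k X)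
    {V : Opens Y} (s : sec (transform Z F) V) {w : X × Y'}
    (hw : w ∈ partOver Z' (preimageOpens g V)) :
    valueAt Z' F (preimageOpens g V) w (secMap (transformBaseChange g hg F) V s) =
      valueAt Z F V (w.1, g.hom w.2) s :=
  (exists_transformBaseChange g hg F).choose_spec V s w hw

theorem hom_ext_of_secMap {A B : Sh k Y} {a b : A ⟶ B}
    (h : ∀ (V : Opens Y) (s : sec A V), secMap a V s = secMap b V s) : a = b :=
  Sheaf.hom_ext (NatTrans.ext (funext fun U =>
    ModuleCat.hom_ext (LinearMap.ext fun s => h U.unop s)))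

end BaseChange

/-! ### The restriction map `R⁰q_{1*} p_1^* ⟶ colim_r R⁰n_{r*} m_r^*` -/

section Restriction

variable {k : Type} [Field k] {X Y : Type} [TopologicalSpace X] [TopologicalSpace Y]
  {Z Z' : Set (X × Y)} {y : Y}

theorem stalkMap_pullPushRes_injective (h : Z' ⊆ Z) (F : Sh k X)
    (hy : ∀ᶠ y' in 𝓝 y, ∀ x, (x, y') ∈ Z → (x, y') ∈ Z') :
    Function.Injective (stalkMap ((pullPushRes (k := k) h).app F) y) := by
  rw [injective_iff_map_eq_zero]
  intro x hx
  obtain ⟨V, hV, s, rfl⟩ := exists_germAt_eq (transform Z F) x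
  rw [stalkMap_germAt, ← map_zero (germAt (transform Z' F) V y)] at hx
  rw [← map_zero (germAt (transform Z F) V y)]
  refine germAt_eq_of_valueAt_eq hV hV ?_
  filter_upwards [eventually_valueAt_eq hV hV hx, hy, eventually_mem_opens hV]
    with y' h_value h_mem hVy' x hxZ
  have h_zero := h_value x
  rw [valueAt_pullPushRes h (w := (x, y')) ⟨h_mem x hxZ, hVy'⟩, map_zero] at h_zero
  rw [h_zero, map_zero]

theorem stalkMap_pullPushRes_surjective (h : Z' ⊆ Z) (F : Sh k X)
    (hy : ∀ᶠ y' in 𝓝 y, ∀ x, (x, y') ∈ Z → (x, y') ∈ Z') :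
    Function.Surjective (stalkMap ((pullPushRes (k := k) h).app F) y) := by
  intro x
  obtain ⟨O, hO, hOo, hyO⟩ := eventually_nhds_iff.1 hy
  obtain ⟨V, hV, s, rfl⟩ := exists_germAt_eq (transform Z' F) x
  let W : Opens Y := V ⊓ ⟨O, hOo⟩
  have h_part : partOver Z W ⊆ partOver Z' V := fun w hw => ⟨hO w.2 hw.2.2 w.1 hw.1, hw.2.1⟩
  obtain ⟨t, ht⟩ := exists_valueAt_eq ((isLocallySection_valueAt s).mono h_part)
  have hyW : y ∈ W := ⟨hV, hyO⟩
  refine ⟨germAt (transform Z F) W y t, ?_⟩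
  rw [stalkMap_germAt]
  refine germAt_eq_of_valueAt_eq hyW hV ?_
  filter_upwards [eventually_mem_opens hyW] with y' hWy' x hx
  rw [valueAt_pullPushRes h (w := (x, y')) ⟨hx, hWy'⟩, ht _ ⟨h hx, hWy'⟩]

theorem toColim_comp (Z : ℝ → Set (X × Y)) (hZ : Antitone Z) {r r' : ℝ} (h : r ≤ r') :
    pullPushRes (hZ h) ≫ toColim k Z hZ r' = toColim k Z hZ r := by
  ext1
  funext F
  exact Limits.colimit.w ((pullPushDiagram k Z hZ).flip.obj F) (homOfLE h)

end Restriction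

section RestrictionToColim

variable {k : Type} [Field k]

/-- The restriction map from `X_r` to `⋃_z 𝓗_z × {z}`. -/
abbrev restrictToDirectG (k : Type) [Field k] (r : ℝ) :
    pullPush k (incH ∪ incC r) ⟶ directG k :=
  pullPushRes Set.subset_union_left

/-- The restriction map from `X_r` to `⋃_z 𝓗_{θ, r} × {z}`, followed by the map to the colimit. -/
abbrev restrictToColim (k : Type) [Field k] (r : ℝ) : pullPush k (incH ∪ incC r) ⟶ directL k :=
  pullPushRes Set.subset_union_right ≫ toColim k incC antitone_incC r

theorem union_incC_subset {r r' : ℝ} (h : r ≤ r') : incH ∪ incC r' ⊆ incH ∪ incC r :=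
  Set.union_subset_union_right _ (antitone_incC h)

theorem pullPushRes_restrictToDirectG {r r' : ℝ} (h : r ≤ r') :
    pullPushRes (union_incC_subset h) ≫ restrictToDirectG k r' = restrictToDirectG k r :=
  pullPushRes_comp _ _

theorem pullPushRes_restrictToColim {r r' : ℝ} (h : r ≤ r') :
    pullPushRes (union_incC_subset h) ≫ restrictToColim k r' = restrictToColim k r := by
  rw [← Category.assoc, pullPushRes_comp]
  refine Eq.trans ?_ (congrArg (pullPushRes Set.subset_union_right ≫ ·)
    (toColim_comp incC antitone_incC h))
  rw [← Category.assoc, pullPushRes_comp]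

theorem eventually_log_norm_lt {z : Cstar} {r : ℝ} (h : Real.log ‖(z : ℂ)‖ < r) :
    ∀ᶠ z' : Cstar in 𝓝 z, Real.log ‖(z' : ℂ)‖ < r :=
  (continuous_subtype_val.norm.continuousAt.log (norm_ne_zero_iff.2 z.2)).eventually_lt_const h

-- As soon as `log |z| < r`, the half-plane `𝓗_{θ, r}` is contained in `𝓗_z`.
theorem stalkMap_restrictToDirectG_bijective (F : Sh k ℂ) {z : Cstar} {r : ℝ}
    (h : Real.log ‖(z : ℂ)‖ < r) :
    Function.Bijective (stalkMap ((restrictToDirectG k r).app F) z) := by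
  have h_mem : ∀ᶠ z' : Cstar in 𝓝 z, ∀ x, (x, z') ∈ incH ∪ incC r → (x, z') ∈ incH := by
    filter_upwards [eventually_log_norm_lt h] with z' hz' x hx
    exact hx.elim id fun hxr => lt_trans hz' hxr
  exact ⟨stalkMap_pullPushRes_injective _ F h_mem, stalkMap_pullPushRes_surjective _ F h_mem⟩

theorem stalkMap_restrictToDirectG_res (F : Sh k ℂ) (z : Cstar) {r r' : ℝ} (h : r ≤ r')
    (x : stk (transform (incH ∪ incC r) F) z) :
    stalkMap ((restrictToDirectG k r').app F) z
        (stalkMap ((pullPushRes (k := k) (union_incC_subset h)).app F) z x) =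
      stalkMap ((restrictToDirectG k r).app F) z x := by
  rw [← stalkMap_comp, ← NatTrans.comp_app, pullPushRes_restrictToDirectG h]

theorem stalkMap_restrictToColim_res (F : Sh k ℂ) (z : Cstar) {r r' : ℝ} (h : r ≤ r')
    (x : stk (transform (incH ∪ incC r) F) z) :
    stalkMap ((restrictToColim k r').app F) z
        (stalkMap ((pullPushRes (k := k) (union_incC_subset h)).app F) z x) =
      stalkMap ((restrictToColim k r).app F) z x := by
  rw [← stalkMap_comp, ← NatTrans.comp_app, pullPushRes_restrictToColim h]

theorem exists_stalk_restriction (F : Sh k ℂ) (z : Cstar) :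
    ∃ φ : stk ((directG k).obj F) z →ₗ[k] stk ((directL k).obj F) z, ∀ (r : ℝ)
      (x : stk (transform (incH ∪ incC r) F) z),
      φ (stalkMap ((restrictToDirectG k r).app F) z x) =
        stalkMap ((restrictToColim k r).app F) z x := by
  let r₀ := Real.log ‖(z : ℂ)‖ + 1
  have hr₀ : Real.log ‖(z : ℂ)‖ < r₀ := lt_add_one _
  let e := LinearEquiv.ofBijective _ (stalkMap_restrictToDirectG_bijective F hr₀)
  let φ := stalkMap ((restrictToColim k r₀).app F) z ∘ₗ e.symm.toLinearMap
  have hφ_base : ∀ x, φ (stalkMap ((restrictToDirectG k r₀).app F) z x) =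
      stalkMap ((restrictToColim k r₀).app F) z x :=
    fun x => congrArg (stalkMap ((restrictToColim k r₀).app F) z) (e.symm_apply_apply x)
  have hφ_max : ∀ r x, φ (stalkMap ((restrictToDirectG k (max r r₀)).app F) z x) =
      stalkMap ((restrictToColim k (max r r₀)).app F) z x := by
    intro r x
    obtain ⟨y, hy⟩ := (stalkMap_restrictToDirectG_bijective F hr₀).2
      (stalkMap ((restrictToDirectG k (max r r₀)).app F) z x)
    have h_extends := (stalkMap_restrictToDirectG_bijective F
      (hr₀.trans_le (le_max_right r r₀))).1
        ((stalkMap_restrictToDirectG_res F z (le_max_right r r₀) y).trans hy)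
    rw [← hy, hφ_base, ← h_extends, stalkMap_restrictToColim_res F z (le_max_right r r₀)]
  refine ⟨φ, fun r x => ?_⟩
  rw [← stalkMap_restrictToDirectG_res F z (le_max_left r r₀), hφ_max,
    stalkMap_restrictToColim_res F z (le_max_left r r₀)]

theorem exists_sheaf_restriction (F : Sh k ℂ) :
    ∃ f : (directG k).obj F ⟶ (directL k).obj F, ∀ z (r : ℝ)
      (x : stk (transform (incH ∪ incC r) F) z),
      stalkMap f z (stalkMap ((restrictToDirectG k r).app F) z x) =
        stalkMap ((restrictToColim k r).app F) z x := by
  choose φ hφ using exists_stalk_restriction F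
  obtain ⟨f, hf⟩ := exists_hom_of_stalkMaps φ fun U s z hz => by
    obtain ⟨x, hx⟩ := (stalkMap_restrictToDirectG_bijective F
      (lt_add_one (Real.log ‖(z : ℂ)‖))).2 (germAt _ U z s)
    obtain ⟨V, hV, t, rfl⟩ := exists_germAt_eq (transform (incH ∪ incC _) F) x
    refine ⟨V, hV, secMap ((restrictToColim k _).app F) V t, ?_⟩
    rw [stalkMap_germAt] at hx
    filter_upwards [eventually_germAt_eq hV hz hx] with z' hz'
    rw [← hz', ← stalkMap_germAt, ← stalkMap_germAt, hφ]
  refine ⟨f, fun z r x => ?_⟩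
  rw [hf]
  exact hφ z r x

theorem exists_isRestriction (k : Type) [Field k] :
    ∃ ι : directG k ⟶ directL k, IsRestriction ι := by
  choose f hf using fun F : Sh k ℂ => exists_sheaf_restriction F
  refine ⟨⟨f, fun F F' a => hom_ext_of_stalkMap fun z x => ?_⟩, fun r => ?_⟩
  · obtain ⟨y, rfl⟩ := (stalkMap_restrictToDirectG_bijective F
      (lt_add_one (Real.log ‖(z : ℂ)‖))).2 x
    rw [stalkMap_comp, stalkMap_comp, hf, ← stalkMap_comp _ ((directG k).map a),
      ← (restrictToDirectG k _).naturality a, stalkMap_comp, hf, ← stalkMap_comp,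
      (restrictToColim k _).naturality a, stalkMap_comp]
  · ext1
    funext F
    refine hom_ext_of_stalkMap fun z x => ?_
    rw [NatTrans.comp_app, stalkMap_comp]
    exact hf F z r x

theorem IsRestriction.unique {ι ι' : directG k ⟶ directL k} (h : IsRestriction ι)
    (h' : IsRestriction ι') : ι' = ι := by
  ext1
  funext F
  refine hom_ext_of_stalkMap fun z x => ?_
  obtain ⟨y, rfl⟩ := (stalkMap_restrictToDirectG_bijective F
    (lt_add_one (Real.log ‖(z : ℂ)‖))).2 x
  have h_comp : restrictToDirectG k (Real.log ‖(z : ℂ)‖ + 1) ≫ ι' =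
      restrictToDirectG k (Real.log ‖(z : ℂ)‖ + 1) ≫ ι :=
    (h' _).trans (h _).symm
  rw [← stalkMap_comp, ← stalkMap_comp, ← NatTrans.comp_app, ← NatTrans.comp_app, h_comp]

end RestrictionToColim

/-! ### Vanishing of cohomology and gluing -/

section Cohomology

open Abelian Limits

variable {X : Type} [TopologicalSpace X]

/-- Abelian sheaves on `X`. -/
abbrev AbSheaf (X : Type) [TopologicalSpace X] :=
  Sheaf (Opens.grothendieckTopology X) AddCommGrpCat.{0}

/-- The abelian sheaf `ℤ[U]` generated by `U`. -/
abbrev freeSheaf (U : Opens X) : AbSheaf X :=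
  (presheafToSheaf (Opens.grothendieckTopology X) AddCommGrpCat.{0}).obj
    (yoneda.obj U ⋙ AddCommGrpCat.free)

theorem constantSheaf_iso_freeSheaf_top :
    Nonempty ((constantSheaf (Opens.grothendieckTopology X) AddCommGrpCat.{0}).obj
      (AddCommGrpCat.of (ULift ℤ)) ≅ freeSheaf (⊤ : Opens X)) := by
  have h_unique (U : (Opens X)ᵒᵖ) : Unique ((yoneda.obj (⊤ : Opens X)).obj U) :=
    ⟨⟨homOfLE le_top⟩, fun _ => Subsingleton.elim (α := U.unop ⟶ ⊤) _ _⟩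
  let e_yoneda : yoneda.obj (⊤ : Opens X) ≅ (Functor.const _).obj PUnit :=
    NatIso.ofComponents (fun U => (Equiv.equivPUnit _).toIso) (by intros; rfl)
  let e_free : AddCommGrpCat.free.obj PUnit ≅ AddCommGrpCat.of (ULift ℤ) :=
    ((FreeAbelianGroup.uniqueEquiv _).trans AddEquiv.ulift.symm).toAddCommGrpIso
  exact ⟨(presheafToSheaf _ _).mapIso ((Functor.isoWhiskerRight e_yoneda _ ≪≫
    Functor.constComp _ _ _ ≪≫ (Functor.const _).mapIso e_free).symm)⟩

variable (G : AbSheaf X)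

/-- Morphisms `ℤ[U] ⟶ G` are sections of `G` over `U`. -/
def freeSheafHomEquiv (U : Opens X) : (freeSheaf U ⟶ G) ≃+ G.obj.obj (op U) where
  toEquiv := ((sheafificationAdjunction _ _).homEquiv _ G).trans
    (((AddCommGrpCat.adj.whiskerRight _).homEquiv (yoneda.obj U) G.obj).trans yonedaEquiv)
  map_add' _ _ := rfl

theorem freeSheafHomEquiv_comp {U V : Opens X} (i : U ⟶ V) (φ : freeSheaf V ⟶ G) :
    freeSheafHomEquiv G U ((presheafToSheaf _ _).map
      (Functor.whiskerRight (yoneda.map i) AddCommGrpCat.free) ≫ φ) =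
      (G.obj.map i.op).hom (freeSheafHomEquiv G V φ) := by
  have h_sheafify := (sheafificationAdjunction _ AddCommGrpCat.{0}).homEquiv_naturality_left
    (Functor.whiskerRight (yoneda.map i) AddCommGrpCat.free) φ
  have h_free := (AddCommGrpCat.adj.whiskerRight _).homEquiv_naturality_left (yoneda.map i)
    ((sheafificationAdjunction _ _).homEquiv _ G φ)
  exact (congrArg (fun a => yonedaEquiv ((AddCommGrpCat.adj.whiskerRight _).homEquiv _ _ a))
    h_sheafify).trans ((congrArg yonedaEquiv h_free).trans (yonedaEquiv_naturality _ i).symm)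

variable [HasExt.{0} (AbSheaf X)]

/-- `H⁰(U, G)` is the group of sections of `G` over `U`. -/
def cohomologyZeroEquiv (U : Opens X) : Sheaf.H' G 0 U ≃+ G.obj.obj (op U) :=
  Ext.addEquiv₀.trans (freeSheafHomEquiv G U)

theorem cohomologyZeroEquiv_map {U V : Opens X} (i : U ⟶ V) (x : Sheaf.H' G 0 V) :
    cohomologyZeroEquiv G U ((G.cohomologyPresheaf 0).map i.op x) =
      (G.obj.map i.op).hom (cohomologyZeroEquiv G V x) := by
  refine Eq.trans ?_ (freeSheafHomEquiv_comp G i (Ext.addEquiv₀ x))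
  refine congrArg (freeSheafHomEquiv G U) (Ext.addEquiv₀.symm.injective ?_)
  refine (AddEquiv.symm_apply_apply _ _).trans (Eq.trans ?_ (Ext.mk₀_comp_mk₀ _ _))
  exact congrArg ((Ext.mk₀ _).comp · (zero_add 0)) (AddEquiv.symm_apply_apply Ext.addEquiv₀ x).symm

theorem exists_map_sub_map_eq (U V : Opens X) [Subsingleton (Sheaf.H' G 1 (U ⊔ V))]
    (s : G.obj.obj (op (U ⊓ V))) :
    ∃ (a : G.obj.obj (op U)) (b : G.obj.obj (op V)),
      (G.obj.map (homOfLE (inf_le_left : U ⊓ V ≤ U)).op).hom a -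
        (G.obj.map (homOfLE (inf_le_right : U ⊓ V ≤ V)).op).hom b = s := by
  let S := Opens.mayerVietorisSquare U V
  obtain ⟨x, rfl⟩ := (cohomologyZeroEquiv G (U ⊓ V)).surjective s
  have hx : S.δ G 0 1 rfl x = 0 := Subsingleton.elim (α := Sheaf.H' G 1 (U ⊔ V)) _ _
  obtain ⟨y, hy⟩ := (ShortComplex.ab_exact_iff _).1 ((S.sequence_exact G 0 1 rfl).exact 1) x hx
  obtain ⟨⟨a, b⟩, rfl⟩ :=
    (AddCommGrpCat.biprodIsoProd _ _).addCommGroupIsoToAddEquiv.symm.surjective y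
  refine ⟨cohomologyZeroEquiv G U a, cohomologyZeroEquiv G V b, ?_⟩
  refine (congrArg₂ (· - ·) (cohomologyZeroEquiv_map G _ a).symm
    (cohomologyZeroEquiv_map G _ b).symm).trans ?_
  refine (map_sub (cohomologyZeroEquiv G _) _ _).symm.trans ?_
  exact congrArg _ ((S.fromBiprod_biprodIsoProd_inv_apply G a b).symm.trans hy)

theorem subsingleton_cohomology_top {n : ℕ} (h : Subsingleton (Sheaf.H G n)) :
    Subsingleton (Sheaf.H' G n (⊤ : Opens X)) := by
  obtain ⟨e⟩ := constantSheaf_iso_freeSheaf_top (X := X)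
  refine (Function.LeftInverse.injective (f := fun x => (Ext.mk₀ e.hom).comp x (zero_add n))
    (g := fun x => (Ext.mk₀ e.inv).comp x (zero_add n)) fun x => ?_).subsingleton (β := Sheaf.H G n)
  simp

variable {k : Type} [Field k] {F : Sh k ℂ}

theorem IsAcyclic.sec_top_eq_zero (hF : IsAcyclic F) (s : sec F ⊤) : s = 0 :=
  have h_zero := hF 0
  (Sheaf.H.equiv₀ ((sheafCompose _ (forget₂ (ModuleCat.{0} k) AddCommGrpCat.{0})).obj F)
    (T := (⊤ : Opens ℂ)) Limits.isTerminalTop).symm.injective (h_zero.elim _ _)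

theorem IsAcyclic.exists_secRes_sub_secRes_eq (hF : IsAcyclic F) {U V : Opens ℂ}
    (hUV : U ⊔ V = ⊤) (s : sec F (U ⊓ V)) :
    ∃ (a : sec F U) (b : sec F V), secRes F inf_le_left a - secRes F inf_le_right b = s := by
  let G := (sheafCompose _ (forget₂ (ModuleCat.{0} k) AddCommGrpCat.{0})).obj F
  have : Subsingleton (Sheaf.H' G 1 (U ⊔ V)) := by
    rw [hUV]
    exact subsingleton_cohomology_top G (hF 1)
  exact exists_map_sub_map_eq G U V s

end Cohomology

/-! ### The identity principle -/

section Identity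

theorem forall_mem_of_isPreconnected {T : Type*} [TopologicalSpace T] {A : Set T}
    (hA : IsPreconnected A) {p : T → Prop} (h_open : ∀ w ∈ A, p w → ∀ᶠ w' in 𝓝[A] w, p w')
    (h_closed : ∀ w ∈ A, (∃ᶠ w' in 𝓝[A] w, p w') → p w) {a : T} (ha : a ∈ A) (h : p a) :
    ∀ w ∈ A, p w := by
  intro w hw
  refine (hA.induction₂ (fun x y => p x ↔ p y) (fun x hx => ?_) (fun _ _ _ _ _ _ => Iff.trans)
    (fun _ _ _ _ => Iff.symm) ha hw).1 h
  by_cases hpx : p x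
  · exact (h_open x hx hpx).mono fun _ hpy => iff_of_true hpx hpy
  · exact (not_frequently.1 (mt (h_closed x hx) hpx)).mono fun _ hpy => iff_of_false hpx hpy

variable {k : Type} [Field k] {X : Type} [TopologicalSpace X] {F : Sh k X} {N N' : Opens X}

/-- The zero locus of every section of `F` is closed in its domain, so that sections over
connected sets are determined by a single germ. -/
def IdentityPrinciple (F : Sh k X) : Prop :=
  ∀ (N : Opens X) (t : sec F N), ∀ x ∈ N, (∃ᶠ y in 𝓝 x, germAt F N y t = 0) → germAt F N x t = 0

theorem IdentityPrinciple.germAt_eq (hF : IdentityPrinciple F) {t : sec F N} {t' : sec F N'}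
    {x : X} (hN : x ∈ N) (hN' : x ∈ N')
    (h : ∃ᶠ y in 𝓝 x, germAt F N y t = germAt F N' y t') : germAt F N x t = germAt F N' x t' := by
  have hx : x ∈ N ⊓ N' := ⟨hN, hN'⟩
  have h_sub (y : X) (hy : y ∈ N ⊓ N') :
      germAt F (N ⊓ N') y (secRes F inf_le_left t - secRes F inf_le_right t') =
        germAt F N y t - germAt F N' y t' := by
    rw [map_sub, germAt_secRes _ hy, germAt_secRes _ hy]
  rw [← sub_eq_zero, ← h_sub x hx]
  refine hF _ _ x hx ((h.and_eventually (eventually_mem_opens hx)).mono ?_)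
  rintro y ⟨h_eq, hy⟩
  rw [h_sub y hy, h_eq, sub_self]

theorem IsLocallySection.eventually_eq {T : Type} [TopologicalSpace T] {f : T → X}
    (hf : Continuous f) {A : Set T} {s s' : ∀ w, stk F (f w)} (hs : IsLocallySection F f A s)
    (hs' : IsLocallySection F f A s') {w : T} (hw : w ∈ A) (h : s w = s' w) :
    ∀ᶠ w' in 𝓝[A] w, s w' = s' w' := by
  obtain ⟨N, hN, t, ht⟩ := hs w hw
  obtain ⟨N', hN', t', ht'⟩ := hs' w hw
  have h_tendsto : Tendsto f (𝓝[A] w) (𝓝 (f w)) := hf.continuousAt.mono_left nhdsWithin_le_nhds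
  have h_germ : germAt F N (f w) t = germAt F N' (f w) t' :=
    (ht.self_of_nhdsWithin hw).symm.trans (h.trans (ht'.self_of_nhdsWithin hw))
  filter_upwards [ht, ht', h_tendsto.eventually (eventually_germAt_eq hN hN' h_germ)]
    with w' hw' hw'' h_eq using hw'.trans (h_eq.trans hw''.symm)

theorem IsLocallySection.eqOn_of_isPreconnected (hF : IdentityPrinciple F) {T : Type}
    [TopologicalSpace T] {f : T → X} (hf : Continuous f) {A : Set T} (hA : IsPreconnected A)
    {s s' : ∀ w, stk F (f w)} (hs : IsLocallySection F f A s) (hs' : IsLocallySection F f A s')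
    {a : T} (ha : a ∈ A) (h : s a = s' a) : ∀ w ∈ A, s w = s' w := by
  refine forall_mem_of_isPreconnected hA (fun w hw => hs.eventually_eq hf hs' hw)
    (fun w hw h_freq => ?_) ha h
  obtain ⟨N, hN, t, ht⟩ := hs w hw
  obtain ⟨N', hN', t', ht'⟩ := hs' w hw
  have h_tendsto : Tendsto f (𝓝[A] w) (𝓝 (f w)) := hf.continuousAt.mono_left nhdsWithin_le_nhds
  have h_germ : ∃ᶠ w' in 𝓝[A] w, germAt F N (f w') t = germAt F N' (f w') t' :=
    (h_freq.and_eventually (ht.and ht')).mono fun w' ⟨h_eq, hw', hw''⟩ =>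
      hw'.symm.trans (h_eq.trans hw'')
  exact (ht.self_of_nhdsWithin hw).trans
    ((hF.germAt_eq hN hN' (h_tendsto.frequently h_germ)).trans (ht'.self_of_nhdsWithin hw).symm)

theorem isLocallySection_germAt (t : sec F N) :
    IsLocallySection F id (N : Set X) (fun x => germAt F N x t) :=
  fun _ hx => ⟨N, hx, t, Eventually.of_forall fun _ => rfl⟩

theorem germAt_eq_of_isPreconnected (hF : IdentityPrinciple F) {t : sec F N} {t' : sec F N'}
    {A : Set X} (hA : IsPreconnected A) (hN : A ⊆ N) (hN' : A ⊆ N') {a : X} (ha : a ∈ A)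
    (h : germAt F N a t = germAt F N' a t') : ∀ x ∈ A, germAt F N x t = germAt F N' x t' :=
  IsLocallySection.eqOn_of_isPreconnected hF continuous_id hA ((isLocallySection_germAt t).mono hN)
    ((isLocallySection_germAt t').mono hN') ha h

/-- Near every point of `K` the sheaf `F` is constant of finite rank. -/
def IsLocallyConstantOn (F : Sh k X) (K : Set X) : Prop :=
  ∀ x ∈ K, ∃ U : Opens X, x ∈ U ∧ IsConstantOn F U

theorem IsLocallyConstantOn.mono {K K' : Set X} (hF : IsLocallyConstantOn F K') (h : K ⊆ K') :
    IsLocallyConstantOn F K := fun x hx => hF x (h hx)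

theorem IsLocallyConstantOn.germAt_eq_zero {K : Set X} (hF : IsLocallyConstantOn F K)
    (t : sec F N) {x : X} (hxK : x ∈ K) (hxN : x ∈ N) (h : ∃ᶠ y in 𝓝 x, germAt F N y t = 0) :
    germAt F N x t = 0 := by
  obtain ⟨U, hxU, V, -, τ, hτ⟩ := hF x hxK
  obtain ⟨v, hv⟩ := (hτ x hxU).2 (germAt F N x t)
  have hvx : germAt F U x (τ v) = germAt F N x t := by rwa [germAt_of_mem hxU]
  obtain ⟨y, hy, hvy, hyU⟩ := (h.and_eventually
    ((eventually_germAt_eq hxU hxN hvx).and (eventually_mem_opens hxU))).exists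
  have hv_germ : germ F U y hyU (τ v) = 0 := by rw [← germAt_of_mem hyU, hvy, hy]
  have hv_zero : v = 0 := (hτ y hyU).1 (hv_germ.trans (map_zero _).symm)
  rw [← hvx, hv_zero, map_zero, map_zero]

theorem IsLocallyConstantOn.germAt_eq_zero_of_isPreconnected {A : Set X}
    (hF : IsLocallyConstantOn F A) (t : sec F N) (hA : IsPreconnected A) (hN : A ⊆ N) {a : X}
    (ha : a ∈ A) (h : germAt F N a t = 0) : ∀ x ∈ A, germAt F N x t = 0 :=
  forall_mem_of_isPreconnected hA
    (fun _ hx h_zero => nhdsWithin_le_nhds (eventually_germAt_eq_zero (hN hx) h_zero))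
    (fun _ hx h_freq => hF.germAt_eq_zero t hx (hN hx) (h_freq.filter_mono nhdsWithin_le_nhds))
    ha h

end Identity

section Plane

variable {k : Type} [Field k] {F : Sh k ℂ}

theorem ball_diff_singleton_eq_image_exp (c : ℂ) {δ : ℝ} (hδ : 0 < δ) :
    Metric.ball c δ \ {c} = (fun w => c + Complex.exp w) '' {w : ℂ | w.re < Real.log δ} := by
  ext z
  constructor
  · rintro ⟨hz, hzc⟩
    have h_ne : z - c ≠ 0 := sub_ne_zero.2 hzc
    refine ⟨Complex.log (z - c), ?_, ?_⟩
    · rw [Set.mem_ofPred_eq, Complex.log_re]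
      exact Real.log_lt_log (norm_pos_iff.2 h_ne) (mem_ball_iff_norm.1 hz)
    · simp only [Complex.exp_log h_ne, add_sub_cancel]
  · rintro ⟨w, hw, rfl⟩
    refine ⟨?_, by simp⟩
    rw [mem_ball_iff_norm, add_sub_cancel_left, Complex.norm_exp]
    exact (Real.lt_log_iff_exp_lt hδ).1 hw

theorem isPreconnected_ball_diff_singleton (c : ℂ) (δ : ℝ) :
    IsPreconnected (Metric.ball c δ \ {c}) := by
  rcases le_or_gt δ 0 with hδ | hδ
  · rw [Metric.ball_eq_empty.2 hδ, Set.empty_sdiff]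
    exact isPreconnected_empty
  · rw [ball_diff_singleton_eq_image_exp c hδ]
    exact (convex_halfSpace_re_lt _).isPreconnected.image _ (by fun_prop)

/-- The ball of radius `δ` as an element of `Opens ℂ`. -/
def openBall (c : ℂ) (δ : ℝ) : Opens ℂ := ⟨Metric.ball c δ, Metric.isOpen_ball⟩

theorem mem_openBall {c x : ℂ} {δ : ℝ} : x ∈ openBall c δ ↔ ‖x - c‖ < δ := mem_ball_iff_norm

theorem mem_openBall_self {c : ℂ} {δ : ℝ} (hδ : 0 < δ) : c ∈ openBall c δ :=
  Metric.mem_ball_self hδ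

theorem exists_openBall_subset {U : Set ℂ} {x : ℂ} (h : U ∈ 𝓝 x) :
    ∃ δ > 0, (openBall x δ : Set ℂ) ⊆ U := Metric.mem_nhds_iff.1 h

theorem IsAcyclic.germAt_eq_zero_of_support (hF : IsAcyclic F) {N : Opens ℂ} (t : sec F N)
    {x : ℂ} (hx : x ∈ N) (h : ∀ᶠ y in 𝓝 x, y ≠ x → germAt F N y t = 0) : germAt F N x t = 0 := by
  classical
  obtain ⟨s, hs⟩ := exists_sec_of_eventually_germAt_eq F ⊤
    (fun z => if z = x then germAt F N z t else 0) fun z _ => by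
      rcases eq_or_ne z x with rfl | hzx
      · refine ⟨N, hx, t, h.mono fun y hy => ?_⟩
        split_ifs with hyz
        · rfl
        · exact hy hyz
      · refine ⟨⊤, trivial, 0, ?_⟩
        filter_upwards [isOpen_ne.mem_nhds hzx] with y hy
        rw [if_neg hy, map_zero]
  have hsx := hs x trivial
  rw [if_pos rfl, hF.sec_top_eq_zero s, map_zero] at hsx
  exact hsx.symm

/-- At a singularity, a section violating the identity principle would be supported in that point,
and its extension by zero would be a nonzero global section. -/
theorem identityPrinciple {S : Finset ℂ} (hS : IsConstructible S F) (hF : IsAcyclic F) :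
    IdentityPrinciple F := by
  intro N t x hxN h_freq
  have h_const : IsLocallyConstantOn F (Sᶜ : Set ℂ) := hS.1
  by_cases hx : x ∈ S
  swap
  · exact h_const.germAt_eq_zero t hx hxN h_freq
  obtain ⟨δ, hδ, h_sub⟩ := exists_openBall_subset (inter_mem (N.isOpen.mem_nhds hxN)
    ((S.erase x).finite_toSet.isClosed.isOpen_compl.mem_nhds (by simp)))
  have hxδ := (openBall x δ).isOpen.mem_nhds (mem_openBall_self hδ)
  obtain ⟨y, hy_zero, hyδ⟩ := (h_freq.and_eventually hxδ).exists
  rcases eq_or_ne y x with rfl | hyx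
  · exact hy_zero
  have h_punctured : ∀ z ∈ Metric.ball x δ \ {x}, germAt F N z t = 0 :=
    (h_const.mono fun z hz hzS => (h_sub hz.1).2
      (Finset.mem_coe.2 (Finset.mem_erase.2 ⟨hz.2, hzS⟩))).germAt_eq_zero_of_isPreconnected t
      (isPreconnected_ball_diff_singleton x δ) (fun z hz => (h_sub hz.1).1) ⟨hyδ, hyx⟩ hy_zero
  exact hF.germAt_eq_zero_of_support t hxN
    (Filter.mem_of_superset hxδ fun z hz hzx => h_punctured z ⟨hz, hzx⟩)

/-! ### Constancy on simply connected open sets -/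

theorem IsConstantOn.germ_openBall_bijective (hF : IdentityPrinciple F) {U : Opens ℂ}
    (hU : IsConstantOn F U) {x : ℂ} {δ : ℝ} (hδ : openBall x δ ≤ U) (y : ℂ)
    (hy : y ∈ openBall x δ) : Function.Bijective (F.presheaf.germ (openBall x δ) y hy) := by
  obtain ⟨V, -, τ, hτ⟩ := hU
  constructor
  · intro s s' h_eq
    refine sec_ext fun z hz => germAt_eq_of_isPreconnected hF (convex_ball x δ).isPreconnected
      (fun _ h => h) (fun _ h => h) hy ?_ z hz
    rw [germAt_of_mem hy]
    exact h_eq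
  · intro g
    obtain ⟨v, hv⟩ := (hτ y (hδ hy)).2 g
    refine ⟨secRes F hδ (τ v), ?_⟩
    have h_germ := germAt_secRes hδ hy (τ v)
    rw [germAt_of_mem hy, germAt_of_mem (hδ hy)] at h_germ
    exact h_germ.trans hv

theorem IsLocallyConstantOn.isCoveringMapOn_base (hF : IdentityPrinciple F) {K : Set ℂ}
    (hK : IsLocallyConstantOn F K) :
    IsCoveringMapOn (TopCat.Presheaf.EtaleSpace.base (F := F.presheaf)) K := by
  intro x hx
  obtain ⟨U, hxU, hU⟩ := hK x hx
  obtain ⟨δ, hδ, h_sub⟩ := exists_openBall_subset (U.isOpen.mem_nhds hxU)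
  refine .to_isEvenlyCovered_preimage (I := WithDiscreteTopology (ToType (F.presheaf.stalk x)))
    ⟨inferInstance, (openBall x δ : Set ℂ), mem_openBall_self hδ, (openBall x δ).isOpen,
      (openBall x δ).isOpen.preimage (TopCat.Presheaf.EtaleSpace.continuous_base F.presheaf),
      TopCat.Presheaf.EtaleSpace.homeomorph (openBall x δ) (hU.germ_openBall_bijective hF h_sub) x
        (mem_openBall_self hδ), fun _ => rfl⟩

theorem exists_sec_of_continuous_etaleSpace {K : Opens ℂ} (γ : ∀ y : K, stk F (y : ℂ))
    (hγ : Continuous fun y : K => (⟨(y : ℂ), γ y⟩ : F.presheaf.EtaleSpace)) :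
    ∃ v : sec F K, ∀ y : K, germAt F K (y : ℂ) v = γ y := by
  classical
  let γ₀ (y : ℂ) : stk F y := if h : y ∈ K then γ ⟨y, h⟩ else 0
  have hγ₀ (y : K) : γ₀ y = γ y := dif_pos y.2
  obtain ⟨v, hv⟩ := exists_sec_of_eventually_germAt_eq F K γ₀ fun y hy => by
    obtain ⟨U, hU, s, hs⟩ :=
      TopCat.Presheaf.EtaleSpace.exists_section_of_tendsto (hγ.tendsto ⟨y, hy⟩)
    have h_nhds : 𝓝 y = map Subtype.val (𝓝 (⟨y, hy⟩ : K)) :=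
      (K.isOpenEmbedding'.map_nhds_eq ⟨y, hy⟩).symm
    refine ⟨U, hU, s, ?_⟩
    rw [h_nhds, eventually_map]
    filter_upwards [hs] with a ⟨ha, h_germ⟩
    rw [germAt_of_mem (A := F) (U := U) ha, hγ₀ a]
    exact h_germ.symm
  exact ⟨v, fun y => (hv y y.2).trans (hγ₀ y)⟩

theorem IsLocallyConstantOn.exists_germAt_eq (hF : IdentityPrinciple F) {K : Opens ℂ}
    [SimplyConnectedSpace K] (hK : IsLocallyConstantOn F K) {x : ℂ} (hx : x ∈ K) (g : stk F x) :
    ∃ v : sec F K, germAt F K x v = g := by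
  have h_cover := (hK.isCoveringMapOn_base hF).isCoveringMap_restrictPreimage
  have : LocallyPathConnectedSpace K := K.isOpen.locallyPathConnectedSpace
  obtain ⟨σ, ⟨hσx, hσ⟩, -⟩ := h_cover.existsUnique_continuousMap_lifts (ContinuousMap.id K)
    (a₀ := ⟨x, hx⟩) (e₀ := ⟨⟨x, g⟩, hx⟩) rfl
  have h_fibre (y : K) : ∃ γ : stk F (y : ℂ), (σ y).1 = ⟨y, γ⟩ := by
    have h_base : (σ y).1.base = y := congrArg Subtype.val (congrFun hσ y)
    generalize (σ y).1 = e at h_base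
    obtain ⟨_, γ⟩ := e
    subst h_base
    exact ⟨γ, rfl⟩
  choose γ hγ using h_fibre
  obtain ⟨v, hv⟩ := exists_sec_of_continuous_etaleSpace γ
    ((continuous_subtype_val.comp σ.continuous).congr hγ)
  refine ⟨v, (hv ⟨x, hx⟩).trans ?_⟩
  have hγx := hγ ⟨x, hx⟩
  rw [hσx] at hγx
  simpa using hγx.symm

end Plane

/-! ### Planar geometry -/

section Geometry

/-- `Im (x e^{-iθ})` for `u = e^{iθ}`; together with `reDir u` it gives coordinates on `ℂ`. -/
def imDir (u : Circle) (x : ℂ) : ℝ := (x * (starRingEnd ℂ) (u : ℂ)).im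

theorem reDir_eq (u : Circle) (x : ℂ) : reDir u x = x.re * (u : ℂ).re + x.im * (u : ℂ).im := by
  simp [reDir]

theorem imDir_eq (u : Circle) (x : ℂ) : imDir u x = x.im * (u : ℂ).re - x.re * (u : ℂ).im := by
  simp only [imDir, Complex.mul_im, Complex.conj_re, Complex.conj_im]
  ring

theorem re_sq_add_im_sq (u : Circle) : (u : ℂ).re ^ 2 + (u : ℂ).im ^ 2 = 1 := by
  rw [sq, sq, ← Complex.normSq_apply, Circle.normSq_coe]

@[simp] theorem reDir_add (u : Circle) (x y : ℂ) : reDir u (x + y) = reDir u x + reDir u y := by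
  simp only [reDir, add_mul, Complex.add_re]

@[simp] theorem imDir_add (u : Circle) (x y : ℂ) : imDir u (x + y) = imDir u x + imDir u y := by
  simp only [imDir, add_mul, Complex.add_im]

@[simp] theorem imDir_sub (u : Circle) (x y : ℂ) : imDir u (x - y) = imDir u x - imDir u y := by
  simp only [imDir, sub_mul, Complex.sub_im]

theorem reDir_smul (u : Circle) (t : ℝ) (x : ℂ) : reDir u (t • x) = t * reDir u x := by
  simp only [reDir, smul_mul_assoc, Complex.smul_re, smul_eq_mul]

theorem imDir_smul (u : Circle) (t : ℝ) (x : ℂ) : imDir u (t • x) = t * imDir u x := by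
  simp only [imDir, smul_mul_assoc, Complex.smul_im, smul_eq_mul]

@[simp] theorem reDir_self (u : Circle) : reDir u u = 1 := by
  rw [reDir_eq, ← sq, ← sq, re_sq_add_im_sq]

@[simp] theorem imDir_self (u : Circle) : imDir u u = 0 := by
  rw [imDir_eq, mul_comm, sub_self]

theorem abs_imDir_le_norm (u : Circle) (x : ℂ) : |imDir u x| ≤ ‖x‖ := by
  refine (Complex.abs_im_le_norm _).trans (le_of_eq ?_)
  rw [norm_mul, RCLike.norm_conj, Circle.norm_coe, mul_one]

theorem eq_of_reDir_eq_of_imDir_eq {u : Circle} {x y : ℂ} (h_re : reDir u x = reDir u y)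
    (h_im : imDir u x = imDir u y) : x = y :=
  mul_right_cancel₀ (by simp) (Complex.ext h_re h_im)

theorem reDir_eq_reDir_mul_sub_imDir_mul (u φ : Circle) (x : ℂ) :
    reDir u x = reDir φ x * reDir u φ - imDir φ x * imDir u φ := by
  simp only [reDir_eq, imDir_eq]
  linear_combination (-(x.re * (u : ℂ).re) - x.im * (u : ℂ).im) * re_sq_add_im_sq φ

theorem continuous_reDir (u : Circle) : Continuous (reDir u) := by unfold reDir; fun_prop

theorem continuous_imDir (u : Circle) : Continuous (imDir u) := by unfold imDir; fun_prop

theorem continuous_reDir_left (x : ℂ) : Continuous fun u => reDir u x := by unfold reDir; fun_prop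

theorem convex_halfPlane (u : Circle) (r : ℝ) : Convex ℝ (halfPlane u r) :=
  convex_halfSpace_gt ⟨reDir_add u, reDir_smul u⟩ r

/-- An upper bound for `Re (c e^{-iθ})`, `c ∈ S`, that is uniform in `θ`. -/
def directionBound (S : Finset ℂ) : ℝ := ∑ c ∈ S, ‖c‖

theorem reDir_le_directionBound {S : Finset ℂ} {c : ℂ} (hc : c ∈ S) (u : Circle) :
    reDir u c ≤ directionBound S :=
  (reDir_le_norm u c).trans (Finset.single_le_sum (fun x _ => norm_nonneg x) hc)

theorem isPreconnected_of_segments {A H : Set ℂ} (hH : IsPreconnected H) (hHA : H ⊆ A)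
    (h : ∀ x ∈ A, ∃ y ∈ H, segment ℝ x y ⊆ A) : IsPreconnected A := by
  rcases A.eq_empty_or_nonempty with rfl | ⟨a, ha⟩
  · exact isPreconnected_empty
  obtain ⟨p, hp, -⟩ := h a ha
  refine isPreconnected_of_forall p fun x hx => ?_
  obtain ⟨y, hy, hxy⟩ := h x hx
  exact ⟨H ∪ segment ℝ x y, Set.union_subset hHA hxy, Or.inl hp, Or.inr (left_mem_segment ℝ x y),
    hH.union y hy (right_mem_segment ℝ x y) (convex_segment x y).isPreconnected⟩

theorem segment_add_smul_subset {A : Set ℂ} {φ x : ℂ} {T : ℝ} (hT : 0 ≤ T)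
    (h : ∀ t : ℝ, 0 ≤ t → x + t • φ ∈ A) : segment ℝ x (x + T • φ) ⊆ A := by
  rw [segment_eq_image']
  rintro _ ⟨s, hs, rfl⟩
  simp only [add_sub_cancel_left, smul_smul]
  exact h _ (mul_nonneg hs.1 hT)

theorem exists_add_smul_mem_halfPlane {u φ : Circle} (hu : 0 < reDir u φ) (x : ℂ) (r : ℝ) :
    ∃ t : ℝ, 0 ≤ t ∧ x + t • (φ : ℂ) ∈ halfPlane u r := by
  obtain ⟨t, ht⟩ := exists_gt (max 0 ((r - reDir u x) / reDir u φ))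
  refine ⟨t, (le_max_left _ _).trans ht.le, ?_⟩
  have h_lt := (div_lt_iff₀ hu).1 ((le_max_right _ _).trans_lt ht)
  simp only [halfPlane, Set.mem_ofPred_eq, reDir_add, reDir_smul]
  linarith

/-! ### Slits and strips -/

/-- The complement of the slits `{c - t φ : t ≥ 0}`, `c ∈ S`. -/
def slitDomain (S : Finset ℂ) (φ : Circle) : Opens ℂ :=
  ⟨⋂ c ∈ S, (fun x => (x - c) * (starRingEnd ℂ) (φ : ℂ)) ⁻¹' Complex.slitPlane,
    isOpen_biInter_finset fun _ _ => Complex.isOpen_slitPlane.preimage (by fun_prop)⟩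

variable {S : Finset ℂ} {φ : Circle} {ε : ℝ}

theorem mem_slitDomain {x : ℂ} :
    x ∈ slitDomain S φ ↔ ∀ c ∈ S, imDir φ x = imDir φ c → reDir φ c < reDir φ x := by
  refine Set.mem_iInter₂.trans (forall₂_congr fun c _ => ?_)
  rw [Set.mem_preimage, Complex.mem_slitPlane_iff, sub_mul, Complex.sub_re, Complex.sub_im,
    sub_pos, sub_ne_zero, or_comm, ← imp_iff_not_or]
  rfl

theorem add_smul_mem_slitDomain {x : ℂ} (hx : x ∈ slitDomain S φ) {t : ℝ} (ht : 0 ≤ t) :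
    x + t • (φ : ℂ) ∈ slitDomain S φ := by
  refine mem_slitDomain.2 fun c hc h_im => ?_
  simp only [imDir_add, imDir_smul, imDir_self, mul_zero, add_zero] at h_im
  simp only [reDir_add, reDir_smul, reDir_self, mul_one]
  linarith [mem_slitDomain.1 hx c hc h_im]

theorem notMem_of_mem_slitDomain {x : ℂ} (hx : x ∈ slitDomain S φ) : x ∉ S :=
  fun h => lt_irrefl _ (mem_slitDomain.1 hx x h rfl)

theorem mem_slitDomain_of_forall_lt {u : Circle} (hu : 0 < reDir u φ) {x : ℂ}
    (h : ∀ c ∈ S, reDir u c < reDir u x) : x ∈ slitDomain S φ := by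
  refine mem_slitDomain.2 fun c hc h_im => lt_of_mul_lt_mul_right ?_ hu.le
  have h_lt := h c hc
  rw [reDir_eq_reDir_mul_sub_imDir_mul u φ c, reDir_eq_reDir_mul_sub_imDir_mul u φ x, h_im] at h_lt
  linarith

theorem halfPlane_subset_slitDomain {u : Circle} (hu : 0 < reDir u φ) {r : ℝ}
    (hr : ∀ c ∈ S, reDir u c ≤ r) : halfPlane u r ⊆ slitDomain S φ :=
  fun _ hx => mem_slitDomain_of_forall_lt hu fun c hc => (hr c hc).trans_lt hx

theorem isPreconnected_slitDomain_inter {A H : Set ℂ}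
    (hA : ∀ x ∈ A, ∀ t : ℝ, 0 ≤ t → x + t • (φ : ℂ) ∈ A) (hH : IsPreconnected H) (hHA : H ⊆ A)
    (hHS : H ⊆ slitDomain S φ) (h : ∀ x ∈ A, ∃ t : ℝ, 0 ≤ t ∧ x + t • (φ : ℂ) ∈ H) :
    IsPreconnected ((slitDomain S φ : Set ℂ) ∩ A) := by
  refine isPreconnected_of_segments hH (fun x hx => ⟨hHS hx, hHA hx⟩) fun x hx => ?_
  obtain ⟨t, ht, hxt⟩ := h x hx.2
  exact ⟨_, hxt, segment_add_smul_subset ht fun t ht =>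
    ⟨add_smul_mem_slitDomain hx.1 ht, hA x hx.2 t ht⟩⟩

theorem homotopic_of_segment_subset {K : Set ℂ} (f g : C(K, K))
    (h : ∀ x : K, segment ℝ (f x : ℂ) (g x) ⊆ K) : f.Homotopic g :=
  ⟨{toFun := fun p => ⟨(1 - (p.1 : ℝ)) • (f p.2 : ℂ) + (p.1 : ℝ) • (g p.2 : ℂ),
      h p.2 ⟨_, _, sub_nonneg.2 p.1.2.2, p.1.2.1, sub_add_cancel _ _, rfl⟩⟩
    continuous_toFun := Continuous.subtype_mk (by fun_prop) _
    map_zero_left := fun x => Subtype.ext (by simp)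
    map_one_left := fun x => Subtype.ext (by simp)}⟩

/- Translation in the direction `φ` moves the slit domain into a half-plane without leaving it. -/
instance contractibleSpace_slitDomain : ContractibleSpace (slitDomain S φ) := by
  let R := directionBound S
  have h_sub : halfPlane φ R ⊆ slitDomain S φ :=
    halfPlane_subset_slitDomain (by simp) fun c hc => reDir_le_directionBound hc φ
  have h_push (x : ℂ) : x + max 0 (R + 1 - reDir φ x) • (φ : ℂ) ∈ halfPlane φ R := by
    simp only [halfPlane, Set.mem_ofPred_eq, reDir_add, reDir_smul, reDir_self]
    linarith [le_max_right 0 (R + 1 - reDir φ x)]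
  let push : C(slitDomain S φ, slitDomain S φ) :=
    ⟨fun x => ⟨x + max 0 (R + 1 - reDir φ x) • (φ : ℂ), h_sub (h_push x)⟩,
      Continuous.subtype_mk (by have := continuous_reDir φ; fun_prop) _⟩
  have h_id : (ContinuousMap.id (slitDomain S φ)).Homotopic push :=
    homotopic_of_segment_subset (K := (slitDomain S φ : Set ℂ)) _ _ fun x =>
      segment_add_smul_subset (le_max_left 0 _) fun _ => add_smul_mem_slitDomain x.2
  have h_const : push.Homotopic (ContinuousMap.const _ ⟨_, h_sub (h_push 0)⟩) :=
    homotopic_of_segment_subset (K := (slitDomain S φ : Set ℂ)) _ _ fun x =>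
      ((convex_halfPlane φ R).segment_subset (h_push x) (h_push 0)).trans h_sub
  exact (contractible_iff_id_nullhomotopic _).2 ⟨_, h_id.trans h_const⟩

theorem isPreconnected_slitDomain : IsPreconnected (slitDomain S φ : Set ℂ) :=
  isPreconnected_iff_preconnectedSpace.2
    (inferInstanceAs (PreconnectedSpace (slitDomain S φ)))

theorem starConvex_slitDomain_singleton (c : ℂ) {t : ℝ} (ht : 0 < t) :
    StarConvex ℝ (c + t • (φ : ℂ)) (slitDomain {c} φ : Set ℂ) := by
  intro x hx a b ha hb hab
  simp only [slitDomain, Opens.coe_mk, Finset.mem_singleton, Set.iInter_iInter_eq_left,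
    Set.mem_preimage] at hx ⊢
  convert Complex.starConvex_ofReal_slitPlane ht hx ha hb hab using 1
  have h_unit : (φ : ℂ) * (starRingEnd ℂ) (φ : ℂ) = 1 := by
    rw [Complex.mul_conj, Circle.normSq_coe, Complex.ofReal_one]
  have h_sum : (a : ℂ) + b = 1 := by exact_mod_cast hab
  simp only [Complex.real_smul]
  linear_combination (a : ℂ) * t * h_unit + c * (starRingEnd ℂ) (φ : ℂ) * h_sum

/-- The strip of width `2ε` around the line through `c` in the direction `φ`. -/
def strip (φ : Circle) (ε : ℝ) (c : ℂ) : Opens ℂ :=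
  ⟨{x | |imDir φ x - imDir φ c| < ε},
    isOpen_lt ((continuous_imDir φ).sub continuous_const).abs continuous_const⟩

theorem mem_strip {c x : ℂ} : x ∈ strip φ ε c ↔ |imDir φ x - imDir φ c| < ε := Iff.rfl

theorem mem_strip_of_imDir_eq (hε : 0 < ε) {c x : ℂ} (h : imDir φ x = imDir φ c) :
    x ∈ strip φ ε c := by
  rwa [mem_strip, h, sub_self, abs_zero]

theorem openBall_le_strip (φ : Circle) (ε : ℝ) (c : ℂ) : openBall c ε ≤ strip φ ε c := by
  intro x hx
  rw [mem_strip, ← imDir_sub]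
  exact (abs_imDir_le_norm _ _).trans_lt (mem_openBall.1 hx)

theorem add_smul_mem_openBall (φ : Circle) (c : ℂ) {δ : ℝ} (hδ : 0 < δ) :
    c + (δ / 2) • (φ : ℂ) ∈ openBall c δ := by
  rw [mem_openBall, add_sub_cancel_left, norm_smul, Circle.norm_coe,
    Real.norm_of_nonneg (half_pos hδ).le, mul_one]
  exact half_lt_self hδ

/-- The lines through the points of `S` in the direction `φ` have distance at least `2ε`, so that
the strips of width `2ε` around them are disjoint. -/
structure IsSeparating (S : Finset ℂ) (φ : Circle) (ε : ℝ) : Prop where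
  pos : 0 < ε
  le_abs_sub : ∀ c ∈ S, ∀ c' ∈ S, c ≠ c' → 2 * ε ≤ |imDir φ c - imDir φ c'|

namespace IsSeparating

theorem eq_of_mem_strip (h : IsSeparating S φ ε) {c c' x : ℂ} (hc : c ∈ S) (hc' : c' ∈ S)
    (hx : x ∈ strip φ ε c) (hx' : x ∈ strip φ ε c') : c = c' := by
  by_contra h_ne
  rw [mem_strip] at hx hx'
  rw [abs_sub_comm] at hx
  linarith [h.le_abs_sub c hc c' hc' h_ne, abs_sub_le (imDir φ c) (imDir φ x) (imDir φ c')]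

theorem mem_slitDomain_iff_singleton (h : IsSeparating S φ ε) {c x : ℂ} (hc : c ∈ S)
    (hx : x ∈ strip φ ε c) : x ∈ slitDomain S φ ↔ x ∈ slitDomain {c} φ := by
  simp only [mem_slitDomain, Finset.mem_singleton, forall_eq]
  refine ⟨fun h_slit => h_slit c hc, fun h_slit c' hc' h_im => ?_⟩
  obtain rfl := h.eq_of_mem_strip hc hc' hx (mem_strip_of_imDir_eq h.pos h_im)
  exact h_slit h_im

theorem mem_slitDomain_iff (h : IsSeparating S φ ε) {c x : ℂ} (hc : c ∈ S)
    (hx : x ∈ strip φ ε c) :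
    x ∈ slitDomain S φ ↔ (imDir φ x = imDir φ c → reDir φ c < reDir φ x) := by
  simp only [h.mem_slitDomain_iff_singleton hc hx, mem_slitDomain, Finset.mem_singleton, forall_eq]

theorem add_smul_mem_slitDomain (h : IsSeparating S φ ε) {c : ℂ} (hc : c ∈ S) {t : ℝ}
    (ht : 0 < t) : c + t • (φ : ℂ) ∈ slitDomain S φ := by
  refine (h.mem_slitDomain_iff hc (mem_strip_of_imDir_eq h.pos ?_)).2 fun _ => ?_
  · rw [imDir_add, imDir_smul, imDir_self, mul_zero, add_zero]
  · rw [reDir_add, reDir_smul, reDir_self]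
    linarith

theorem slitDomain_sup_strip_eq_top (h : IsSeparating S φ ε) :
    slitDomain S φ ⊔ S.sup (strip φ ε) = ⊤ := by
  refine eq_top_iff.2 fun x _ => or_iff_not_imp_left.2 fun hx => ?_
  have h_slit := mt mem_slitDomain.2 hx
  push Not at h_slit
  obtain ⟨c, hc, h_im, -⟩ := h_slit
  exact (Finset.le_sup hc : strip φ ε c ≤ S.sup (strip φ ε)) (mem_strip_of_imDir_eq h.pos h_im)

theorem isPreconnected_slitDomain_inter_ball (h : IsSeparating S φ ε) {c : ℂ} (hc : c ∈ S) {δ : ℝ}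
    (hδ : 0 < δ) (hδε : δ ≤ ε) :
    IsPreconnected ((slitDomain S φ : Set ℂ) ∩ Metric.ball c δ) := by
  have h_strip : Metric.ball c δ ⊆ strip φ ε c :=
    (Metric.ball_subset_ball hδε).trans (openBall_le_strip φ ε c)
  have h_inter : (slitDomain S φ : Set ℂ) ∩ Metric.ball c δ =
      (slitDomain {c} φ : Set ℂ) ∩ Metric.ball c δ := by
    ext x
    exact and_congr_left fun hx => h.mem_slitDomain_iff_singleton hc (h_strip hx)
  have h_mem := add_smul_mem_openBall φ c hδ
  have h_slit : c + (δ / 2) • (φ : ℂ) ∈ slitDomain {c} φ :=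
    mem_slitDomain.2 fun c' hc' _ => by
      rw [Finset.mem_singleton.1 hc', reDir_add, reDir_smul, reDir_self, mul_one]
      linarith
  rw [h_inter]
  have h_star := (starConvex_slitDomain_singleton (φ := φ) c (half_pos hδ)).inter
    ((convex_ball c δ).starConvex h_mem)
  exact (h_star.isPathConnected ⟨h_slit, h_mem⟩).isConnected.isPreconnected

end IsSeparating

end Geometry

/-! ### Sections over slit domains -/

section Gluing

variable {X : Type} [TopologicalSpace X]

theorem mem_opens_finset_sup {ι : Type} {s : Finset ι} {U : ι → Opens X} {x : X} :
    x ∈ s.sup U ↔ ∃ i ∈ s, x ∈ U i := by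
  simp only [Finset.sup_eq_iSup, Opens.mem_iSup, exists_prop]

variable {k : Type} [Field k]

theorem exists_glue (F : Sh k X) {ι : Type} (U : ι → Opens X) (a : ∀ i, sec F (U i)) (N : Opens X)
    (hN : ∀ x ∈ N, ∃ i, x ∈ U i)
    (h : ∀ i j, ∀ x ∈ U i, x ∈ U j → germAt F (U i) x (a i) = germAt F (U j) x (a j)) :
    ∃ w : sec F N, ∀ i, ∀ x ∈ N, x ∈ U i → germAt F N x w = germAt F (U i) x (a i) := by
  rcases isEmpty_or_nonempty ι with _ | _
  · exact ⟨0, isEmptyElim⟩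
  choose! i hi using hN
  let g (x : X) : stk F x := germAt F (U (i x)) x (a (i x))
  have hg (j : ι) (x : X) (hx : x ∈ N) (hj : x ∈ U j) : g x = germAt F (U j) x (a j) :=
    h _ _ x (hi x hx) hj
  obtain ⟨w, hw⟩ := exists_sec_of_eventually_germAt_eq F N g fun x hx =>
    ⟨U (i x), hi x hx, a (i x), by
      filter_upwards [eventually_mem_opens hx, eventually_mem_opens (hi x hx)] with y hy hyi
      exact (hg (i x) y hy hyi).symm⟩
  exact ⟨w, fun j x hx hj => (hw x hx).trans (hg j x hx hj)⟩

theorem exists_glue_two (F : Sh k X) {U V : Opens X} (a : sec F U) (b : sec F V)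
    (h : ∀ x ∈ U, x ∈ V → germAt F U x a = germAt F V x b) :
    ∃ w : sec F (U ⊔ V), (∀ x ∈ U, germAt F (U ⊔ V) x w = germAt F U x a) ∧
      ∀ x ∈ V, germAt F (U ⊔ V) x w = germAt F V x b := by
  obtain ⟨w, hw⟩ := exists_glue F (Bool.rec U V) (Bool.rec a b) (U ⊔ V)
    (fun x hx => hx.elim (fun hx => ⟨false, hx⟩) fun hx => ⟨true, hx⟩) (by
      rintro (_ | _) (_ | _) x hx hx'
      exacts [rfl, h x hx hx', (h x hx' hx).symm, rfl])
  exact ⟨w, fun x hx => hw false x (Or.inl hx) hx, fun x hx => hw true x (Or.inr hx) hx⟩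

end Gluing

section Slits

variable {k : Type} [Field k] {F : Sh k ℂ} {S : Finset ℂ} {φ : Circle} {ε : ℝ}

theorem germAt_slitDomain_bijective (hS : IsConstructible S F) (hF : IsAcyclic F) {x : ℂ}
    (hx : x ∈ slitDomain S φ) : Function.Bijective (germAt F (slitDomain S φ) x) := by
  have h_identity := identityPrinciple hS hF
  refine ⟨fun v w h => sec_ext ?_, fun g => ?_⟩
  · exact germAt_eq_of_isPreconnected h_identity isPreconnected_slitDomain subset_rfl subset_rfl
      hx h
  · exact IsLocallyConstantOn.exists_germAt_eq h_identity
      (fun y hy => hS.1 y (notMem_of_mem_slitDomain hy)) hx g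

variable (F S φ ε) in
/-- The sections on the slit domain that extend over the slit at `c`. -/
def extendable (c : ℂ) : Submodule k (sec F (slitDomain S φ)) :=
  LinearMap.range (secRes F (le_sup_left : slitDomain S φ ≤ slitDomain S φ ⊔ strip φ ε c))

theorem mem_extendable {c : ℂ} {v : sec F (slitDomain S φ)} :
    v ∈ extendable F S φ ε c ↔ ∃ w : sec F (slitDomain S φ ⊔ strip φ ε c),
      ∀ x ∈ slitDomain S φ, germAt F _ x w = germAt F _ x v := by
  constructor
  · rintro ⟨w, rfl⟩
    exact ⟨w, fun x hx => (germAt_secRes _ hx w).symm⟩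
  · rintro ⟨w, hw⟩
    exact ⟨w, sec_ext fun x hx => (germAt_secRes _ hx w).trans (hw x hx)⟩

theorem mem_extendable_of_sec {c : ℂ} {v : sec F (slitDomain S φ)} {W : Opens ℂ}
    (hW : strip φ ε c ≤ slitDomain S φ ⊔ W) (b : sec F W)
    (h : ∀ x ∈ slitDomain S φ, x ∈ W → germAt F _ x v = germAt F _ x b) :
    v ∈ extendable F S φ ε c := by
  obtain ⟨w, hw, -⟩ := exists_glue_two F v b h
  refine mem_extendable.2 ⟨secRes F (sup_le le_sup_left hW) w, fun x hx => ?_⟩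
  exact (germAt_secRes _ (Or.inl hx : x ∈ slitDomain S φ ⊔ strip φ ε c) w).trans (hw x hx)

theorem exists_sec_openBall_of_mem_extendable {c : ℂ} {v : sec F (slitDomain S φ)}
    (hv : v ∈ extendable F S φ ε c) :
    ∃ b : sec F (openBall c ε),
      ∀ x ∈ slitDomain S φ, x ∈ openBall c ε → germAt F _ x b = germAt F _ x v := by
  obtain ⟨w, hw⟩ := mem_extendable.1 hv
  have h_le : openBall c ε ≤ slitDomain S φ ⊔ strip φ ε c :=
    (openBall_le_strip φ ε c).trans le_sup_right
  exact ⟨secRes F h_le w, fun x hx hx' => (germAt_secRes h_le hx' w).trans (hw x hx)⟩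

theorem exists_sec_of_mem_extendable (hφ : IsSeparating S φ ε) {J : Finset ℂ} (hJ : J ⊆ S)
    {v : sec F (slitDomain S φ)} (hv : ∀ c ∈ J, v ∈ extendable F S φ ε c) :
    ∃ w : sec F (slitDomain S φ ⊔ J.sup (strip φ ε)),
      ∀ x ∈ slitDomain S φ, germAt F _ x w = germAt F _ x v := by
  let U : Option J → Opens ℂ := fun i => i.elim (slitDomain S φ) fun c =>
    slitDomain S φ ⊔ strip φ ε c
  have h_ext (i : Option J) :
      ∃ a : sec F (U i), ∀ x ∈ slitDomain S φ, germAt F _ x a = germAt F _ x v := by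
    rcases i with _ | c
    · exact ⟨v, fun _ _ => rfl⟩
    · exact mem_extendable.1 (hv c c.2)
  choose a ha using h_ext
  have h_cover : ∀ x ∈ slitDomain S φ ⊔ J.sup (strip φ ε), ∃ i, x ∈ U i := by
    rintro x (hx | hx)
    · exact ⟨none, hx⟩
    · obtain ⟨c, hc, hx⟩ := mem_opens_finset_sup.1 hx
      exact ⟨some ⟨c, hc⟩, Or.inr hx⟩
  have h_agree (i j : Option J) (x : ℂ) (hi : x ∈ U i) (hj : x ∈ U j) :
      germAt F (U i) x (a i) = germAt F (U j) x (a j) := by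
    by_cases hx : x ∈ slitDomain S φ
    · rw [ha i x hx, ha j x hx]
    rcases i with _ | c
    · exact absurd hi hx
    rcases j with _ | c'
    · exact absurd hj hx
    obtain rfl : c = c' := Subtype.ext <|
      hφ.eq_of_mem_strip (hJ c.2) (hJ c'.2) (hi.resolve_left hx) (hj.resolve_left hx)
    rfl
  obtain ⟨w, hw⟩ := exists_glue F U a _ h_cover h_agree
  exact ⟨w, fun x hx => (hw none x (Or.inl hx) hx).trans (ha none x hx)⟩

theorem eq_zero_of_mem_extendable (hF : IsAcyclic F) (hφ : IsSeparating S φ ε)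
    {v : sec F (slitDomain S φ)} (hv : ∀ c ∈ S, v ∈ extendable F S φ ε c) : v = 0 := by
  obtain ⟨w, hw⟩ := exists_sec_of_mem_extendable hφ subset_rfl hv
  have h_zero {N : Opens ℂ} (hN : N = ⊤) (w : sec F N) : w = 0 := by
    subst hN
    exact IsAcyclic.sec_top_eq_zero hF w
  refine sec_ext fun x hx => ?_
  rw [← hw x hx, h_zero hφ.slitDomain_sup_strip_eq_top w, map_zero, map_zero]

theorem exists_sub_mem_extendable (hF : IsAcyclic F) (hφ : IsSeparating S φ ε)
    (v : S → sec F (slitDomain S φ)) :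
    ∃ v₀ : sec F (slitDomain S φ), ∀ c : S, v₀ - v c ∈ extendable F S φ ε c := by
  obtain ⟨σ, hσ⟩ := exists_glue F (fun c : S => slitDomain S φ ⊓ strip φ ε c)
    (fun c => secRes F inf_le_left (v c)) (slitDomain S φ ⊓ S.sup (strip φ ε))
    (by
      rintro x ⟨hx, hx'⟩
      obtain ⟨c, hc, hx'⟩ := mem_opens_finset_sup.1 hx'
      exact ⟨⟨c, hc⟩, hx, hx'⟩)
    (by
      intro c c' x hc hc'
      obtain rfl : c = c' := Subtype.ext (hφ.eq_of_mem_strip c.2 c'.2 hc.2 hc'.2)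
      rfl)
  obtain ⟨a, b, rfl⟩ :=
    IsAcyclic.exists_secRes_sub_secRes_eq hF hφ.slitDomain_sup_strip_eq_top σ
  refine ⟨a, fun c => mem_extendable_of_sec le_sup_right
    (secRes F (Finset.le_sup c.2 : strip φ ε (c : ℂ) ≤ S.sup (strip φ ε)) b) fun x hx hx' => ?_⟩
  have hx_sup : x ∈ S.sup (strip φ ε) := mem_opens_finset_sup.2 ⟨c, c.2, hx'⟩
  have h_germ := hσ c x ⟨hx, hx_sup⟩ ⟨hx, hx'⟩
  rw [germAt_secRes inf_le_left (⟨hx, hx'⟩ : x ∈ slitDomain S φ ⊓ strip φ ε (c : ℂ)), map_sub,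
    germAt_secRes _ (⟨hx, hx_sup⟩ : x ∈ slitDomain S φ ⊓ S.sup (strip φ ε)),
    germAt_secRes _ (⟨hx, hx_sup⟩ : x ∈ slitDomain S φ ⊓ S.sup (strip φ ε))] at h_germ
  rw [germAt_secRes _ hx', map_sub, ← h_germ, sub_sub_cancel]

/-- The half of the strip at `c` that lies behind `c` and contains the slit. -/
def halfStrip (φ : Circle) (ε : ℝ) (c : ℂ) : Opens ℂ :=
  strip φ ε c ⊓ ⟨{x | reDir φ x < reDir φ c}, isOpen_lt (continuous_reDir φ) continuous_const⟩

theorem convex_halfStrip (φ : Circle) (ε : ℝ) (c : ℂ) : Convex ℝ (halfStrip φ ε c : Set ℂ) := by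
  have h_im : IsLinearMap ℝ (imDir φ) := ⟨imDir_add φ, imDir_smul φ⟩
  have h_re : IsLinearMap ℝ (reDir φ) := ⟨reDir_add φ, reDir_smul φ⟩
  have h_strip : (strip φ ε c : Set ℂ) = imDir φ ⁻¹' Metric.ball (imDir φ c) ε := rfl
  rw [halfStrip, Opens.coe_inf, h_strip]
  exact ((convex_ball _ _).is_linear_preimage h_im).inter (convex_halfSpace_lt h_re _)

theorem sub_smul_mem_halfStrip {c : ℂ} {t : ℝ} (hε : 0 < ε) (ht : 0 < t) :
    c - t • (φ : ℂ) ∈ halfStrip φ ε c := by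
  rw [sub_eq_add_neg, ← neg_smul]
  refine ⟨mem_strip_of_imDir_eq hε ?_, ?_⟩
  · rw [imDir_add, imDir_smul, imDir_self, mul_zero, add_zero]
  change reDir φ _ < reDir φ c
  rw [reDir_add, reDir_smul, reDir_self]
  linarith

namespace IsSeparating

theorem isLocallyConstantOn_halfStrip (hS : IsConstructible S F) (hφ : IsSeparating S φ ε) {c : ℂ}
    (hc : c ∈ S) : IsLocallyConstantOn F (halfStrip φ ε c) := fun y hy => hS.1 y fun hyS => by
  obtain rfl := hφ.eq_of_mem_strip hc hyS hy.1 (mem_strip_of_imDir_eq hφ.pos rfl)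
  exact lt_irrefl (reDir φ c) hy.2

theorem strip_le (hφ : IsSeparating S φ ε) {c : ℂ} (hc : c ∈ S) {δ : ℝ} (hδ : 0 < δ) :
    strip φ ε c ≤ slitDomain S φ ⊔ (openBall c δ ⊔ halfStrip φ ε c) := by
  refine fun y hy => or_iff_not_imp_left.2 fun hy_slit => ?_
  rw [SetLike.mem_coe, hφ.mem_slitDomain_iff hc hy] at hy_slit
  push Not at hy_slit
  rcases eq_or_lt_of_le hy_slit.2 with h_re | h_re
  · obtain rfl := eq_of_reDir_eq_of_imDir_eq h_re hy_slit.1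
    exact Or.inl (mem_openBall_self hδ)
  · exact Or.inr ⟨hy, h_re⟩

/- The segment from a point of the half-strip towards `c` reaches the ball before it meets the
slit. -/
theorem exists_isPreconnected_halfStrip (hφ : IsSeparating S φ ε) {c : ℂ} (hc : c ∈ S) {δ : ℝ}
    (hδ : 0 < δ) {y : ℂ} (hy : y ∈ halfStrip φ ε c) (hy_slit : y ∈ slitDomain S φ) :
    ∃ A : Set ℂ, IsPreconnected A ∧ A ⊆ slitDomain S φ ∧ A ⊆ halfStrip φ ε c ∧ y ∈ A ∧
      (A ∩ openBall c δ).Nonempty := by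
  have h_im : imDir φ y ≠ imDir φ c := fun h =>
    ((hφ.mem_slitDomain_iff hc hy.1).1 hy_slit h).asymm hy.2
  let γ (t : ℝ) : ℂ := t • c + (1 - t) • y
  have hγ : Continuous γ := by fun_prop
  have hγ_im (t : ℝ) : imDir φ (γ t) - imDir φ c = (1 - t) * (imDir φ y - imDir φ c) := by
    simp only [γ, imDir_add, imDir_smul]
    ring
  have hγ_half (t : ℝ) (ht : t ∈ Set.Ico 0 1) : γ t ∈ halfStrip φ ε c := by
    have h_pos : 0 < 1 - t := sub_pos.2 ht.2
    refine ⟨?_, ?_⟩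
    · change |imDir φ (γ t) - imDir φ c| < ε
      rw [hγ_im, abs_mul, abs_of_pos h_pos]
      exact (mul_le_of_le_one_left (abs_nonneg _) (sub_le_self 1 ht.1)).trans_lt hy.1
    · change reDir φ (γ t) < reDir φ c
      simp only [γ, reDir_add, reDir_smul]
      linarith [mul_lt_mul_of_pos_left hy.2.out h_pos]
  have hγ_slit (t : ℝ) (ht : t ∈ Set.Ico 0 1) : γ t ∈ slitDomain S φ :=
    (hφ.mem_slitDomain_iff hc (hγ_half t ht).1).2 fun h =>
      absurd ((hγ_im t).symm.trans (sub_eq_zero.2 h))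
        (mul_ne_zero (sub_pos.2 ht.2).ne' (sub_ne_zero.2 h_im))
  have h_ball : ∀ᶠ t in 𝓝[<] (1 : ℝ), γ t ∈ openBall c δ :=
    (hγ.tendsto 1).mono_left nhdsWithin_le_nhds |>.eventually
      ((openBall c δ).isOpen.mem_nhds (by simpa [γ] using mem_openBall_self hδ))
  obtain ⟨t, ht_ball, ht⟩ := (h_ball.and (Ico_mem_nhdsLT zero_lt_one)).exists
  exact ⟨γ '' Set.Ico 0 1, isPreconnected_Ico.image _ hγ.continuousOn,
    Set.image_subset_iff.2 hγ_slit, Set.image_subset_iff.2 hγ_half, ⟨0, by simp, by simp [γ]⟩,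
    γ t, ⟨t, ht, rfl⟩, ht_ball⟩

theorem exists_extend_halfStrip (hS : IsConstructible S F) (hF : IsAcyclic F)
    (hφ : IsSeparating S φ ε) {c : ℂ} (hc : c ∈ S) {δ : ℝ} (hδ : 0 < δ)
    (b : sec F (openBall c δ)) :
    ∃ b' : sec F (openBall c δ ⊔ halfStrip φ ε c),
      ∀ x ∈ openBall c δ, germAt F _ x b' = germAt F _ x b := by
  have h_identity := identityPrinciple hS hF
  have hp : c - (δ / 2) • (φ : ℂ) ∈ halfStrip φ ε c := sub_smul_mem_halfStrip hφ.pos (half_pos hδ)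
  have hp_ball : c - (δ / 2) • (φ : ℂ) ∈ openBall c δ := by
    rw [mem_openBall, sub_sub_cancel_left, norm_neg, norm_smul, Circle.norm_coe,
      Real.norm_of_nonneg (half_pos hδ).le, mul_one]
    exact half_lt_self hδ
  have : ContractibleSpace (halfStrip φ ε c) := (convex_halfStrip φ ε c).contractibleSpace ⟨_, hp⟩
  obtain ⟨w, hw⟩ := IsLocallyConstantOn.exists_germAt_eq h_identity
    (isLocallyConstantOn_halfStrip hS hφ hc) hp (germAt F _ _ b)
  obtain ⟨b', hb', -⟩ := exists_glue_two F b w fun y hy hy' =>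
    germAt_eq_of_isPreconnected h_identity
      ((convex_ball c δ).inter (convex_halfStrip φ ε c)).isPreconnected
      Set.inter_subset_left Set.inter_subset_right ⟨hp_ball, hp⟩ hw.symm y ⟨hy, hy'⟩
  exact ⟨b', hb'⟩

theorem mem_extendable_of_germAt_eq (hS : IsConstructible S F) (hF : IsAcyclic F)
    (hφ : IsSeparating S φ ε) {c : ℂ} (hc : c ∈ S) {δ : ℝ} (hδ : 0 < δ) (hδε : δ ≤ ε)
    {v : sec F (slitDomain S φ)} (b : sec F (openBall c δ)) {x : ℂ} (hx : x ∈ openBall c δ)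
    (hx_slit : x ∈ slitDomain S φ) (h : germAt F _ x v = germAt F _ x b) :
    v ∈ extendable F S φ ε c := by
  have h_identity := identityPrinciple hS hF
  obtain ⟨b', hb'⟩ := hφ.exists_extend_halfStrip hS hF hc hδ b
  have h_ball (y : ℂ) (hy : y ∈ slitDomain S φ) (hy' : y ∈ openBall c δ) :
      germAt F _ y v = germAt F _ y b' :=
    (germAt_eq_of_isPreconnected h_identity (hφ.isPreconnected_slitDomain_inter_ball hc hδ hδε)
      Set.inter_subset_left Set.inter_subset_right ⟨hx_slit, hx⟩ h y ⟨hy, hy'⟩).trans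
      (hb' y hy').symm
  refine mem_extendable_of_sec (hφ.strip_le hc hδ) b' fun y hy hy' => ?_
  rcases hy' with hy' | hy'
  · exact h_ball y hy hy'
  · obtain ⟨A, hA, hA_slit, hA_half, hyA, z, hzA, hz⟩ :=
      hφ.exists_isPreconnected_halfStrip hc hδ hy' hy
    exact germAt_eq_of_isPreconnected h_identity hA hA_slit
      (hA_half.trans Set.subset_union_right) hzA (h_ball z (hA_slit hzA) hz) y hyA

end IsSeparating

end Slits

/-! ### The sheaf `colim_r R⁰q_{r*} p_r^* F` -/

section Far

/-- `⋃_y 𝓗_{d(y),r} × {y} ⊆ ℂ × Y`; for `Y = S¹` and `Y = ℂ^*` these are the families of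
half-planes in the definitions of `Psi` and `directL`. -/
def halfPlaneFamily {Y : Type} (d : Y → Circle) (r : ℝ) : Set (ℂ × Y) :=
  {w | w.1 ∈ halfPlane (d w.2) r}

theorem mem_halfPlaneFamily {Y : Type} {d : Y → Circle} {r : ℝ} {x : ℂ} {y : Y} :
    (x, y) ∈ halfPlaneFamily d r ↔ r < reDir (d y) x := Iff.rfl

theorem antitone_halfPlaneFamily {Y : Type} (d : Y → Circle) : Antitone (halfPlaneFamily d) :=
  fun _ _ h _ hw => lt_of_le_of_lt h hw

theorem smul_mem_halfPlaneFamily {Y : Type} (d : Y → Circle) (r : ℝ) (y : Y) :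
    ((r + 1) • (d y : ℂ), y) ∈ halfPlaneFamily d r := by
  rw [mem_halfPlaneFamily, reDir_smul, reDir_self]
  linarith

variable {k : Type} [Field k] {Y : Type} [TopologicalSpace Y]

variable (d : Y → Circle) (F : Sh k ℂ)

/-- The sheaf `colim_r R⁰q_{r*} p_r^* F` for the families of half-planes `halfPlaneFamily d r`. -/
abbrev farSheaf : Sh k Y :=
  (colimPullPush k (halfPlaneFamily d) (antitone_halfPlaneFamily d)).obj F

/-- The map from the `r`-th term of the colimit to `farSheaf d F`. -/
def toFar (r : ℝ) : transform (halfPlaneFamily d r) F ⟶ farSheaf d F :=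
  (toColim k (halfPlaneFamily d) (antitone_halfPlaneFamily d) r).app F

variable {d F}

theorem stalkMap_toFar_pullPushRes {r r' : ℝ} (h : r ≤ r') (y : Y)
    (x : stk (transform (halfPlaneFamily d r) F) y) :
    stalkMap (toFar d F r') y
      (stalkMap ((pullPushRes (k := k) (antitone_halfPlaneFamily d h)).app F) y x) =
      stalkMap (toFar d F r) y x := by
  have h_comp := congrArg (fun f => f.app F)
    (toColim_comp (k := k) (halfPlaneFamily d) (antitone_halfPlaneFamily d) h)
  rw [← stalkMap_comp]
  exact congrArg (fun f => stalkMap f y x) h_comp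

theorem stalkMap_toFar_germAt_eq {r r' : ℝ} (h : r ≤ r') {y : Y} {V V' : Opens Y} (hy : y ∈ V)
    (hy' : y ∈ V') {s : sec (transform (halfPlaneFamily d r) F) V}
    {s' : sec (transform (halfPlaneFamily d r') F) V'}
    (hs : ∀ᶠ y' in 𝓝 y, ∀ x, (x, y') ∈ halfPlaneFamily d r' →
      valueAt (halfPlaneFamily d r) F V (x, y') s =
        valueAt (halfPlaneFamily d r') F V' (x, y') s') :
    stalkMap (toFar d F r) y (germAt _ V y s) = stalkMap (toFar d F r') y (germAt _ V' y s') := by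
  refine (stalkMap_toFar_pullPushRes h y _).symm.trans (congrArg (stalkMap (toFar d F r') y) ?_)
  refine (stalkMap_germAt _ V y s).trans (germAt_eq_of_valueAt_eq hy hy' ?_)
  filter_upwards [hs, eventually_mem_opens hy] with y' hy'_eq hy'_mem x hx
  rw [valueAt_pullPushRes (antitone_halfPlaneFamily d h) ⟨hx, hy'_mem⟩, hy'_eq x hx]

theorem eventually_eq_on_fibres {Z : Set (ℂ × Y)} {V : Opens Y} (hF : IdentityPrinciple F)
    {s s' : ∀ w : ℂ × Y, stk F w.1} (hs : IsLocallySection F Prod.fst (partOver Z V) s)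
    (hs' : IsLocallySection F Prod.fst (partOver Z V) s')
    (hZ : ∀ y ∈ V, IsPreconnected {x | (x, y) ∈ Z}) {p : Y → ℂ} (hp : Continuous p)
    (hpZ : ∀ y ∈ V, (p y, y) ∈ Z) {y : Y} (hy : y ∈ V) (h : s (p y, y) = s' (p y, y)) :
    ∀ᶠ y' in 𝓝 y, ∀ x, (x, y') ∈ Z → s (x, y') = s' (x, y') := by
  have h_near := hs.eventually_eq continuous_fst hs' (w := (p y, y)) ⟨hpZ y hy, hy⟩ h
  have h_tendsto : Tendsto (fun y' => (p y', y')) (𝓝 y) (𝓝[partOver Z V] (p y, y)) := by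
    refine tendsto_nhdsWithin_iff.2 ⟨(hp.prodMk continuous_id).tendsto y, ?_⟩
    exact (eventually_mem_opens hy).mono fun y' hy' => ⟨hpZ y' hy', hy'⟩
  filter_upwards [h_tendsto.eventually h_near, eventually_mem_opens hy] with y' h_eq hy' x hx
  have h_fibre : IsPreconnected ((·, y') '' {x | (x, y') ∈ Z}) :=
    (hZ y' hy').image _ (Continuous.continuousOn (by fun_prop))
  have h_sub : (·, y') '' {x | (x, y') ∈ Z} ⊆ partOver Z V :=
    Set.image_subset_iff.2 fun x hx => ⟨hx, hy'⟩
  exact (hs.mono h_sub).eqOn_of_isPreconnected hF continuous_fst h_fibre (hs'.mono h_sub)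
    ⟨_, hpZ y' hy', rfl⟩ h_eq _ ⟨x, hx, rfl⟩

/-- The points whose direction is at an angle less than `π / 2` to `φ`. -/
def dirChart (hd : Continuous d) (φ : Circle) : Opens Y :=
  ⟨{y | 0 < reDir (d y) φ}, isOpen_lt continuous_const ((continuous_reDir_left _).comp hd)⟩

theorem self_mem_dirChart (hd : Continuous d) (y : Y) : y ∈ dirChart hd (d y) :=
  one_pos.trans_eq (reDir_self (d y)).symm

variable {S : Finset ℂ} {φ : Circle}

theorem fst_mem_slitDomain (hd : Continuous d) (φ : Circle) {r : ℝ} (hr : directionBound S ≤ r) :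
    ∀ w ∈ partOver (halfPlaneFamily d r) (dirChart hd φ), w.1 ∈ slitDomain S φ := fun _ hw =>
  halfPlane_subset_slitDomain hw.2 (fun _ hc => (reDir_le_directionBound hc _).trans hr) hw.1

theorem germAt_transformSec_bijective (hS : IsConstructible S F) (hF : IsAcyclic F)
    (hd : Continuous d) {r : ℝ} (hr : directionBound S ≤ r) {y : Y} (hy : y ∈ dirChart hd φ) :
    Function.Bijective (germAt (transform (halfPlaneFamily d r) F) (dirChart hd φ) y ∘ₗ
      transformSec (k := k) (F := F) (fst_mem_slitDomain (S := S) hd φ hr)) := by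
  let V := dirChart hd φ
  let p (y : Y) : ℂ := (r + 1) • (d y : ℂ)
  have hp : (p y, y) ∈ partOver (halfPlaneFamily d r) V := ⟨smul_mem_halfPlaneFamily d r y, hy⟩
  have h_bij := germAt_slitDomain_bijective hS hF (fst_mem_slitDomain hd φ hr _ hp)
  have h_value := valueAt_transformSec (k := k) (F := F) (fst_mem_slitDomain (S := S) hd φ hr) hp
  refine ⟨fun v v' h => h_bij.1 ?_, fun g => ?_⟩
  · exact (h_value v).symm.trans
      (((eventually_valueAt_eq hy hy h).self_of_nhds (p y)).trans (h_value v'))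
  · obtain ⟨V', hV', s, rfl⟩ := exists_germAt_eq _ g
    obtain ⟨v, hv⟩ := h_bij.2 (valueAt (halfPlaneFamily d r) F V' (p y, y) s)
    refine ⟨v, germAt_eq_of_valueAt_eq hy hV' ?_⟩
    exact eventually_eq_on_fibres (Z := halfPlaneFamily d r) (V := V ⊓ V')
      (identityPrinciple hS hF)
      ((isLocallySection_valueAt _).mono fun w hw => ⟨hw.1, hw.2.1⟩)
      ((isLocallySection_valueAt _).mono fun w hw => ⟨hw.1, hw.2.2⟩)
      (fun y _ => (convex_halfPlane (d y) r).isPreconnected) (by fun_prop)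
      (fun y _ => smul_mem_halfPlaneFamily d r y) ⟨hy, hV'⟩ ((h_value v).trans hv)

/- Near `y`, the terms of the colimit for `r ≥ directionBound S` are all the constant sheaf of
sections of `F` on a slit domain. -/
theorem isIso_toFar (hS : IsConstructible S F) (hF : IsAcyclic F) (hd : Continuous d) {r : ℝ}
    (hr : directionBound S ≤ r) : IsIso (toFar d F r) := by
  let D := (pullPushDiagram k (halfPlaneFamily d) (antitone_halfPlaneFamily d)).flip.obj F
  have hD : D.IsEventuallyConstantFrom r := by
    intro r' f
    refine isIso_of_stalkMap_bijective (A := transform (halfPlaneFamily d r) F)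
      (B := transform (halfPlaneFamily d r') F) _ fun y => ?_
    have hy := self_mem_dirChart hd y
    have h_bij := germAt_transformSec_bijective hS hF hd hr hy
    have h_bij' := germAt_transformSec_bijective hS hF hd (hr.trans f.le) hy
    refine (Function.Bijective.of_comp_iff _ h_bij).1 ?_
    convert h_bij' using 1
    funext v
    refine (stalkMap_germAt _ _ _ _).trans (congrArg (germAt _ _ y) (transform_sec_ext ?_))
    intro w hw
    have hw' := antitone_halfPlaneFamily d f.le hw.1
    exact (valueAt_pullPushRes (antitone_halfPlaneFamily d f.le) hw _).trans
      ((valueAt_transformSec _ ⟨hw', hw.2⟩ v).trans (valueAt_transformSec _ hw v).symm)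
  exact hD.isIso_ι_of_isColimit (Limits.colimit.isColimit D)

/-! ### Sections of `farSheaf` from sections on slit domains -/

variable (F S) in
/-- The section of `farSheaf d F` given by a section of `F` on a slit domain. -/
def farSec (hd : Continuous d) (φ : Circle) :
    sec F (slitDomain S φ) →ₗ[k] sec (farSheaf d F) (dirChart hd φ) :=
  secMap (toFar d F (directionBound S)) _ ∘ₗ transformSec (fst_mem_slitDomain hd φ le_rfl)

theorem germAt_farSec (hd : Continuous d) {y : Y} (hy : y ∈ dirChart hd φ) {r : ℝ}
    (hr : directionBound S ≤ r) (v : sec F (slitDomain S φ)) {V : Opens Y} (hV : y ∈ V)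
    (t : sec (transform (halfPlaneFamily d r) F) V)
    (h : ∀ᶠ y' in 𝓝 y, ∀ x, (x, y') ∈ halfPlaneFamily d r →
      valueAt _ F V (x, y') t = germAt F _ x v) :
    germAt _ _ y (farSec F S hd φ v) = stalkMap (toFar d F r) y (germAt _ V y t) := by
  refine (stalkMap_germAt (toFar d F (directionBound S)) _ y _).symm.trans
    (stalkMap_toFar_germAt_eq hr hy hV ?_)
  filter_upwards [h, eventually_mem_opens hy] with y' h_eq hy' x hx
  rw [h_eq x hx]
  exact valueAt_transformSec (fst_mem_slitDomain hd φ le_rfl)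
    ⟨antitone_halfPlaneFamily d hr hx, hy'⟩ v

theorem germAt_farSec_bijective (hS : IsConstructible S F) (hF : IsAcyclic F) (hd : Continuous d)
    {y : Y} (hy : y ∈ dirChart hd φ) :
    Function.Bijective (germAt _ _ y ∘ₗ farSec F S hd φ) := by
  have := isIso_toFar hS hF hd (le_refl (directionBound S))
  convert (stalkMap_bijective_of_isIso (toFar d F (directionBound S)) y).comp
    (germAt_transformSec_bijective hS hF hd le_rfl hy) using 1
  funext v
  exact (stalkMap_germAt (toFar d F (directionBound S)) _ y _).symm

theorem eventually_valueAt_eq_of_germAt_farSec_eq (hS : IsConstructible S F) (hF : IsAcyclic F)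
    (hd : Continuous d) {y : Y} (hy : y ∈ dirChart hd φ) {r : ℝ} (hr : directionBound S ≤ r)
    {v : sec F (slitDomain S φ)} {V : Opens Y} (hV : y ∈ V)
    {t : sec (transform (halfPlaneFamily d r) F) V}
    (h : stalkMap (toFar d F r) y (germAt _ V y t) = germAt _ _ y (farSec F S hd φ v)) :
    ∀ᶠ y' in 𝓝 y, ∀ x, (x, y') ∈ halfPlaneFamily d r →
      valueAt _ F V (x, y') t = germAt F _ x v := by
  have := isIso_toFar hS hF hd hr
  have h_value : ∀ᶠ y' in 𝓝 y, ∀ x, (x, y') ∈ halfPlaneFamily d r →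
      valueAt _ F _ (x, y') (transformSec (fst_mem_slitDomain hd φ hr) v) = germAt F _ x v := by
    filter_upwards [eventually_mem_opens hy] with y' hy' x hx
    exact valueAt_transformSec (fst_mem_slitDomain hd φ hr) ⟨hx, hy'⟩ v
  rw [germAt_farSec hd hy hr v hy _ h_value] at h
  filter_upwards [h_value, eventually_valueAt_eq hV hy
    ((stalkMap_bijective_of_isIso (toFar d F r) y).1 h)] with y' hy' h_eq x hx
  rw [h_eq x, hy' x hx]

theorem finite_sec_slitDomain (hS : IsConstructible S F) (hF : IsAcyclic F) (φ : Circle) :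
    Module.Finite k (sec F (slitDomain S φ)) := by
  have hx : (directionBound S + 1) • (φ : ℂ) ∈ slitDomain S φ :=
    fst_mem_slitDomain continuous_id φ le_rfl _ ⟨smul_mem_halfPlaneFamily id (directionBound S) φ,
      self_mem_dirChart continuous_id φ⟩
  have := hS.2 ((directionBound S + 1) • (φ : ℂ))
  exact Module.Finite.equiv
    (LinearEquiv.ofBijective _ (germAt_slitDomain_bijective hS hF hx)).symm

theorem isLocalSystem_farSheaf (hS : IsConstructible S F) (hF : IsAcyclic F) (hd : Continuous d) :
    IsLocalSystem (farSheaf d F) := fun y =>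
  ⟨dirChart hd (d y), self_mem_dirChart hd y, sec F (slitDomain S (d y)),
    finite_sec_slitDomain hS hF (d y), farSec F S hd (d y), fun y' hy' => by
      rw [← germAt_of_mem hy']
      exact germAt_farSec_bijective hS hF hd hy'⟩

end Far

/-! ### Separating directions -/

section SeparatingDirections

variable {S : Finset ℂ} {φ : Circle}

theorem exists_isSeparating_of_injOn (h : Set.InjOn (imDir φ) S) : ∃ ε, IsSeparating S φ ε := by
  have h_small : ∀ᶠ ε in 𝓝[>] (0 : ℝ), ∀ c ∈ S, ∀ c' ∈ S, c ≠ c' →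
      2 * ε ≤ |imDir φ c - imDir φ c'| := by
    refine (eventually_all_finset S).2 fun c hc => (eventually_all_finset S).2 fun c' hc' => ?_
    refine eventually_imp_distrib_left.2 fun h_ne => ?_
    have h_pos := abs_pos.2 (sub_ne_zero.2 (h.ne hc hc' h_ne))
    filter_upwards [Ioo_mem_nhdsGT (half_pos h_pos)] with ε hε
    linarith [hε.2]
  obtain ⟨ε, h_le, hε⟩ := (h_small.and self_mem_nhdsWithin).exists
  exact ⟨ε, hε, h_le⟩

theorem eventually_imDir_exp_mul_ne_zero (u : Circle) {x : ℂ} (hx : x ≠ 0) :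
    ∀ᶠ t in 𝓝[>] (0 : ℝ), imDir (Circle.exp t * u) x ≠ 0 := by
  have h_imDir (t : ℝ) :
      imDir (Circle.exp t * u) x = imDir u x * Real.cos t - reDir u x * Real.sin t := by
    simp only [imDir_eq, reDir_eq, Circle.coe_mul, Circle.coe_exp, Complex.mul_re, Complex.mul_im,
      Complex.exp_ofReal_mul_I_re, Complex.exp_ofReal_mul_I_im]
    ring
  simp only [h_imDir]
  by_cases h_im : imDir u x = 0
  · have h_re : reDir u x ≠ 0 := fun h_re =>
      hx (eq_of_reDir_eq_of_imDir_eq (u := u) (h_re.trans (by simp [reDir]))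
        (h_im.trans (by simp [imDir])))
    filter_upwards [Ioo_mem_nhdsGT Real.pi_pos] with t ht
    simpa [h_im] using ⟨h_re, (Real.sin_pos_of_pos_of_lt_pi ht.1 ht.2).ne'⟩
  · have h_cont : Continuous fun t => imDir u x * Real.cos t - reDir u x * Real.sin t := by fun_prop
    exact nhdsWithin_le_nhds (h_cont.continuousAt.eventually_ne (by simpa using h_im))

theorem exists_isSeparating_near (S : Finset ℂ) (u : Circle) :
    ∃ (φ : Circle) (ε : ℝ), 0 < reDir u φ ∧ IsSeparating S φ ε := by
  have h_inj : ∀ᶠ t in 𝓝[>] (0 : ℝ), ∀ c ∈ S, ∀ c' ∈ S, c ≠ c' →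
      imDir (Circle.exp t * u) (c - c') ≠ 0 := by
    refine (eventually_all_finset S).2 fun c _ => (eventually_all_finset S).2 fun c' _ => ?_
    exact eventually_imp_distrib_left.2 fun h_ne =>
      eventually_imDir_exp_mul_ne_zero u (sub_ne_zero.2 h_ne)
  have h_near : ∀ᶠ t in 𝓝[>] (0 : ℝ), 0 < reDir u (Circle.exp t * u : Circle) := by
    have h_cont : Continuous fun t => reDir u (Circle.exp t * u : Circle) :=
      (continuous_reDir u).comp (by fun_prop)
    exact nhdsWithin_le_nhds (h_cont.continuousAt.eventually_const_lt (by simp))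
  obtain ⟨t, ht_inj, ht⟩ := (h_inj.and h_near).exists
  obtain ⟨ε, hε⟩ := exists_isSeparating_of_injOn (S := S) (φ := Circle.exp t * u)
    fun c hc c' hc' h_eq => by
      by_contra h_ne
      exact ht_inj c hc c' hc' h_ne ((imDir_sub _ c c').trans (sub_eq_zero.2 h_eq))
  exact ⟨_, ε, ht, hε⟩

theorem IsSeparating.anti {ε ε' : ℝ} (h : IsSeparating S φ ε) (hε' : 0 < ε') (h_le : ε' ≤ ε) :
    IsSeparating S φ ε' :=
  ⟨hε', fun c hc c' hc' h_ne => by linarith [h.le_abs_sub c hc c' hc' h_ne]⟩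

theorem exists_isSeparating (S : Finset ℂ) :
    ∃ ε, 0 < ε ∧ ∀ u : Circle, ∃ φ : Circle, 0 < reDir u φ ∧ IsSeparating S φ ε := by
  have h_uniform : ∃ ε, 0 < ε ∧
      ∀ u ∈ (Set.univ : Set Circle), ∃ φ : Circle, 0 < reDir u φ ∧ IsSeparating S φ ε := by
    refine isCompact_univ.induction_on ⟨1, one_pos, by simp⟩ ?_ ?_ fun u _ => ?_
    · rintro s t hst ⟨ε, hε, ht⟩
      exact ⟨ε, hε, fun u hu => ht u (hst hu)⟩
    · rintro s t ⟨ε, hε, hs⟩ ⟨ε', hε', ht⟩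
      have h_min := lt_min hε hε'
      refine ⟨min ε ε', h_min, fun u hu => ?_⟩
      rcases hu with hu | hu
      · obtain ⟨φ, hφ, h⟩ := hs u hu
        exact ⟨φ, hφ, h.anti h_min (min_le_left _ _)⟩
      · obtain ⟨φ, hφ, h⟩ := ht u hu
        exact ⟨φ, hφ, h.anti h_min (min_le_right _ _)⟩
    · obtain ⟨φ, ε, hφ, h⟩ := exists_isSeparating_near S u
      exact ⟨_, mem_nhdsWithin_of_mem_nhds
        ((continuous_reDir_left φ).continuousAt.eventually_const_lt hφ), ε, h.pos,
        fun v hv => ⟨φ, hv, h⟩⟩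
  obtain ⟨ε, hε, h⟩ := h_uniform
  exact ⟨ε, hε, fun u => h u trivial⟩

end SeparatingDirections

/-! ### Subsheaves of sections on half-planes -/

section HalfPlanes

variable {k : Type} [Field k] {Y : Type} [TopologicalSpace Y] {d : Y → Circle}
  {F : Sh k ℂ} {S : Finset ℂ} {φ : Circle} {ε : ℝ} {ρ : Y → ℝ} {Z : Set (ℂ × Y)}

/-- The fibre of `Z` over `y` is an open or closed half-plane in the direction `d y`, bounded by
the line `Re (x e^{-iθ}) = ρ y`; in either case the points of this line belong to fibres
arbitrarily close to `y`. This covers both the families defining `ℒ_{<ξ}` and `⋃_z 𝓗_z × {z}`. -/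
structure IsHalfPlaneFamily (d : Y → Circle) (ρ : Y → ℝ) (Z : Set (ℂ × Y)) : Prop where
  continuous : Continuous ρ
  le_reDir : ∀ x y, (x, y) ∈ Z → ρ y ≤ reDir (d y) x
  mem_of_lt : ∀ x y, ρ y < reDir (d y) x → (x, y) ∈ Z
  mem_of_le : ∀ x x' y, (x, y) ∈ Z → reDir (d y) x ≤ reDir (d y) x' → (x', y) ∈ Z
  frequently_mem : ∀ x y, ρ y ≤ reDir (d y) x → ∃ᶠ y' in 𝓝 y, (x, y') ∈ Z

/-- The map `i` is given by restriction of sections to far half-planes. -/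
def IsFarRestriction (i : transform Z F ⟶ farSheaf d F) : Prop :=
  ∀ (y : Y) (r : ℝ) (V V' : Opens Y) (s : sec (transform Z F) V)
    (t : sec (transform (halfPlaneFamily d r) F) V'), y ∈ V → y ∈ V' →
    (∀ᶠ y' in 𝓝 y, ∀ x, (x, y') ∈ halfPlaneFamily d r →
      (x, y') ∈ Z ∧ valueAt Z F V (x, y') s = valueAt _ F V' (x, y') t) →
    stalkMap i y (germAt _ V y s) = stalkMap (toFar d F r) y (germAt _ V' y t)

theorem isLocallySection_valueAt_fibre {V : Opens Y} (s : sec (transform Z F) V) {y : Y}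
    (hy : y ∈ V) :
    IsLocallySection F id {x | (x, y) ∈ Z} (fun x => valueAt Z F V (x, y) s) := by
  intro x hx
  obtain ⟨N, hN, t, ht⟩ := isLocallySection_valueAt s (x, y) ⟨hx, hy⟩
  have h_tendsto : Tendsto (·, y) (𝓝[{x | (x, y) ∈ Z}] x) (𝓝[partOver Z V] (x, y)) :=
    Continuous.continuousWithinAt (by fun_prop) |>.tendsto_nhdsWithin fun x hx => ⟨hx, hy⟩
  exact ⟨N, hN, t, h_tendsto.eventually ht⟩

namespace IsHalfPlaneFamily

theorem isPreconnected_slitDomain_inter_fibre (hZ : IsHalfPlaneFamily d ρ Z) (S : Finset ℂ)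
    {y : Y} (hy : 0 < reDir (d y) φ) :
    IsPreconnected ((slitDomain S φ : Set ℂ) ∩ {x | (x, y) ∈ Z}) := by
  let r := max (directionBound S) (ρ y)
  refine isPreconnected_slitDomain_inter (H := halfPlane (d y) r)
    (fun x hx t ht => hZ.mem_of_le _ _ _ hx ?_) (convex_halfPlane _ _).isPreconnected
    (fun x hx => hZ.mem_of_lt _ _ ((le_max_right _ _).trans_lt hx))
    (halfPlane_subset_slitDomain hy fun c hc =>
      (reDir_le_directionBound hc _).trans (le_max_left _ _))
    (fun x _ => exists_add_smul_mem_halfPlane hy x _)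
  rw [reDir_add, reDir_smul]
  exact le_add_of_nonneg_right (mul_nonneg ht hy.le)

theorem isPreconnected_fibre (hZ : IsHalfPlaneFamily d ρ Z) (y : Y) :
    IsPreconnected {x | (x, y) ∈ Z} := by
  have h_fibre := hZ.isPreconnected_slitDomain_inter_fibre (φ := d y) ∅ (y := y) (by simp)
  rwa [Set.inter_eq_right.2 fun x _ => mem_slitDomain.2 (by simp)] at h_fibre

theorem exists_far_sec (hZ : IsHalfPlaneFamily d ρ Z) (r₀ : ℝ) {V : Opens Y} {y : Y}
    (hy : y ∈ V) (s : sec (transform Z F) V) : ∃ r, r₀ ≤ r ∧ ∃ V' : Opens Y, y ∈ V' ∧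
      ∃ t : sec (transform (halfPlaneFamily d r) F) V', ∀ᶠ y' in 𝓝 y, ∀ x,
        (x, y') ∈ halfPlaneFamily d r →
          (x, y') ∈ Z ∧ valueAt Z F V (x, y') s = valueAt _ F V' (x, y') t := by
  let r := max r₀ (ρ y + 1)
  let V' : Opens Y := V ⊓ ⟨{y' | ρ y' < r}, isOpen_lt hZ.continuous continuous_const⟩
  have hy' : y ∈ V' := ⟨hy, (lt_add_one (ρ y)).trans_le (le_max_right _ _)⟩
  have h_sub : partOver (halfPlaneFamily d r) V' ⊆ partOver Z V := fun w hw =>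
    ⟨hZ.mem_of_lt _ _ (hw.2.2.trans hw.1), hw.2.1⟩
  obtain ⟨t, ht⟩ := exists_valueAt_eq ((isLocallySection_valueAt s).mono h_sub)
  refine ⟨r, le_max_left _ _, V', hy', t, ?_⟩
  filter_upwards [eventually_mem_opens hy'] with y' hy' x hx
  exact ⟨(h_sub ⟨hx, hy'⟩).1, (ht _ ⟨hx, hy'⟩).symm⟩

theorem eventually_valueAt_eq (hS : IsConstructible S F) (hF : IsAcyclic F) (hd : Continuous d)
    (hZ : IsHalfPlaneFamily d ρ Z) {i : transform Z F ⟶ farSheaf d F} (hi : IsFarRestriction i)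
    {y : Y} (hy : y ∈ dirChart hd φ) {V : Opens Y} (hV : y ∈ V) {s : sec (transform Z F) V}
    {v : sec F (slitDomain S φ)}
    (h : stalkMap i y (germAt _ V y s) = germAt _ _ y (farSec F S hd φ v)) :
    ∀ᶠ y' in 𝓝 y, ∀ x, (x, y') ∈ Z → x ∈ slitDomain S φ →
      valueAt Z F V (x, y') s = germAt F _ x v := by
  obtain ⟨r, hr, V', hV', t, ht⟩ := hZ.exists_far_sec (directionBound S) hV s
  rw [hi y r V V' s t hV hV' ht] at h
  filter_upwards [ht, eventually_valueAt_eq_of_germAt_farSec_eq hS hF hd hy hr hV' h,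
    eventually_mem_opens hy, eventually_mem_opens hV] with y' h_res h_far hy' hyV x hx hx_slit
  have hp := smul_mem_halfPlaneFamily d r y'
  obtain ⟨hpZ, h_eq⟩ := h_res _ hp
  exact ((isLocallySection_valueAt_fibre s hyV).mono Set.inter_subset_right).eqOn_of_isPreconnected
    (identityPrinciple hS hF) continuous_id (hZ.isPreconnected_slitDomain_inter_fibre S hy')
    ((isLocallySection_germAt v).mono Set.inter_subset_left)
    ⟨fst_mem_slitDomain hd φ hr (_, y') ⟨hp, hy'⟩, hpZ⟩ (h_eq.trans (h_far _ hp)) x ⟨hx_slit, hx⟩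

theorem mono (hS : IsConstructible S F) (hF : IsAcyclic F) (hd : Continuous d)
    (hZ : IsHalfPlaneFamily d ρ Z) {i : transform Z F ⟶ farSheaf d F} (hi : IsFarRestriction i) :
    Mono i := by
  refine mono_of_stalkMap_injective i fun y => (injective_iff_map_eq_zero _).2 fun a ha => ?_
  obtain ⟨V, hV, s, rfl⟩ := exists_germAt_eq _ a
  have hy := self_mem_dirChart hd y
  have h_zero := hZ.eventually_valueAt_eq hS hF hd hi hy hV (v := 0)
    (by rw [ha, map_zero, map_zero])
  rw [← map_zero (germAt (transform Z F) V y)]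
  refine germAt_eq_of_valueAt_eq hV hV ?_
  filter_upwards [h_zero, eventually_mem_opens hy, eventually_mem_opens hV]
    with y' h_zero hy' hyV x hx
  let r := max (directionBound S) (ρ y')
  have hp : ((r + 1) • (d y' : ℂ), y') ∈ halfPlaneFamily d r := smul_mem_halfPlaneFamily d r y'
  have hpZ := hZ.mem_of_lt _ _ ((le_max_right (directionBound S) (ρ y')).trans_lt hp)
  have hp_slit := fst_mem_slitDomain hd (d y) (le_max_left _ _) (_, y') ⟨hp, hy'⟩
  exact (isLocallySection_valueAt_fibre s hyV).eqOn_of_isPreconnected (identityPrinciple hS hF)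
    continuous_id (hZ.isPreconnected_fibre y') (isLocallySection_valueAt_fibre 0 hyV) hpZ
    (by rw [h_zero _ hpZ hp_slit, map_zero, map_zero]) x hx

theorem mem_extendable_of_mem_stalkRange (hS : IsConstructible S F) (hF : IsAcyclic F)
    (hd : Continuous d) (hφ : IsSeparating S φ ε) (hZ : IsHalfPlaneFamily d ρ Z)
    {i : transform Z F ⟶ farSheaf d F} (hi : IsFarRestriction i) {y : Y} (hy : y ∈ dirChart hd φ)
    {v : sec F (slitDomain S φ)} (hv : germAt _ _ y (farSec F S hd φ v) ∈ stalkRange i y)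
    {c : ℂ} (hc : c ∈ S) (hyc : ρ y ≤ reDir (d y) c) : v ∈ extendable F S φ ε c := by
  obtain ⟨a, ha⟩ := hv
  obtain ⟨V, hV, s, rfl⟩ := exists_germAt_eq _ a
  obtain ⟨y', hcZ, h_eq, hy', hyV⟩ := ((hZ.frequently_mem c y hyc).and_eventually
    ((hZ.eventually_valueAt_eq hS hF hd hi hy hV ha).and
      ((eventually_mem_opens hy).and (eventually_mem_opens hV)))).exists
  obtain ⟨N, hN, b, hb⟩ := isLocallySection_valueAt_fibre s hyV c hcZ
  obtain ⟨δ', hδ', h_ball⟩ := exists_openBall_subset (Filter.inter_mem (N.isOpen.mem_nhds hN)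
    (eventually_nhdsWithin_iff.1 hb))
  let δ := min δ' ε
  have hδ : 0 < δ := lt_min hδ' hφ.pos
  have h_le (x : ℂ) (hx : x ∈ openBall c δ) := h_ball (Metric.ball_subset_ball (min_le_left _ _) hx)
  have hx := add_smul_mem_openBall φ c hδ
  have hx_slit := hφ.add_smul_mem_slitDomain hc (half_pos hδ)
  have hxZ : (c + (δ / 2) • (φ : ℂ), y') ∈ Z := by
    refine hZ.mem_of_le _ _ _ hcZ ?_
    rw [reDir_add, reDir_smul]
    exact le_add_of_nonneg_right (mul_pos (half_pos hδ) hy').le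
  refine hφ.mem_extendable_of_germAt_eq hS hF hc hδ (min_le_right _ _)
    (secRes F (fun x hx => (h_le x hx).1) b) hx hx_slit ?_
  rw [germAt_secRes _ hx, ← h_eq _ hxZ hx_slit]
  exact (h_le _ hx).2 hxZ

theorem exists_nhds_mem_slitDomain_sup_strip (hd : Continuous d) (hφ : 0 < ε)
    (hZ : IsHalfPlaneFamily d ρ Z) {y : Y} (hy : y ∈ dirChart hd φ) :
    ∃ V : Opens Y, y ∈ V ∧ ∀ w ∈ partOver Z V,
      w.1 ∈ slitDomain S φ ⊔ {c ∈ S | ρ y ≤ reDir (d y) c}.sup (strip φ ε) := by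
  have h_lt : ∀ᶠ y' in 𝓝 y, ∀ c ∈ S, reDir (d y) c < ρ y → reDir (d y') c < ρ y' :=
    (eventually_all_finset S).2 fun c _ => eventually_imp_distrib_left.2 fun h =>
      ((continuous_reDir_left c).comp hd).continuousAt.eventually_lt hZ.continuous.continuousAt h
  obtain ⟨V, hV, hV_open, hyV⟩ := eventually_nhds_iff.1 (h_lt.and (eventually_mem_opens hy))
  refine ⟨⟨V, hV_open⟩, hyV, fun ⟨x, y'⟩ ⟨hx, hy'⟩ => or_iff_not_imp_left.2 fun hx_slit => ?_⟩
  have h_slit := mt mem_slitDomain.2 hx_slit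
  push Not at h_slit
  obtain ⟨c, hc, h_im, h_re⟩ := h_slit
  obtain ⟨h_lt, hy'_pos⟩ := hV y' hy'
  have h_le : reDir (d y') x ≤ reDir (d y') c := by
    rw [reDir_eq_reDir_mul_sub_imDir_mul (d y') φ x, reDir_eq_reDir_mul_sub_imDir_mul (d y') φ c,
      h_im]
    exact sub_le_sub_right (mul_le_mul_of_nonneg_right h_re (le_of_lt hy'_pos)) _
  have hyc : ρ y ≤ reDir (d y) c := not_lt.1 fun h_lt' =>
    (h_lt c hc h_lt').not_ge ((hZ.le_reDir x y' hx).trans h_le)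
  exact mem_opens_finset_sup.2
    ⟨c, Finset.mem_filter.2 ⟨hc, hyc⟩, mem_strip_of_imDir_eq hφ h_im⟩

theorem germAt_farSec_mem_stalkRange (hd : Continuous d) (hφ : IsSeparating S φ ε)
    (hZ : IsHalfPlaneFamily d ρ Z) {i : transform Z F ⟶ farSheaf d F} (hi : IsFarRestriction i)
    {y : Y} (hy : y ∈ dirChart hd φ) {v : sec F (slitDomain S φ)}
    (hv : ∀ c ∈ S, ρ y ≤ reDir (d y) c → v ∈ extendable F S φ ε c) :
    germAt _ _ y (farSec F S hd φ v) ∈ stalkRange i y := by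
  obtain ⟨V, hV, h_sub⟩ := hZ.exists_nhds_mem_slitDomain_sup_strip (S := S) hd hφ.pos hy
  obtain ⟨w, hw⟩ := exists_sec_of_mem_extendable hφ (Finset.filter_subset _ S) fun c hc =>
    hv c (Finset.mem_filter.1 hc).1 (Finset.mem_filter.1 hc).2
  refine ⟨germAt _ V y (transformSec h_sub w), ?_⟩
  obtain ⟨r, hr, V', hV', t, ht⟩ := hZ.exists_far_sec (directionBound S) hV (transformSec h_sub w)
  rw [hi y r V V' _ t hV hV' ht, germAt_farSec hd hy hr v hV' t]
  filter_upwards [ht, eventually_mem_opens hy, eventually_mem_opens hV] with y' h_eq hy' hyV x hx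
  rw [← (h_eq x hx).2, valueAt_transformSec h_sub ⟨(h_eq x hx).1, hyV⟩]
  exact hw x (fst_mem_slitDomain hd φ hr (x, y') ⟨hx, hy'⟩)

theorem germAt_farSec_mem_stalkRange_iff (hS : IsConstructible S F) (hF : IsAcyclic F)
    (hd : Continuous d) (hφ : IsSeparating S φ ε) (hZ : IsHalfPlaneFamily d ρ Z)
    {i : transform Z F ⟶ farSheaf d F} (hi : IsFarRestriction i) {y : Y} (hy : y ∈ dirChart hd φ)
    {v : sec F (slitDomain S φ)} :
    germAt _ _ y (farSec F S hd φ v) ∈ stalkRange i y ↔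
      ∀ c ∈ S, ρ y ≤ reDir (d y) c → v ∈ extendable F S φ ε c :=
  ⟨fun hv _ hc => hZ.mem_extendable_of_mem_stalkRange hS hF hd hφ hi hy hv hc,
    hZ.germAt_farSec_mem_stalkRange hd hφ hi hy⟩

end IsHalfPlaneFamily

end HalfPlanes

/-! ### The graded pieces -/

section Graded

variable {k : Type} [Field k] {F : Sh k ℂ} {S : Finset ℂ} {φ : Circle} {ε : ℝ}

theorem bijective_pi_of_ker_eq_extendable (hF : IsAcyclic F) (hφ : IsSeparating S φ ε)
    {M : S → Type} [∀ c, AddCommGroup (M c)] [∀ c, Module k (M c)]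
    (f : ∀ c, sec F (slitDomain S φ) →ₗ[k] M c)
    (hf_ker : ∀ c : S, LinearMap.ker (f c) = extendable F S φ ε c)
    (hf_surj : ∀ c, Function.Surjective (f c)) : Function.Bijective (LinearMap.pi f) := by
  refine ⟨(injective_iff_map_eq_zero _).2 fun v hv => ?_, fun x => ?_⟩
  · exact eq_zero_of_mem_extendable hF hφ fun c hc =>
      (hf_ker ⟨c, hc⟩).le (congrFun hv ⟨c, hc⟩)
  · choose v hv using fun c => hf_surj c (x c)
    obtain ⟨v₀, hv₀⟩ := exists_sub_mem_extendable hF hφ v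
    refine ⟨v₀, funext fun c => (sub_eq_zero.1 ?_).trans (hv c)⟩
    exact ((f c).map_sub _ _).symm.trans ((hf_ker c).ge (hv₀ c))

theorem pi_mkQ_extendable_bijective (hF : IsAcyclic F) (hφ : IsSeparating S φ ε) :
    Function.Bijective (LinearMap.pi fun c : S => (extendable F S φ ε c).mkQ) :=
  bijective_pi_of_ker_eq_extendable hF hφ _ (fun _ => Submodule.ker_mkQ _)
    fun _ => Submodule.mkQ_surjective _

/-- The circle of radius `ε / 2` around `c`. -/
def smallCircle (ε : ℝ) (c : ℂ) : TopCat.of Circle ⟶ TopCat.of ℂ :=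
  TopCat.ofHom ⟨fun u => c + (ε / 2) • (u : ℂ), by fun_prop⟩

theorem reDir_coe_comm (u φ : Circle) : reDir φ u = reDir u φ := by
  rw [reDir_eq, reDir_eq]
  ring

theorem smallCircle_mem_openBall (hε : 0 < ε) (c : ℂ) (u : Circle) :
    (smallCircle ε c).hom u ∈ openBall c ε := add_smul_mem_openBall u c hε

theorem IsSeparating.smallCircle_mem_slitDomain (hφ : IsSeparating S φ ε) {c : ℂ} (hc : c ∈ S)
    {u : Circle} (hu : u ∈ dirChart continuous_id φ) :
    (smallCircle ε c).hom u ∈ slitDomain S φ := by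
  refine (hφ.mem_slitDomain_iff hc
    (openBall_le_strip φ ε c (smallCircle_mem_openBall hφ.pos c u))).2 fun _ => ?_
  have h_pos : 0 < reDir φ u := by
    rw [reDir_coe_comm]
    exact hu
  change reDir φ c < reDir φ (c + (ε / 2) • (u : ℂ))
  rw [reDir_add, reDir_smul]
  exact lt_add_of_pos_right _ (mul_pos (half_pos hφ.pos) h_pos)

variable (F) in
/-- The germs on the small circle around `c` of the sections of `F` on the ball of radius `ε`. -/
def ballGerms (ε : ℝ) (c : ℂ) (u : Circle) : Submodule k (stk (pullSheaf (smallCircle ε c) F) u) :=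
  LinearMap.range (germAt _ _ u ∘ₗ pullSec (smallCircle ε c) F (openBall c ε))

variable (F) in
/-- The graded piece `gr_c` of the co-Stokes structure attached to `F`: the sheaf of germs of `F`
on a small circle around `c` modulo the sections of `F` near `c`. -/
def grSheaf (ε : ℝ) (c : ℂ) : Sh k Circle :=
  Limits.cokernel (subSheafIncl (pullSheaf (smallCircle ε c) F) (ballGerms F ε c))

variable (F) in
/-- The projection from the germs of `F` on a small circle around `c` to `gr_c`. -/
def grProj (ε : ℝ) (c : ℂ) : pullSheaf (smallCircle ε c) F ⟶ grSheaf F ε c :=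
  Limits.cokernel.π _

theorem stalkMap_grProj_surjective (ε : ℝ) (c : ℂ) (u : Circle) :
    Function.Surjective (stalkMap (grProj F ε c) u) :=
  stalkMap_cokernel_π_surjective _ u

theorem ker_stalkMap_grProj (ε : ℝ) (c : ℂ) (u : Circle) :
    LinearMap.ker (stalkMap (grProj F ε c) u) = stalkRange (subSheafIncl _ (ballGerms F ε c)) u :=
  ker_stalkMap_cokernel_π _ u

theorem stalkMap_grProj_pullStalk_eq_zero_iff (hε : 0 < ε) {c : ℂ} {u : Circle}
    {x : stk F ((smallCircle ε c).hom u)} :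
    stalkMap (grProj F ε c) u (pullStalk (smallCircle ε c) F u x) = 0 ↔
      ∃ b : sec F (openBall c ε), germAt F (openBall c ε) ((smallCircle ε c).hom u) b = x := by
  have h_ball := smallCircle_mem_openBall hε c u
  have h_germ : (∃ b : sec F (openBall c ε), germAt F _ ((smallCircle ε c).hom u) b = x) ↔
      pullStalk (smallCircle ε c) F u x ∈ ballGerms F ε c u := by
    refine exists_congr fun b => pullStalk_injective.eq_iff.symm.trans (Eq.congr_left ?_)
    exact pullStalk_germAt h_ball b
  rw [h_germ, ← LinearMap.mem_ker, ker_stalkMap_grProj, mem_stalkRange_subSheafIncl]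
  constructor
  · rintro ⟨U, hU, s, hs, h_mem⟩
    exact hs ▸ h_mem u hU
  · rintro ⟨b, hb⟩
    exact ⟨_, h_ball, _, hb, fun u' _ => ⟨b, rfl⟩⟩

variable (F) in
/-- The section of `gr_c` given by a section of `F` on a slit domain. -/
def grSec (hφ : IsSeparating S φ ε) {c : ℂ} (hc : c ∈ S) :
    sec F (slitDomain S φ) →ₗ[k] sec (grSheaf F ε c) (dirChart continuous_id φ) :=
  secMap (grProj F ε c) _ ∘ₗ secRes _ (fun _ hu => hφ.smallCircle_mem_slitDomain hc hu) ∘ₗ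
    pullSec (smallCircle ε c) F (slitDomain S φ)

theorem germAt_grSec (hφ : IsSeparating S φ ε) {c : ℂ} (hc : c ∈ S) {u : Circle}
    (hu : u ∈ dirChart continuous_id φ) (v : sec F (slitDomain S φ)) :
    germAt _ _ u (grSec F hφ hc v) =
      stalkMap (grProj F ε c) u (pullStalk (smallCircle ε c) F u (germAt F _ _ v)) := by
  have h_le : dirChart continuous_id φ ≤ preimageOpens (smallCircle ε c) (slitDomain S φ) :=
    fun _ hu' => hφ.smallCircle_mem_slitDomain hc hu'
  rw [pullStalk_germAt (hφ.smallCircle_mem_slitDomain hc hu), ← germAt_secRes h_le hu,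
    stalkMap_germAt]
  rfl

theorem ker_germAt_grSec (hS : IsConstructible S F) (hF : IsAcyclic F) (hφ : IsSeparating S φ ε)
    {c : ℂ} (hc : c ∈ S) {u : Circle} (hu : u ∈ dirChart continuous_id φ) :
    LinearMap.ker (germAt _ _ u ∘ₗ grSec F hφ hc) = extendable F S φ ε c := by
  have h_slit := hφ.smallCircle_mem_slitDomain hc hu
  have h_ball := smallCircle_mem_openBall hφ.pos c u
  ext v
  rw [LinearMap.mem_ker, LinearMap.comp_apply, germAt_grSec hφ hc hu,
    stalkMap_grProj_pullStalk_eq_zero_iff hφ.pos]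
  constructor
  · rintro ⟨b, hb⟩
    exact hφ.mem_extendable_of_germAt_eq hS hF hc hφ.pos le_rfl b h_ball h_slit hb.symm
  · intro hv
    obtain ⟨b, hb⟩ := exists_sec_openBall_of_mem_extendable hv
    exact ⟨b, hb _ h_slit h_ball⟩

theorem germAt_grSec_surjective (hS : IsConstructible S F) (hF : IsAcyclic F)
    (hφ : IsSeparating S φ ε) {c : ℂ} (hc : c ∈ S) {u : Circle}
    (hu : u ∈ dirChart continuous_id φ) :
    Function.Surjective (germAt _ _ u ∘ₗ grSec F hφ hc) := by
  have h_germ := germAt_slitDomain_bijective hS hF (hφ.smallCircle_mem_slitDomain hc hu)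
  convert (stalkMap_grProj_surjective ε c u).comp (pullStalk_surjective.comp h_germ.2) using 1
  exact funext (germAt_grSec hφ hc hu)

theorem isLocalSystem_grSheaf (hS : IsConstructible S F) (hF : IsAcyclic F)
    (hε : ∀ u : Circle, ∃ φ : Circle, 0 < reDir u φ ∧ IsSeparating S φ ε) {c : ℂ} (hc : c ∈ S) :
    IsLocalSystem (grSheaf F ε c) := by
  intro u
  obtain ⟨φ, hu, hφ⟩ := hε u
  have := finite_sec_slitDomain hS hF φ
  have h_ker {u'} (hu' : u' ∈ dirChart continuous_id φ) := ker_germAt_grSec hS hF hφ hc hu'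
  have h_le : extendable F S φ ε c ≤ LinearMap.ker (grSec F hφ hc) := fun v hv =>
    sec_ext fun u' hu' => ((h_ker hu').ge hv).trans (map_zero _).symm
  refine ⟨dirChart continuous_id φ, hu,
    ModuleCat.of k (sec F (slitDomain S φ) ⧸ extendable F S φ ε c),
    inferInstanceAs (Module.Finite k (sec F (slitDomain S φ) ⧸ extendable F S φ ε c)),
    (extendable F S φ ε c).liftQ (grSec F hφ hc) h_le, fun u' hu' => ?_⟩
  rw [← germAt_of_mem hu']
  refine ⟨(injective_iff_map_eq_zero _).2 fun q hq => ?_, fun a => ?_⟩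
  · obtain ⟨v, rfl⟩ := (extendable F S φ ε c).mkQ_surjective q
    exact (Submodule.Quotient.mk_eq_zero _).2 ((h_ker hu').le hq)
  · obtain ⟨v, rfl⟩ := germAt_grSec_surjective hS hF hφ hc hu' a
    exact ⟨(extendable F S φ ε c).mkQ v, rfl⟩

variable (F) in
/-- The germs at `u` in the graded pieces `gr_c`, `c ∈ S`, of a section on a slit domain. -/
def grGerms (hφ : IsSeparating S φ ε) (u : Circle) :
    sec F (slitDomain S φ) →ₗ[k] ∀ c : S, stk (grSheaf F ε c) u :=
  LinearMap.pi fun c : S => germAt _ _ u ∘ₗ grSec F hφ c.2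

theorem grGerms_bijective (hS : IsConstructible S F) (hF : IsAcyclic F) (hφ : IsSeparating S φ ε)
    {u : Circle} (hu : u ∈ dirChart continuous_id φ) : Function.Bijective (grGerms F hφ u) :=
  bijective_pi_of_ker_eq_extendable hF hφ _ (fun c => ker_germAt_grSec hS hF hφ c.2 hu)
    fun c => germAt_grSec_surjective hS hF hφ c.2 hu

end Graded

/-! ### Co-Stokes structures and co-Stokes sheaves -/

section CoStokes

variable {k : Type} [Field k] {F : Sh k ℂ} {S : Finset ℂ} {φ : Circle} {ε : ℝ}

theorem isHalfPlaneFamily_incSAt (ξ : ℂ) :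
    IsHalfPlaneFamily id (fun u => reDir u ξ) (incSAt ξ) where
  continuous := continuous_reDir_left ξ
  le_reDir _ _ h := h
  mem_of_lt _ _ h := le_of_lt h
  mem_of_le _ _ _ h h' := le_trans h h'
  frequently_mem _ _ h := frequently_iff.2 fun hU => ⟨_, mem_of_mem_nhds hU, h⟩

/-- The dilation `z ↦ e^t z` of `ℂ*`. -/
def dilate (t : ℝ) (z : Cstar) : Cstar :=
  ⟨Real.exp t * z, mul_ne_zero (Complex.ofReal_ne_zero.2 (Real.exp_ne_zero t)) z.2⟩

theorem norm_dilate (t : ℝ) (z : Cstar) : ‖(dilate t z : ℂ)‖ = Real.exp t * ‖(z : ℂ)‖ := by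
  rw [dilate, norm_mul, Complex.norm_real, Real.norm_of_nonneg (Real.exp_pos t).le]

theorem log_norm_dilate (t : ℝ) (z : Cstar) :
    Real.log ‖(dilate t z : ℂ)‖ = t + Real.log ‖(z : ℂ)‖ := by
  rw [norm_dilate, Real.log_mul (Real.exp_ne_zero t) (norm_ne_zero_iff.2 z.2), Real.log_exp]

theorem dir_dilate (t : ℝ) (z : Cstar) : dir (dilate t z) = dir z := by
  refine Subtype.ext ?_
  change (dilate t z : ℂ) / (‖(dilate t z : ℂ)‖ : ℂ) = z / (‖(z : ℂ)‖ : ℂ)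
  rw [norm_dilate, Complex.ofReal_mul]
  exact mul_div_mul_left _ _ (Complex.ofReal_ne_zero.2 (Real.exp_ne_zero t))

theorem tendsto_dilate_zero (z : Cstar) : Tendsto (fun t => dilate t z) (𝓝 0) (𝓝 z) := by
  have h_cont : Continuous fun t => dilate t z := Continuous.subtype_mk (by fun_prop) _
  convert h_cont.tendsto 0 using 2
  exact Subtype.ext (by simp [dilate])

theorem isHalfPlaneFamily_incH :
    IsHalfPlaneFamily dir (fun z => Real.log ‖(z : ℂ)‖) incH where
  continuous := continuous_subtype_val.norm.log fun z => norm_ne_zero_iff.2 z.2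
  le_reDir _ _ h := le_of_lt h
  mem_of_lt _ _ h := h
  mem_of_le _ _ _ h h' := lt_of_lt_of_le h h'
  frequently_mem x z h := by
    have h_tendsto : Tendsto (fun t => dilate t z) (𝓝[<] 0) (𝓝 z) :=
      (tendsto_dilate_zero z).mono_left nhdsWithin_le_nhds
    refine h_tendsto.frequently (Eventually.frequently ?_)
    filter_upwards [self_mem_nhdsWithin] with t (ht : t < 0)
    change Real.log ‖(dilate t z : ℂ)‖ < reDir (dir (dilate t z)) x
    rw [log_norm_dilate, dir_dilate]
    exact (add_lt_of_neg_left _ ht).trans_le h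

variable (F) in
theorem isFarRestriction_incSAt (ξ : ℂ) :
    IsFarRestriction (d := id) (F := F) (Z := incSAt ξ)
      ((pullPushRes (incS_subset ξ) ≫ toColim k incS antitone_incS ‖ξ‖).app F) := by
  intro u r V V' s t hV hV' h
  have h_ξ : halfPlaneFamily id (max r ‖ξ‖) ⊆ halfPlaneFamily id ‖ξ‖ :=
    antitone_halfPlaneFamily id (le_max_right r ‖ξ‖)
  have h_r : halfPlaneFamily id (max r ‖ξ‖) ⊆ halfPlaneFamily id r :=
    antitone_halfPlaneFamily id (le_max_left r ‖ξ‖)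
  let t' := secMap ((pullPushRes (k := k) h_r).app F) V' t
  have h_t : stalkMap (toFar id F (max r ‖ξ‖)) u (germAt _ V' u t') =
      stalkMap (toFar id F r) u (germAt _ V' u t) := by
    rw [← stalkMap_germAt]
    exact stalkMap_toFar_pullPushRes (le_max_left r ‖ξ‖) u _
  refine (stalkMap_comp ((pullPushRes (k := k) (incS_subset ξ)).app F)
    (toFar id F ‖ξ‖) u _).trans (Eq.trans ?_ h_t)
  rw [stalkMap_germAt]
  refine stalkMap_toFar_germAt_eq (le_max_right r ‖ξ‖) hV hV' ?_
  filter_upwards [h, eventually_mem_opens hV, eventually_mem_opens hV'] with u' h hu hu' x hx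
  rw [valueAt_pullPushRes h_r ⟨hx, hu'⟩ t, ← (h x (h_r hx)).2]
  exact valueAt_pullPushRes (incS_subset ξ) ⟨h_ξ hx, hu⟩ s

theorem IsRestriction.stalkMap_restrictToDirectG {ι : directG k ⟶ directL k}
    (hι : IsRestriction ι) (r : ℝ) (z : Cstar) (x : stk (transform (incH ∪ incC r) F) z) :
    stalkMap (ι.app F) z (stalkMap ((restrictToDirectG k r).app F) z x) =
      stalkMap ((restrictToColim k r).app F) z x := by
  have h_comp : (restrictToDirectG k r).app F ≫ ι.app F = (restrictToColim k r).app F :=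
    NatTrans.congr_app (hι r) F
  rw [← stalkMap_comp, h_comp]

theorem stalkMap_restrictToColim_germAt (r : ℝ) {V : Opens Cstar} (z : Cstar)
    (s : sec (transform (incH ∪ incC r) F) V) :
    stalkMap ((restrictToColim k r).app F) z (germAt _ V z s) =
      stalkMap (toFar dir F r) z (germAt _ V z (secMap ((pullPushRes (k := k)
        (Set.subset_union_right : incC r ⊆ incH ∪ incC r)).app F) V s)) :=
  (stalkMap_comp ((pullPushRes (k := k)
    (Set.subset_union_right : incC r ⊆ incH ∪ incC r)).app F) (toFar dir F r) z _).trans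
    (congrArg (stalkMap (toFar dir F r) z) (stalkMap_germAt _ V z s))

variable (F) in
theorem isFarRestriction_of_isRestriction {ι : directG k ⟶ directL k} (hι : IsRestriction ι) :
    IsFarRestriction (d := dir) (F := F) (Z := incH) (ι.app F) := by
  intro z r V V' s t hV hV' h
  obtain ⟨r', hr, h_log⟩ : ∃ r', r ≤ r' ∧ Real.log ‖(z : ℂ)‖ < r' :=
    ⟨max r (Real.log ‖(z : ℂ)‖ + 1), le_max_left _ _, (lt_add_one _).trans_le (le_max_right _ _)⟩
  obtain ⟨a, ha⟩ := (stalkMap_restrictToDirectG_bijective F h_log).2 (germAt _ V z s)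
  obtain ⟨W, hW, s', rfl⟩ := exists_germAt_eq (transform (incH ∪ incC r') F) a
  refine (congrArg (stalkMap (ι.app F) z) ha).symm.trans
    ((hι.stalkMap_restrictToDirectG r' z _).trans
      ((stalkMap_restrictToColim_germAt r' z s').trans ?_))
  rw [stalkMap_germAt] at ha
  refine (stalkMap_toFar_germAt_eq (d := dir) hr hV' hW ?_).symm
  filter_upwards [h, eventually_mem_opens hW, eventually_valueAt_eq hW hV ha,
    eventually_log_norm_lt h_log] with z' h hz' h_s h_lt x hx
  have h_incH : (x, z') ∈ incH := lt_trans h_lt hx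
  exact (h x (antitone_halfPlaneFamily dir hr hx)).2.symm.trans
    ((h_s x).symm.trans ((valueAt_pullPushRes Set.subset_union_left ⟨h_incH, hz'⟩ s').trans
      (valueAt_pullPushRes Set.subset_union_right (w := (x, z')) ⟨hx, hz'⟩ s').symm))

theorem exists_stalk_map_grGerms (hS : IsConstructible S F) (hF : IsAcyclic F)
    (hφ : IsSeparating S φ ε) :
    ∃ e : ∀ u : Circle, (∀ c : S, stk (grSheaf F ε c) u) →ₗ[k] stk (farSheaf id F) u,
      ∀ u ∈ dirChart continuous_id φ, ∀ v,
        e u (grGerms F hφ u v) = germAt _ _ u (farSec F S continuous_id φ v) := by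
  suffices ∀ u : Circle, ∃ e : (∀ c : S, stk (grSheaf F ε c) u) →ₗ[k] stk (farSheaf id F) u,
      u ∈ dirChart continuous_id φ → ∀ v,
        e (grGerms F hφ u v) = germAt _ _ u (farSec F S continuous_id φ v) from
    ⟨fun u => (this u).choose, fun u => (this u).choose_spec⟩
  intro u
  by_cases hu : u ∈ dirChart continuous_id φ
  · let θ := LinearEquiv.ofBijective _ (grGerms_bijective hS hF hφ hu)
    exact ⟨germAt _ _ u ∘ₗ farSec F S continuous_id φ ∘ₗ θ.symm.toLinearMap, fun _ v =>
      congrArg (germAt _ _ u ∘ₗ farSec F S continuous_id φ) (θ.symm_apply_apply v)⟩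
  · exact ⟨0, fun hu' => absurd hu' hu⟩

theorem exists_sec_germAt_eq_of_grGerms (hS : IsConstructible S F) (hF : IsAcyclic F)
    (hφ : IsSeparating S φ ε)
    {e : ∀ u : Circle, (∀ c : S, stk (grSheaf F ε c) u) →ₗ[k] stk (farSheaf id F) u}
    (he : ∀ u ∈ dirChart continuous_id φ, ∀ v,
      e u (grGerms F hφ u v) = germAt _ _ u (farSec F S continuous_id φ v))
    {W : Opens Circle} (hW : W ≤ dirChart continuous_id φ) (s : ∀ c : S, sec (grSheaf F ε c) W) :
    ∃ t : sec (farSheaf id F) W, ∀ u ∈ W,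
      germAt _ W u t = e u fun c => germAt _ W u (s c) := by
  refine exists_sec_of_eventually_germAt_eq (farSheaf id F) W _ fun u hu => ?_
  obtain ⟨v, hv⟩ := (grGerms_bijective hS hF hφ (hW hu)).2 fun c => germAt _ W u (s c)
  have h_germs : ∀ᶠ u' in 𝓝 u, ∀ c : S,
      germAt _ _ u' (grSec F hφ c.2 v) = germAt _ W u' (s c) :=
    eventually_all.2 fun c => eventually_germAt_eq (hW hu) hu (congrFun hv c)
  refine ⟨dirChart continuous_id φ, hW hu, farSec F S continuous_id φ v, ?_⟩
  filter_upwards [h_germs, eventually_mem_opens hu] with u' h_eq hu'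
  rw [← he u' (hW hu')]
  exact congrArg (e u') (funext h_eq)

theorem isCoStokesStructure_of_isFarRestriction (hS : IsConstructible S F) (hF : IsAcyclic F)
    (i : ∀ ξ, transform (incSAt ξ) F ⟶ farSheaf id F)
    (hi : ∀ ξ, IsFarRestriction (d := id) (i ξ)) :
    IsCoStokesStructure S ⟨farSheaf id F, fun ξ => transform (incSAt ξ) F, i⟩ := by
  have hd : Continuous (id : Circle → Circle) := continuous_id
  obtain ⟨ε, _, hε⟩ := exists_isSeparating S
  have h_mem {φ} (hφ : IsSeparating S φ ε) {u} (hu : u ∈ dirChart hd φ) (ξ : ℂ)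
      (v : sec F (slitDomain S φ)) : germAt _ _ u (farSec F S hd φ v) ∈ stalkRange (i ξ) u ↔
        ∀ c ∈ S, reDir u ξ ≤ reDir u c → v ∈ extendable F S φ ε c :=
    (isHalfPlaneFamily_incSAt ξ).germAt_farSec_mem_stalkRange_iff hS hF hd hφ (hi ξ) hu
  refine ⟨isLocalSystem_farSheaf hS hF hd,
    fun ξ => (isHalfPlaneFamily_incSAt ξ).mono hS hF hd (hi ξ), fun u ξ₁ ξ₂ h_lt a ha => ?_,
    fun c => grSheaf F ε c, fun c => isLocalSystem_grSheaf hS hF hε c.2, fun u₀ => ?_⟩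
  · obtain ⟨φ, hu, hφ⟩ := hε u
    obtain ⟨v, rfl⟩ := (germAt_farSec_bijective hS hF hd (φ := φ) hu).2 a
    exact (h_mem hφ hu ξ₂ v).2 fun c hc h => (h_mem hφ hu ξ₁ v).1 ha c hc (h_lt.le.trans h)
  obtain ⟨φ, hu₀, hφ⟩ := hε u₀
  obtain ⟨e, he⟩ := exists_stalk_map_grGerms hS hF hφ
  have h_gr {u} (hu : u ∈ dirChart hd φ) := grGerms_bijective hS hF hφ hu
  refine ⟨dirChart hd φ, hu₀, e, fun u hu => ?_, fun W hW s => ?_, fun u hu ξ x => ?_⟩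
  · refine (Function.Bijective.of_comp_iff _ (h_gr hu)).1 ?_
    convert germAt_farSec_bijective hS hF hd hu using 1
    exact funext (he u hu)
  · obtain ⟨t, ht⟩ := exists_sec_germAt_eq_of_grGerms hS hF hφ he hW s
    refine ⟨t, fun u hu => ?_⟩
    simpa only [germAt_of_mem hu] using ht u hu
  · obtain ⟨v, rfl⟩ := (h_gr hu).2 x
    have h_ker (c : S) : germAt _ _ u (grSec F hφ c.2 v) = 0 ↔ v ∈ extendable F S φ ε c :=
      SetLike.ext_iff.1 (ker_germAt_grSec hS hF hφ c.2 hu) v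
    rw [he u hu, h_mem hφ hu, Subtype.forall]
    exact forall₂_congr fun c hc => imp_congr not_lt.symm (h_ker ⟨c, hc⟩).symm

theorem notMem_outside_iff {z : Cstar} {c : ℂ} :
    z ∉ outside c ↔ Real.log ‖(z : ℂ)‖ ≤ reDir (dir z) c := by
  rw [outside, Set.mem_ofPred_eq, not_lt, Real.log_le_iff_le_exp (norm_pos_iff.2 z.2)]

theorem isCoStokesSheaf_of_isFarRestriction (hS : IsConstructible S F) (hF : IsAcyclic F)
    (i : transform incH F ⟶ farSheaf dir F) (hi : IsFarRestriction (d := dir) i) :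
    IsCoStokesSheaf S ⟨farSheaf dir F, transform incH F, i⟩ := by
  refine ⟨isHalfPlaneFamily_incH.mono hS hF continuous_dir hi, fun z₀ => ?_⟩
  obtain ⟨ε, _, hε⟩ := exists_isSeparating S
  obtain ⟨φ, hz₀, hφ⟩ := hε (dir z₀)
  have := finite_sec_slitDomain hS hF φ
  let θ := LinearEquiv.ofBijective _ (pi_mkQ_extendable_bijective (F := F) hF hφ)
  refine ⟨dirChart continuous_dir φ, hz₀,
    fun c => ModuleCat.of k (sec F (slitDomain S φ) ⧸ extendable F S φ ε c),
    fun c => inferInstanceAs (Module.Finite k (sec F (slitDomain S φ) ⧸ extendable F S φ ε c)),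
    farSec F S continuous_dir φ ∘ₗ θ.symm.toLinearMap, fun z hz => ?_⟩
  rw [← germAt_of_mem hz]
  refine ⟨(germAt_farSec_bijective hS hF continuous_dir hz).comp θ.symm.bijective, fun x => ?_⟩
  obtain ⟨v, rfl⟩ := θ.surjective x
  have h_farSec : (farSec F S continuous_dir φ ∘ₗ θ.symm.toLinearMap) (θ v) =
      farSec F S continuous_dir φ v := congrArg (farSec F S continuous_dir φ) (θ.symm_apply_apply v)
  refine (iff_of_eq (congrArg (fun a => germAt _ _ z a ∈ stalkRange i z) h_farSec)).trans ?_
  rw [isHalfPlaneFamily_incH.germAt_farSec_mem_stalkRange_iff hS hF continuous_dir hφ hi hz,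
    Subtype.forall]
  exact forall₂_congr fun c hc =>
    imp_congr notMem_outside_iff.symm (Submodule.Quotient.mk_eq_zero _).symm

end CoStokes

/-! ### The comparison map -/

section Comparison

variable {k : Type} [Field k]

/-- The push-forward `π_*` from `ℂ*` to `S¹`, right adjoint to `piPull`. -/
abbrev piPush (k : Type) [Field k] : Sh k Cstar ⥤ Sh k Circle :=
  TopCat.Sheaf.pushforward (ModuleCat.{0} k) dirMap

/-- The base change map `R⁰q_{r*} p_r^* F ⟶ π_* R⁰n_{r*} m_r^* F`. -/
abbrev dirBaseChange (F : Sh k ℂ) (r : ℝ) :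
    transform (halfPlaneFamily id r) F ⟶ (piPush k).obj (transform (halfPlaneFamily dir r) F) :=
  transformBaseChange dirMap (fun _ h => h) F

theorem valueAt_dirBaseChange (F : Sh k ℂ) {r : ℝ} {V : Opens Circle}
    (s : sec (transform (halfPlaneFamily id r) F) V) {w : ℂ × Cstar}
    (hw : w ∈ partOver (halfPlaneFamily dir r) (preimageOpens dirMap V)) :
    valueAt (halfPlaneFamily dir r) F (preimageOpens dirMap V) w (secMap (dirBaseChange F r) V s) =
      valueAt (halfPlaneFamily id r) F V (w.1, dir w.2) s :=
  valueAt_transformBaseChange dirMap (fun _ h => h) F s hw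

theorem pullPushRes_dirBaseChange (F : Sh k ℂ) {r r' : ℝ} (h : r ≤ r') :
    (pullPushRes (k := k) (antitone_halfPlaneFamily id h)).app F ≫ dirBaseChange F r' =
      dirBaseChange F r ≫
        (piPush k).map ((pullPushRes (k := k) (antitone_halfPlaneFamily dir h)).app F) := by
  refine hom_ext_of_secMap fun V s => transform_sec_ext (Z := halfPlaneFamily dir r')
    (V := preimageOpens dirMap V) fun w hw => ?_
  have h_mem : w ∈ halfPlaneFamily dir r := antitone_halfPlaneFamily dir h hw.1
  exact (valueAt_dirBaseChange F _ hw).trans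
    ((valueAt_pullPushRes (antitone_halfPlaneFamily id h) ⟨hw.1, hw.2⟩ s).trans
      ((valueAt_pullPushRes (antitone_halfPlaneFamily dir h) hw _).trans
        (valueAt_dirBaseChange F s ⟨h_mem, hw.2⟩)).symm)

theorem dirBaseChange_naturality {F F' : Sh k ℂ} (a : F ⟶ F') (r : ℝ) :
    (pullPush k (halfPlaneFamily id r)).map a ≫ dirBaseChange F' r =
      dirBaseChange F r ≫ (piPush k).map ((pullPush k (halfPlaneFamily dir r)).map a) := by
  refine hom_ext_of_secMap fun V s => transform_sec_ext (Z := halfPlaneFamily dir r)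
    (V := preimageOpens dirMap V) fun w hw => ?_
  exact (valueAt_dirBaseChange F' _ hw).trans ((valueAt_map a V (w.1, dir w.2) s).trans
    ((valueAt_map (F := F) a (preimageOpens dirMap V) w (secMap (dirBaseChange F r) V s)).trans
      (congrArg (stalkMap a w.1) (valueAt_dirBaseChange F s hw))).symm)

theorem secMap_dirBaseChange_transformSec {F : Sh k ℂ} {r : ℝ} {N : Opens ℂ} {V : Opens Circle}
    (h : ∀ w ∈ partOver (halfPlaneFamily id r) V, w.1 ∈ N)
    (h' : ∀ w ∈ partOver (halfPlaneFamily dir r) (preimageOpens dirMap V), w.1 ∈ N)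
    (v : sec F N) : secMap (dirBaseChange F r) V (transformSec h v) = transformSec h' v :=
  transform_sec_ext (Z := halfPlaneFamily dir r) (V := preimageOpens dirMap V) fun w hw =>
    (valueAt_dirBaseChange F _ hw).trans
      ((valueAt_transformSec h (w := (w.1, dir w.2)) hw v).trans
        (valueAt_transformSec h' hw v).symm)

theorem pullPushRes_dirBaseChange_toFar (F : Sh k ℂ) {r r' : ℝ} (h : r ≤ r') :
    (pullPushRes (k := k) (antitone_halfPlaneFamily id h)).app F ≫
        dirBaseChange F r' ≫ (piPush k).map (toFar dir F r') =
      dirBaseChange F r ≫ (piPush k).map (toFar dir F r) := by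
  have h_far : (pullPushRes (k := k) (antitone_halfPlaneFamily dir h)).app F ≫ toFar dir F r' =
      toFar dir F r :=
    NatTrans.congr_app (toColim_comp (halfPlaneFamily dir) (antitone_halfPlaneFamily dir) h) F
  rw [← Category.assoc, pullPushRes_dirBaseChange F h, Category.assoc, ← Functor.map_comp, h_far]

theorem exists_comparison (F : Sh k ℂ) :
    ∃ f : (piPull k).obj (farSheaf id F) ⟶ farSheaf dir F, ∀ r,
      toFar id F r ≫ pullUnit dirMap (farSheaf id F) ≫ (piPush k).map f =
        dirBaseChange F r ≫ (piPush k).map (toFar dir F r) := by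
  let D := (pullPushDiagram k (halfPlaneFamily id) (antitone_halfPlaneFamily id)).flip.obj F
  let c : Limits.Cocone D :=
    { pt := (piPush k).obj (farSheaf dir F)
      ι :=
        { app := fun r => dirBaseChange F r ≫ (piPush k).map (toFar dir F r)
          naturality := fun r r' g =>
            (pullPushRes_dirBaseChange_toFar F g.le).trans (Category.comp_id _).symm } }
  obtain ⟨f, hf⟩ := exists_pullUnit_comp_eq (f := dirMap) (B := farSheaf dir F)
    (Limits.colimit.desc D c)
  exact ⟨f, fun r => (congrArg (toFar id F r ≫ ·) hf).trans (Limits.colimit.ι_desc c r)⟩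

/-- The comparison map `π^* colim_r R⁰q_{r*} p_r^* F ⟶ colim_r R⁰n_{r*} m_r^* F`, adjoint to the
colimit of the base change maps. -/
def comparison (F : Sh k ℂ) : (piPull k).obj (farSheaf id F) ⟶ farSheaf dir F :=
  (exists_comparison F).choose

theorem toFar_comparison (F : Sh k ℂ) (r : ℝ) :
    toFar id F r ≫ pullUnit dirMap (farSheaf id F) ≫ (piPush k).map (comparison F) =
      dirBaseChange F r ≫ (piPush k).map (toFar dir F r) :=
  (exists_comparison F).choose_spec r

theorem toFar_naturality {Y : Type} [TopologicalSpace Y] (d : Y → Circle) {F F' : Sh k ℂ}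
    (a : F ⟶ F') (r : ℝ) :
    toFar d F r ≫ (colimPullPush k (halfPlaneFamily d) (antitone_halfPlaneFamily d)).map a =
      (pullPush k (halfPlaneFamily d r)).map a ≫ toFar d F' r :=
  ((toColim k (halfPlaneFamily d) (antitone_halfPlaneFamily d) r).naturality a).symm

theorem comparison_naturality {F F' : Sh k ℂ} (a : F ⟶ F') :
    (piPull k).map
        ((colimPullPush k (halfPlaneFamily id) (antitone_halfPlaneFamily id)).map a) ≫
        comparison F' =
      comparison F ≫ (colimPullPush k (halfPlaneFamily dir) (antitone_halfPlaneFamily dir)).map a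
      := by
  let α := (colimPullPush k (halfPlaneFamily (id : Circle → Circle))
    (antitone_halfPlaneFamily id)).map a
  let β := (colimPullPush k (halfPlaneFamily dir) (antitone_halfPlaneFamily dir)).map a
  refine pullSheaf_hom_ext (Limits.colimit.hom_ext fun r => ?_)
  have h_unit : pullUnit dirMap (farSheaf id F) ≫ (piPush k).map ((piPull k).map α) =
      α ≫ pullUnit dirMap (farSheaf id F') :=
    ((TopCat.Sheaf.pullbackPushforwardAdjunction (ModuleCat.{0} k) dirMap).unit.naturality α).symm
  calc toFar id F r ≫ pullUnit dirMap _ ≫ (piPush k).map ((piPull k).map α ≫ comparison F')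
    _ = (toFar id F r ≫ α) ≫ pullUnit dirMap _ ≫ (piPush k).map (comparison F') := by
      rw [Functor.map_comp, reassoc_of% h_unit, Category.assoc]
    _ = (pullPush k (halfPlaneFamily id r)).map a ≫
          toFar id F' r ≫ pullUnit dirMap _ ≫ (piPush k).map (comparison F') := by
      rw [toFar_naturality, Category.assoc]
    _ = dirBaseChange F r ≫
          (piPush k).map ((pullPush k (halfPlaneFamily dir r)).map a ≫ toFar dir F' r) := by
      rw [toFar_comparison, ← Category.assoc, dirBaseChange_naturality, Category.assoc,
        ← Functor.map_comp]
    _ = (toFar id F r ≫ pullUnit dirMap _ ≫ (piPush k).map (comparison F)) ≫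
          (piPush k).map β := by
      rw [← toFar_naturality, Functor.map_comp, toFar_comparison, Category.assoc]
    _ = toFar id F r ≫ pullUnit dirMap _ ≫ (piPush k).map (comparison F ≫ β) := by
      rw [Functor.map_comp, Category.assoc, Category.assoc]

theorem stalkMap_comparison_germAt (F : Sh k ℂ) {r : ℝ} {z : Cstar} {V : Opens Circle}
    (hV : dir z ∈ V) (s : sec (transform (halfPlaneFamily id r) F) V) :
    stalkMap (comparison F) z (pullStalk dirMap (farSheaf id F) z
        (germAt _ V (dir z) (secMap (toFar id F r) V s))) =
      germAt _ (preimageOpens dirMap V) z (secMap (toFar dir F r) (preimageOpens dirMap V)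
        (secMap (dirBaseChange F r) V s)) := by
  have h_sec := congrArg (fun f => secMap f V s) (toFar_comparison F r)
  refine (congrArg (stalkMap (comparison F) z) (pullStalk_germAt (w := z) hV _)).trans ?_
  rw [stalkMap_germAt]
  exact congrArg _ h_sec

variable {F : Sh k ℂ} {S : Finset ℂ} {φ : Circle}

theorem stalkMap_comparison_farSec {z : Cstar} (hz : z ∈ dirChart continuous_dir φ)
    (v : sec F (slitDomain S φ)) :
    stalkMap (comparison F) z (pullStalk dirMap (farSheaf id F) z
      (germAt _ _ (dir z) (farSec F S continuous_id φ v))) =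
      germAt _ _ z (farSec F S continuous_dir φ v) :=
  (stalkMap_comparison_germAt F (V := dirChart continuous_id φ) hz _).trans <|
    congrArg (fun t => germAt _ (dirChart continuous_dir φ) z
      (secMap (toFar dir F (directionBound S)) (dirChart continuous_dir φ) t))
      (secMap_dirBaseChange_transformSec (fst_mem_slitDomain continuous_id φ le_rfl)
        (fst_mem_slitDomain continuous_dir φ le_rfl) v)

theorem exists_pullStalk_germAt_farSec_eq (hS : IsConstructible S F) (hF : IsAcyclic F) {z : Cstar}
    (hz : z ∈ dirChart continuous_dir φ) (x : stk ((piPull k).obj (farSheaf id F)) z) :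
    ∃ v : sec F (slitDomain S φ), pullStalk dirMap (farSheaf id F) z
      (germAt _ _ (dir z) (farSec F S continuous_id φ v)) = x := by
  obtain ⟨a, rfl⟩ := pullStalk_surjective x
  obtain ⟨v, hv⟩ := (germAt_farSec_bijective hS hF continuous_id (φ := φ) (y := dir z) hz).2 a
  exact ⟨v, congrArg _ hv⟩

theorem isIso_comparison (hS : IsConstructible S F) (hF : IsAcyclic F) :
    IsIso (comparison F) := by
  refine isIso_of_stalkMap_bijective _ fun z => ?_
  have hz := self_mem_dirChart continuous_dir z
  have h_far := germAt_farSec_bijective hS hF continuous_dir hz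
  refine ⟨fun x y h => ?_, fun y => ?_⟩
  · obtain ⟨v, rfl⟩ := exists_pullStalk_germAt_farSec_eq hS hF hz x
    obtain ⟨w, rfl⟩ := exists_pullStalk_germAt_farSec_eq hS hF hz y
    rw [stalkMap_comparison_farSec hz, stalkMap_comparison_farSec hz] at h
    rw [h_far.1 h]
  · obtain ⟨v, rfl⟩ := h_far.2 y
    exact ⟨_, stalkMap_comparison_farSec hz v⟩

end Comparison

/-! ### The isomorphism of co-Stokes sheaves -/

section Isomorphism

variable {k : Type} [Field k]

section SheafPair

variable {A B : SheafPair k} (f : A.L ⟶ B.L) (hf : IsIso f)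
  (h : ∀ z x, x ∈ stalkRange A.incl z ↔ stalkMap f z x ∈ stalkRange B.incl z)
include hf h

theorem IsCoStokesSheaf.of_isIso {S : Finset ℂ} (hB : IsCoStokesSheaf S B) [hA : Mono A.incl] :
    IsCoStokesSheaf S A := by
  refine ⟨hA, fun z₀ => ?_⟩
  obtain ⟨U, hU, gr, hgr, t, ht⟩ := hB.2 z₀
  refine ⟨U, hU, gr, hgr, secMap (inv f) U ∘ₗ t, fun z hz => ?_⟩
  have h_germ (x : ∀ c : S, gr c) : germ A.L U z hz (secMap (inv f) U (t x)) =
      stalkMap (inv f) z (germ B.L U z hz (t x)) := by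
    rw [← germAt_of_mem hz, ← germAt_of_mem hz, stalkMap_germAt]
  constructor
  · convert (stalkMap_bijective_of_isIso (inv f) z).comp (ht z hz).1 using 1
    exact funext h_germ
  · intro x
    refine (h z _).trans (Iff.trans (iff_of_eq ?_) ((ht z hz).2 x))
    refine congrArg (· ∈ stalkRange B.incl z) ((congrArg (stalkMap f z) (h_germ x)).trans ?_)
    rw [← stalkMap_comp, IsIso.inv_hom_id, stalkMap_id]

theorem SheafPair.exists_iso_of_isIso [Mono A.incl] [Mono B.incl] : ∃ e : A ≅ B, e.hom.hom = f := by
  have h_hom : ∃ g : A.G ⟶ B.G, g ≫ B.incl = A.incl ≫ f := by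
    refine exists_lift_of_stalkRange_le _ _ fun z => ?_
    rintro _ ⟨a, rfl⟩
    rw [stalkMap_comp]
    exact (h z _).1 ⟨a, rfl⟩
  have h_inv : ∃ g : B.G ⟶ A.G, g ≫ A.incl = B.incl ≫ inv f :=
    exists_lift_of_stalkRange_le _ _ fun z x hx =>
      (h z x).2 ((mem_stalkRange_comp_inv_iff B.incl f).1 hx)
  exact ⟨{ hom := ⟨f, h_hom⟩
           inv := ⟨inv f, h_inv⟩
           hom_inv_id := SheafPair.Hom.ext (IsIso.hom_inv_id f)
           inv_hom_id := SheafPair.Hom.ext (IsIso.inv_hom_id f) }, rfl⟩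

end SheafPair

theorem log_norm_eq_reDir_of_mem_circ {z : Cstar} {ξ : ℂ} (h : z ∈ circ ξ) :
    Real.log ‖(z : ℂ)‖ = reDir (dir z) ξ :=
  (congrArg Real.log h).trans (Real.log_exp _)

theorem exists_mem_circ (z : Cstar) : ∃ ξ : ℂ, z ∈ circ ξ := by
  refine ⟨Real.log ‖(z : ℂ)‖ • (dir z : ℂ), ?_⟩
  rw [circ, Set.mem_ofPred_eq, reDir_smul, reDir_self, mul_one, Real.exp_log (norm_pos_iff.2 z.2)]

theorem mem_prescribed_iff {A : FilteredSheaf k} {z : Cstar} {x : stk ((piPull k).obj A.L) z} :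
    x ∈ prescribed A z ↔ ∀ ξ, z ∈ circ ξ → x ∈ stalkRange ((piPull k).map (A.incl ξ)) z := by
  simp only [prescribed, Submodule.mem_iInf]

variable {F : Sh k ℂ} {S : Finset ℂ}

theorem isCoStokesStructure_Psi (hS : IsConstructible S F) (hF : IsAcyclic F) :
    IsCoStokesStructure S ((Psi k).obj F) :=
  isCoStokesStructure_of_isFarRestriction hS hF _ (isFarRestriction_incSAt F)

variable {ι : directG k ⟶ directL k}

theorem isCoStokesSheaf_pairFunctor (hS : IsConstructible S F) (hF : IsAcyclic F)
    (hι : IsRestriction ι) : IsCoStokesSheaf S ((pairFunctor ι).obj F) :=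
  isCoStokesSheaf_of_isFarRestriction hS hF (ι.app F) (isFarRestriction_of_isRestriction F hι)

-- For `z ∈ S_ξ`, both sides say that a section on a slit domain extends over every `c ∈ S` with
-- `log |z| = Re (ξ e^{-iθ}) ≤ Re (c e^{-iθ})`.
theorem mem_stalkRange_piPull_incl_iff (hS : IsConstructible S F) (hF : IsAcyclic F)
    (hι : IsRestriction ι) {z : Cstar} {ξ : ℂ} (hξ : z ∈ circ ξ)
    (x : stk ((piPull k).obj (farSheaf id F)) z) :
    x ∈ stalkRange ((piPull k).map (((Psi k).obj F).incl ξ)) z ↔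
      stalkMap (comparison F) z x ∈ stalkRange (ι.app F) z := by
  obtain ⟨ε, _, hε⟩ := exists_isSeparating S
  obtain ⟨φ, hz, hφ⟩ := hε (dir z)
  obtain ⟨v, rfl⟩ := exists_pullStalk_germAt_farSec_eq hS hF (φ := φ) (z := z) hz x
  refine (pullStalk_mem_stalkRange_iff (((Psi k).obj F).incl ξ)).trans ?_
  refine ((isHalfPlaneFamily_incSAt ξ).germAt_farSec_mem_stalkRange_iff hS hF continuous_id hφ
    (isFarRestriction_incSAt F ξ) hz).trans ?_
  rw [stalkMap_comparison_farSec (φ := φ) hz]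
  refine Iff.symm ((isHalfPlaneFamily_incH.germAt_farSec_mem_stalkRange_iff hS hF continuous_dir hφ
    (isFarRestriction_of_isRestriction F hι) hz).trans ?_)
  rw [log_norm_eq_reDir_of_mem_circ hξ]
  exact Iff.rfl

theorem mem_prescribed_Psi_iff (hS : IsConstructible S F) (hF : IsAcyclic F)
    (hι : IsRestriction ι) {z : Cstar} (x : stk ((piPull k).obj (farSheaf id F)) z) :
    x ∈ prescribed ((Psi k).obj F) z ↔
      stalkMap (comparison F) z x ∈ stalkRange (ι.app F) z := by
  have h_iff {ξ} (hξ : z ∈ circ ξ) := mem_stalkRange_piPull_incl_iff hS hF hι hξ x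
  obtain ⟨ξ, hξ⟩ := exists_mem_circ z
  refine mem_prescribed_iff.trans ⟨fun h => (h_iff hξ).1 (h ξ hξ), fun h ξ' hξ' => (h_iff hξ').2 h⟩

theorem mem_stalkRange_sigma_Psi_iff (hS : IsConstructible S F) (hF : IsAcyclic F)
    (hι : IsRestriction ι) {z : Cstar} (x : stk ((piPull k).obj (farSheaf id F)) z) :
    x ∈ stalkRange ((sigma k).obj ((Psi k).obj F)).incl z ↔
      stalkMap (comparison F) z x ∈ stalkRange (ι.app F) z :=
  mem_stalkRange_subSheafIncl_iff_of_isIso (A := (piPull k).obj (farSheaf id F)) (ι.app F)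
    (comparison F) (isIso_comparison hS hF) fun _ => mem_prescribed_Psi_iff hS hF hι

theorem hasPrescribedStalks_Psi (hS : IsConstructible S F) (hF : IsAcyclic F)
    (hι : IsRestriction ι) : HasPrescribedStalks ((Psi k).obj F) := fun _ _ hξ =>
  Submodule.ext fun x => (mem_stalkRange_sigma_Psi_iff hS hF hι x).trans
    (mem_stalkRange_piPull_incl_iff hS hF hι hξ x).symm

instance mono_sigma_incl (A : FilteredSheaf k) : Mono ((sigma k).obj A).incl :=
  mono_subSheafIncl _ _

theorem isCoStokesSheaf_sigma_Psi (hS : IsConstructible S F) (hF : IsAcyclic F)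
    (hι : IsRestriction ι) : IsCoStokesSheaf S ((sigma k).obj ((Psi k).obj F)) :=
  IsCoStokesSheaf.of_isIso (A := (sigma k).obj ((Psi k).obj F)) (B := (pairFunctor ι).obj F)
    (comparison F) (isIso_comparison hS hF) (fun _ => mem_stalkRange_sigma_Psi_iff hS hF hι)
    (isCoStokesSheaf_pairFunctor hS hF hι)

theorem exists_iso_sigma_Psi_pairFunctor (hS : IsConstructible S F) (hF : IsAcyclic F)
    (hι : IsRestriction ι) :
    ∃ e : (sigma k).obj ((Psi k).obj F) ≅ (pairFunctor ι).obj F, e.hom.hom = comparison F :=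
  have : Mono ((pairFunctor ι).obj F).incl := (isCoStokesSheaf_pairFunctor hS hF hι).1
  SheafPair.exists_iso_of_isIso (A := (sigma k).obj ((Psi k).obj F))
    (B := (pairFunctor ι).obj F) (comparison F) (isIso_comparison hS hF)
    fun _ => mem_stalkRange_sigma_Psi_iff hS hF hι

theorem nonempty_iso_sigma_Psi_pairFunctor (hι : IsRestriction ι) :
    Nonempty ((Constr₀ k).ι ⋙ Psi k ⋙ sigma k ≅ (Constr₀ k).ι ⋙ pairFunctor ι) := by
  have h_iso (F : (Constr₀ k).FullSubcategory) :
      ∃ e : (sigma k).obj ((Psi k).obj F.obj) ≅ (pairFunctor ι).obj F.obj,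
        e.hom.hom = comparison F.obj := by
    obtain ⟨⟨S, hS⟩, hF⟩ := F.property
    exact exists_iso_sigma_Psi_pairFunctor hS hF hι
  choose e he using h_iso
  refine ⟨NatIso.ofComponents e fun {F F'} a => SheafPair.Hom.ext ?_⟩
  have h_nat := comparison_naturality a.hom
  rw [← he F, ← he F'] at h_nat
  exact h_nat

end Isomorphism

end TopLaplace

end

theorem mainTheorem11 (k : Type) [Field k] :
    ∃ ι : directG k ⟶ directL k,
      IsRestriction ι ∧ (∀ ι' : directG k ⟶ directL k, IsRestriction ι' → ι' = ι) ∧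
      (∀ F : Sh k ℂ, Constr₀ k F → ∀ S : Finset ℂ, IsConstructible S F →
        IsCoStokesStructure S ((Psi k).obj F) ∧
        HasPrescribedStalks ((Psi k).obj F) ∧
        IsCoStokesSheaf S ((sigma k).obj ((Psi k).obj F)) ∧
        IsCoStokesSheaf S ((pairFunctor ι).obj F)) ∧
      Nonempty ((Constr₀ k).ι ⋙ Psi k ⋙ sigma k ≅ (Constr₀ k).ι ⋙ pairFunctor ι) := by
  obtain ⟨ι, hι⟩ := exists_isRestriction k
  refine ⟨ι, hι, fun _ h => hι.unique h, fun F hF S hS => ?_,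
    nonempty_iso_sigma_Psi_pairFunctor hι⟩
  exact ⟨isCoStokesStructure_Psi hS hF.2, hasPrescribedStalks_Psi hS hF.2 hι,
    isCoStokesSheaf_sigma_Psi hS hF.2 hι, isCoStokesSheaf_pairFunctor hS hF.2 hι⟩
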